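/- Let $A=\bigoplus_{i\ge 0}A_i$ be a finite dimensional (basic) positively graded quasi-hereditary algebra over an algebraically closed field $k$, with a complete set $\{e_\lambda\}_{\lambda\in\Lambda}$ of pairwise orthogonal primitive idempotents of degree zero, $A_0=\bigoplus_\lambda k e_\lambda$, and a linear order on $\Lambda$ that defines the quasi-hereditary structure. We work in the category of finite dimensional graded left $A$-modules with homomorphisms of degree zero, and put $M\langle n\rangle_j=M_{n+j}$. Let $L(\lambda)$, $\Delta(\lambda)$, $\nabla(\lambda)$, $T(\lambda)$ be the simple, standard, costandard and indecomposable tilting modules, graded so that $L(\lambda)$ and the top of $\Delta(\lambda)$ and the socle of $\nabla(\lambda)$ are in degree $0$, and so that the unique composition factor of $T(\lambda)$ isomorphic to $L(\lambda)$ up to shift is in degree $0$. A complex $\cdots\to X_{i+1}\to X_i\to X_{i-1}\to\cdots$ of standard (respectively, tilting) modules is *linear* if each $X_i$ is a finite direct sum of modules $\Delta(\mu)\langle -i\rangle$ (respectively, $T(\mu)\langle -i\rangle$), $\mu\in\Lambda$. Assume that $A$ is *balanced*: each $\Delta(\lambda)$ has a finite linear tilting coresolution $0\to\Delta(\lambda)\to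 S_0\to S_{-1}\to\cdots$, and each $\nabla(\lambda)$ has a finite linear tilting resolution $\cdots\to C_1\to C_0\to\nabla(\lambda)\to 0$. A *BGG resolution* of $L(\lambda)$ is an exact complex $\cdots\to\Delta_1\to\Delta_0\xrightarrow{p}L(\lambda)\to0$ in which $\Delta_\bullet$ is a linear complex of standard modules. A *linear tilting complex representing $L(\lambda)$* is a bounded linear complex $T_\bullet$ of tilting modules together with an identification $H_0(T_\bullet)\cong L(\lambda)$, such that $H_i(T_\bullet)=0$ for $i\ne 0$. Let $\lambda\in\Lambda$ and assume that $L(\lambda)$ has a BGG resolution. Then: 1. All BGG resolutions of $L(\lambda)$ are isomorphic in the category of complexes: for any two of them, $(\Delta_\bullet,p)$ and $(\Delta'_\bullet,p')$, there is an isomorphism of complexes $f:\Delta_\bullet\to\Delta'_\bullet$ with $p'f_0=p$. 2. There is a linear tilting complex representing $L(\lambda)$. 3. For every linear tilting complex $T_\bullet$ representing $L(\lambda)$ there is a subcomplex $K_\bullet\subseteq T_\bullet$ such that for every BGG resolution $(\Delta_\bullet,p)$ of $L(\lambda)$ there is exactly one homomorphism of complexes $\varphi:\Delta_\bullet\to T_\bullet$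 that is compatible with the identifications of the homology in position $0$ with $L(\lambda)$, and this $\varphi$ is injective with image $K_\bullet$. (In particular, $K_\bullet$ does not depend on the BGG resolution.) -/

import Mathlib

open CategoryTheory

set_option linter.unusedSectionVars false

universe u w

namespace BGG

section GradedModules

variable {k A : Type u} [Field k] [Ring A] [Algebra k A]

/-- A criterion for an internal direct sum decomposition in terms of projections. -/
theorem isInternal_of_proj {M : Type u} [AddCommGroup M] [Module k M]
    (gr : ℤ → Submodule k M) (p : ℤ → M →ₗ[k] M)
    (hmem : ∀ i x, p i x ∈ gr i) (hid : ∀ i, ∀ x ∈ gr i, p i x = x)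
    (hne : ∀ i j, ∀ x ∈ gr i, j ≠ i → p j x = 0)
    (hsum : ∀ x, ∃ s : Finset ℤ, x = ∑ i ∈ s, p i x) : DirectSum.IsInternal gr := by
  classical
  constructor
  · rw [injective_iff_map_eq_zero]
    intro f hf
    have key : ∀ (g : DirectSum ℤ (fun i => gr i)) (i : ℤ),
        p i (DirectSum.coeAddMonoidHom gr g) = g i := by
      intro g i
      induction g using DirectSum.induction_on with
      | zero => simp
      | of j x =>
        rw [DirectSum.coeAddMonoidHom_of]
        by_cases h : i = j
        · subst h
          rw [hid _ _ x.2, DirectSum.of_eq_same]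
        · rw [hne j i x x.2 h, DirectSum.of_eq_of_ne _ _ _ h]
          rfl
      | add a b ha hb =>
        rw [map_add, map_add, ha, hb, DirectSum.add_apply]
        rfl
    ext i
    have := key f i
    rw [hf, map_zero] at this
    exact this.symm
  · intro x
    obtain ⟨s, hs⟩ := hsum x
    refine ⟨∑ i ∈ s, DirectSum.of (fun i => gr i) i ⟨p i x, hmem i x⟩, ?_⟩
    rw [map_sum]
    simp only [DirectSum.coeAddMonoidHom_of]
    exact hs.symm

/-- A finite dimensional `ℤ`-graded left module over the graded `k`-algebra `(A, 𝒜)`. -/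
structure GrMod (𝒜 : ℤ → Submodule k A) where
  carrier : Type u
  [isAddCommGroup : AddCommGroup carrier]
  [isModuleBase : Module k carrier]
  [isModule : Module A carrier]
  [isScalarTower : IsScalarTower k A carrier]
  [isFinite : Module.Finite k carrier]
  /-- the homogeneous components -/
  gr : ℤ → Submodule k carrier
  isInternal : DirectSum.IsInternal gr
  smul_mem : ∀ {i j : ℤ} {a : A} {x : carrier}, a ∈ 𝒜 i → x ∈ gr j → a • x ∈ gr (i + j)

namespace GrMod

variable {𝒜 : ℤ → Submodule k A}

instance : CoeSort (GrMod 𝒜) (Type u) := ⟨GrMod.carrier⟩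

attribute [instance] isAddCommGroup isModuleBase isModule isScalarTower isFinite

/-- The decomposition of a graded module into its homogeneous components. -/
noncomputable def decomp (M : GrMod 𝒜) : DirectSum ℤ (fun i => M.gr i) ≃ₗ[k] M :=
  LinearEquiv.ofBijective (DirectSum.coeLinearMap M.gr) M.isInternal

theorem decomp_apply (M : GrMod 𝒜) (x : DirectSum ℤ (fun i => M.gr i)) :
    M.decomp x = DirectSum.coeLinearMap M.gr x := rfl

/-- The projection onto the homogeneous component of degree `i`. -/
noncomputable def proj (M : GrMod 𝒜) (i : ℤ) : M →ₗ[k] M :=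
  (M.gr i).subtype ∘ₗ DirectSum.component k ℤ (fun i => M.gr i) i ∘ₗ M.decomp.symm.toLinearMap

theorem proj_mem (M : GrMod 𝒜) (i : ℤ) (x : M) : M.proj i x ∈ M.gr i :=
  Subtype.property (p := (· ∈ M.gr i)) _

theorem symm_of_mem (M : GrMod 𝒜) {i : ℤ} {x : M} (hx : x ∈ M.gr i) :
    M.decomp.symm x = DirectSum.lof k ℤ (fun i => M.gr i) i ⟨x, hx⟩ := by
  rw [LinearEquiv.symm_apply_eq, decomp_apply, DirectSum.coeLinearMap_lof]

theorem proj_of_mem (M : GrMod 𝒜) {i : ℤ} {x : M} (hx : x ∈ M.gr i) : M.proj i x = x := by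
  simp only [proj, LinearMap.comp_apply, LinearEquiv.coe_coe, symm_of_mem M hx]
  simp [DirectSum.component.lof_self]

theorem proj_of_mem_ne (M : GrMod 𝒜) {i j : ℤ} {x : M} (hx : x ∈ M.gr i) (h : j ≠ i) :
    M.proj j x = 0 := by
  simp only [proj, LinearMap.comp_apply, LinearEquiv.coe_coe, symm_of_mem M hx]
  rw [DirectSum.component.of, dif_neg (Ne.symm h)]
  simp

theorem exists_sum_proj (M : GrMod 𝒜) (x : M) : ∃ s : Finset ℤ, x = ∑ i ∈ s, M.proj i x := by
  classical
  set E := M.decomp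
  refine ⟨(E.symm x).support, ?_⟩
  have h1 : x = E (E.symm x) := (E.apply_symm_apply x).symm
  have h2 : E (E.symm x) = ∑ i ∈ (E.symm x).support, ((E.symm x) i : M) :=
    DirectSum.coeLinearMap_eq_dfinsuppSum _ _
  rw [h2] at h1
  exact h1

theorem smul_proj (M : GrMod 𝒜) {i : ℤ} {a : A} (ha : a ∈ 𝒜 i) (j : ℤ) (x : M) :
    M.proj (i + j) (a • x) = a • M.proj j x := by
  obtain ⟨s, hs⟩ := M.exists_sum_proj x
  have key : ∀ l, ∀ y ∈ M.gr l, M.proj (i + j) (a • y) = a • M.proj j y := by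
    intro l y hy
    by_cases h : j = l
    · subst h
      rw [M.proj_of_mem hy, M.proj_of_mem (M.smul_mem ha hy)]
    · rw [M.proj_of_mem_ne hy h, M.proj_of_mem_ne (M.smul_mem ha hy) (by omega), smul_zero]
  rw [hs, Finset.smul_sum, map_sum, map_sum, Finset.smul_sum]
  exact Finset.sum_congr rfl fun l _ => key l _ (M.proj_mem l x)

/-- The degree zero homomorphisms of graded modules. -/
def gradedHom (M N : GrMod 𝒜) : AddSubgroup (M →ₗ[A] N) where
  carrier := {f | ∀ i, ∀ x ∈ M.gr i, f x ∈ N.gr i}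
  zero_mem' := fun i _ _ => (N.gr i).zero_mem
  add_mem' := fun hf hg i x hx => (N.gr i).add_mem (hf i x hx) (hg i x hx)
  neg_mem' := fun hf i x hx => (N.gr i).neg_mem (hf i x hx)

/-- The category of finite dimensional graded modules and homomorphisms of degree zero. -/
instance : Category (GrMod 𝒜) where
  Hom M N := gradedHom M N
  id M := ⟨LinearMap.id, fun _ _ hx => hx⟩
  comp f g := ⟨g.1 ∘ₗ f.1, fun i _ hx => g.2 i _ (f.2 i _ hx)⟩

/-- The `A`-linear map underlying a morphism of graded modules. -/
def toLin {M N : GrMod 𝒜} (f : M ⟶ N) : M →ₗ[A] N := f.1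

/-- A degree zero homomorphism as a morphism of graded modules. -/
def ofLin {M N : GrMod 𝒜} (f : M →ₗ[A] N) (hf : ∀ i, ∀ x ∈ M.gr i, f x ∈ N.gr i) : M ⟶ N :=
  ⟨f, hf⟩

instance : Preadditive (GrMod 𝒜) where
  homGroup M N := inferInstanceAs (AddCommGroup (gradedHom M N))
  add_comp _ _ _ f f' g := Subtype.ext (LinearMap.comp_add f.1 f'.1 g.1)
  comp_add _ _ _ f g g' := Subtype.ext (LinearMap.add_comp f.1 g'.1 g.1)

/-- The shift of grading `M⟨n⟩`, with `M⟨n⟩_j = M_{n+j}`. -/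
def shift (M : GrMod 𝒜) (n : ℤ) : GrMod 𝒜 where
  carrier := M
  gr j := M.gr (n + j)
  isInternal := by
    refine isInternal_of_proj _ (fun j => M.proj (n + j)) (fun j x => M.proj_mem _ x)
      (fun j x hx => M.proj_of_mem hx) (fun i j x hx h => M.proj_of_mem_ne hx (by omega)) ?_
    intro x
    obtain ⟨s, hs⟩ := M.exists_sum_proj x
    refine ⟨s.map (Equiv.subRight n).toEmbedding, ?_⟩
    rw [Finset.sum_map]
    simpa using hs
  smul_mem {i j a x} ha hx := by
    have := M.smul_mem ha hx
    rwa [show n + (i + j) = i + (n + j) by ring]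

/-- A submodule is homogeneous if it contains the homogeneous components of its elements. -/
def IsHomogeneous (M : GrMod 𝒜) (N : Submodule A M) : Prop :=
  ∀ x ∈ N, ∀ i, M.proj i x ∈ N

/-- A homogeneous submodule as a graded module. -/
def sub (M : GrMod 𝒜) (N : Submodule A M) (hN : M.IsHomogeneous N) : GrMod 𝒜 where
  carrier := N
  isFinite := Module.Finite.of_injective (N.subtype.restrictScalars k) Subtype.val_injective
  gr j := (M.gr j).comap (N.subtype.restrictScalars k)
  isInternal := by
    refine isInternal_of_proj _
      (fun j => ((M.proj j).comp (N.subtype.restrictScalars k)).codRestrict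
        (N.restrictScalars k) (fun x => hN x.1 x.2 j)) ?_ ?_ ?_ ?_
    · intro j x
      exact M.proj_mem j x.1
    · intro j x hx
      exact Subtype.ext (M.proj_of_mem hx)
    · intro i j x hx h
      exact Subtype.ext (M.proj_of_mem_ne hx h)
    · intro x
      obtain ⟨s, hs⟩ := M.exists_sum_proj x.1
      refine ⟨s, Subtype.ext ?_⟩
      rw [AddSubmonoidClass.coe_finsetSum]
      exact hs
  smul_mem ha hx := M.smul_mem ha hx

/-- The quotient of a graded module by a homogeneous submodule. -/
def quot (M : GrMod 𝒜) (N : Submodule A M) (hN : M.IsHomogeneous N) : GrMod 𝒜 where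
  carrier := M ⧸ N
  isFinite := Module.Finite.of_surjective (N.mkQ.restrictScalars k) N.mkQ_surjective
  gr j := (M.gr j).map (N.mkQ.restrictScalars k)
  isInternal := by
    refine isInternal_of_proj _
      (fun j => (N.restrictScalars k).mapQ (N.restrictScalars k) (M.proj j)
        (fun x hx => hN x hx j)) ?_ ?_ ?_ ?_
    · intro j x
      obtain ⟨y, rfl⟩ := N.mkQ_surjective x
      exact ⟨M.proj j y, M.proj_mem j y, rfl⟩
    · rintro j _ ⟨y, hy, rfl⟩
      exact congrArg N.mkQ (M.proj_of_mem hy)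
    · rintro i j _ ⟨y, hy, rfl⟩ h
      exact (congrArg N.mkQ (M.proj_of_mem_ne hy h)).trans (map_zero _)
    · intro x
      obtain ⟨y, rfl⟩ := N.mkQ_surjective x
      obtain ⟨s, hs⟩ := M.exists_sum_proj y
      refine ⟨s, ?_⟩
      exact (congrArg N.mkQ hs).trans (map_sum N.mkQ _ _)
  smul_mem {i j a x} ha hx := by
    obtain ⟨y, hy, rfl⟩ := hx
    exact ⟨a • y, M.smul_mem ha hy, rfl⟩

theorem isHomogeneous_span (M : GrMod 𝒜) [GradedAlgebra 𝒜] (S : Set M)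
    (hS : ∀ x ∈ S, ∀ i, M.proj i x ∈ Submodule.span A S) :
    M.IsHomogeneous (Submodule.span A S) := by
  classical
  have key : ∀ (l : ℤ) (b : A), b ∈ 𝒜 l → ∀ y, (∀ i, M.proj i y ∈ Submodule.span A S) →
      ∀ i, M.proj i (b • y) ∈ Submodule.span A S := by
    intro l b hb y hy i
    have := M.smul_proj hb (i - l) y
    rw [show l + (i - l) = i by ring] at this
    rw [this]
    exact Submodule.smul_mem _ _ (hy _)
  intro x hx
  induction hx using Submodule.span_induction with
  | mem x h => exact hS x h
  | zero => intro i; rw [map_zero]; exact Submodule.zero_mem _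
  | add x y _ _ hx hy => intro i; rw [map_add]; exact Submodule.add_mem _ (hx i) (hy i)
  | smul a x _ hx =>
    intro i
    rw [← DirectSum.sum_support_decompose 𝒜 a, Finset.sum_smul, map_sum]
    exact Submodule.sum_mem _ fun l _ => key l _ (SetLike.coe_mem _) x hx i

theorem isHomogeneous_ker {M N : GrMod 𝒜} (f : M ⟶ N) :
    M.IsHomogeneous (LinearMap.ker (toLin f)) := by
  intro x hx i
  have key : ∀ y, toLin f (M.proj i y) = N.proj i (toLin f y) := by
    intro y
    obtain ⟨s, hs⟩ := M.exists_sum_proj y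
    have h1 : ∀ l, ∀ z ∈ M.gr l, toLin f (M.proj i z) = N.proj i (toLin f z) := by
      intro l z hz
      have hfz : toLin f z ∈ N.gr l := f.2 l z hz
      by_cases h : i = l
      · subst h
        rw [M.proj_of_mem hz, N.proj_of_mem hfz]
      · rw [M.proj_of_mem_ne hz h, N.proj_of_mem_ne hfz h, map_zero]
    rw [hs, map_sum, map_sum, map_sum, map_sum]
    exact Finset.sum_congr rfl fun l _ => h1 l _ (M.proj_mem l y)
  rw [LinearMap.mem_ker] at hx ⊢
  rw [key, hx, map_zero]

/-- The kernel of a morphism, as a graded module. -/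
def kernel {M N : GrMod 𝒜} (f : M ⟶ N) : GrMod 𝒜 :=
  M.sub (LinearMap.ker (toLin f)) (isHomogeneous_ker f)

/-- `M` is a finite direct sum of modules that have the property `S`. -/
def IsDirectSumOf (S : GrMod 𝒜 → Prop) (M : GrMod 𝒜) : Prop :=
  ∃ (n : ℕ) (F : Fin n → GrMod 𝒜), (∀ j, S (F j)) ∧
    ∃ b : Limits.Bicone F, Nonempty b.IsBilimit ∧ Nonempty (M ≅ b.pt)

/-- `M` has a finite filtration by graded submodules whose subquotients have the property `S`. -/
inductive HasFiltration (S : GrMod 𝒜 → Prop) : GrMod 𝒜 → Prop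
  | zero (M : GrMod 𝒜) (h : Subsingleton M) : HasFiltration S M
  | extension {N M Q : GrMod 𝒜} (f : N ⟶ M) (g : M ⟶ Q)
      (hf : Function.Injective (toLin f)) (hfg : Function.Exact (toLin f) (toLin g))
      (hg : Function.Surjective (toLin g)) (hN : HasFiltration S N) (hQ : S Q) :
      HasFiltration S M

/-- Indecomposability, by idempotent endomorphisms. -/
def IsIndecomposable (M : GrMod 𝒜) : Prop :=
  Nontrivial M ∧ ∀ f : M ⟶ M, f ≫ f = f → f = 0 ∨ f = 𝟙 M

end GrMod

end GradedModules

section Algebra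

variable {k A : Type u} [Field k] [Ring A] [Algebra k A]
variable {Λ : Type w} [Fintype Λ]

/-- `(A, 𝒜)` is a (basic) positively graded algebra with complete set of pairwise orthogonal
primitive idempotents `e`: there are no elements of negative degree, and `A_0` is the semisimple
algebra `⨁ k e_λ` (so that the radical of `A` is `⨁_{i > 0} A_i`). -/
structure IsPositivelyGraded (𝒜 : ℤ → Submodule k A) (e : Λ → A) : Prop where
  neg : ∀ i < 0, 𝒜 i = ⊥
  idem : CompleteOrthogonalIdempotents e
  ne_zero : ∀ l, e l ≠ 0
  zero : 𝒜 0 = Submodule.span k (Set.range e)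

theorem IsPositivelyGraded.mem {𝒜 : ℤ → Submodule k A} {e : Λ → A}
    (h : IsPositivelyGraded 𝒜 e) (l : Λ) : e l ∈ 𝒜 0 := by
  rw [h.zero]
  exact Submodule.subset_span ⟨l, rfl⟩

variable [Module.Finite k A] (𝒜 : ℤ → Submodule k A) [GradedAlgebra 𝒜]

open GrMod

/-- The left regular module. -/
def regular : GrMod 𝒜 where
  carrier := A
  gr := 𝒜
  isInternal := DirectSum.Decomposition.isInternal 𝒜
  smul_mem ha hx := SetLike.GradedMul.mul_mem ha hx

/-- The left module structure on `Hom_k(A, k)`, where `(a • f) x = f (x * a)`. -/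
@[reducible] def dualModule : Module A (Module.Dual k A) where
  smul a f := f ∘ₗ LinearMap.mulRight k a
  one_smul f := LinearMap.ext fun x => congrArg f (mul_one x)
  mul_smul a b f := LinearMap.ext fun x => congrArg f (mul_assoc x a b).symm
  smul_zero _ := rfl
  smul_add _ _ _ := rfl
  add_smul a b f := LinearMap.ext fun x => (congrArg f (mul_add x a b)).trans (map_add f _ _)
  zero_smul f := LinearMap.ext fun x => (congrArg f (mul_zero x)).trans (map_zero f)

/-- The dual `Hom_k(A, k)` of the right regular module; its component of degree `j` consists of
the functionals supported on `A_{-j}`. -/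
def dualRegular : GrMod 𝒜 :=
  letI := dualModule (k := k) (A := A)
  { carrier := Module.Dual k A
    isScalarTower := ⟨fun c a f => LinearMap.ext fun x => by
      change f (x * (c • a)) = c • f (x * a)
      rw [mul_smul_comm, map_smul]⟩
    gr := fun j =>
      { carrier := {f | ∀ i, i ≠ -j → ∀ x ∈ 𝒜 i, f x = 0}
        zero_mem' := fun _ _ _ _ => rfl
        add_mem' := fun {f g} hf hg i hi x hx => by
          rw [LinearMap.add_apply, hf i hi x hx, hg i hi x hx, add_zero]
        smul_mem' := fun c f hf i hi x hx => by
          rw [LinearMap.smul_apply, hf i hi x hx, smul_zero] }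
    isInternal := by
      classical
      refine isInternal_of_proj _
        (fun j => Module.Dual.transpose (R := k) (GradedAlgebra.proj 𝒜 (-j))) ?_ ?_ ?_ ?_
      · intro j f i hi x hx
        change f (DirectSum.decompose 𝒜 x (-j)) = 0
        rw [DirectSum.decompose_of_mem_ne 𝒜 hx hi, map_zero]
      · intro j f hf
        refine LinearMap.ext fun x => ?_
        change f (DirectSum.decompose 𝒜 x (-j)) = f x
        induction x using DirectSum.Decomposition.inductionOn 𝒜 with
        | zero => simp
        | @homogeneous l m =>
          by_cases hl : l = -j
          · subst hl
            rw [DirectSum.decompose_of_mem_same 𝒜 m.2]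
          · rw [DirectSum.decompose_of_mem_ne 𝒜 m.2 hl, map_zero, hf l hl m m.2]
        | add x y hx hy =>
          rw [DirectSum.decompose_add, DirectSum.add_apply, Submodule.coe_add, map_add, map_add,
            hx, hy]
      · intro i j f hf hij
        exact LinearMap.ext fun x => hf (-j) (by omega) _ (SetLike.coe_mem _)
      · intro f
        let b := Module.finBasis k A
        let t : Finset ℤ := Finset.univ.biUnion fun m => (DirectSum.decompose 𝒜 (b m)).support
        refine ⟨t.map (Equiv.neg ℤ).toEmbedding, b.ext fun m => ?_⟩
        rw [Finset.sum_map, LinearMap.sum_apply]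
        simp only [Equiv.coe_toEmbedding, Equiv.neg_apply, neg_neg]
        change f (b m) = ∑ i ∈ t, f (DirectSum.decompose 𝒜 (b m) i)
        have h1 : (DirectSum.decompose 𝒜 (b m)).support ⊆ t :=
          Finset.subset_biUnion_of_mem (fun m => (DirectSum.decompose 𝒜 (b m)).support)
            (Finset.mem_univ m)
        rw [← Finset.sum_subset h1, ← map_sum, DirectSum.sum_support_decompose]
        intro i _ hi
        rw [DFinsupp.notMem_support_iff.mp hi]
        exact map_zero f
    smul_mem := by
      intro i j a f ha hf l hl x hx
      change f (x * a) = 0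
      exact hf (l + i) (by omega) _ (SetLike.GradedMul.mul_mem hx ha) }

variable {𝒜} {e : Λ → A} (h : IsPositivelyGraded 𝒜 e)

/-- The indecomposable projective module `P(λ) = A e_λ`. -/
def P (l : Λ) : GrMod 𝒜 :=
  (regular 𝒜).sub (Submodule.span A {e l}) <| by
    refine (regular 𝒜).isHomogeneous_span _ ?_
    rintro x rfl i
    by_cases hi : i = 0
    · subst hi
      rw [(regular 𝒜).proj_of_mem (h.mem l)]
      exact Submodule.subset_span rfl
    · rw [(regular 𝒜).proj_of_mem_ne (h.mem l) hi]
      exact Submodule.zero_mem _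

theorem proj_smul_e (h : IsPositivelyGraded 𝒜 e) (M : GrMod 𝒜) (l : Λ) (i : ℤ) (x : M) :
    M.proj i (e l • x) = e l • M.proj i x := by
  simpa using M.smul_proj (h.mem l) i x

/-- The radical `A_{>0} M` of a graded module. -/
def radical (M : GrMod 𝒜) : Submodule A M :=
  Submodule.span A {x | ∃ i : ℤ, 0 < i ∧ ∃ a ∈ 𝒜 i, ∃ y : M, x = a • y}

theorem isHomogeneous_radical (M : GrMod 𝒜) : M.IsHomogeneous (radical M) := by
  refine M.isHomogeneous_span _ ?_
  rintro x ⟨i, hi, a, ha, y, rfl⟩ j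
  have := M.smul_proj ha (j - i) y
  rw [show i + (j - i) = j by ring] at this
  rw [this]
  exact Submodule.subset_span ⟨i, hi, a, ha, _, rfl⟩

/-- The simple module `L(λ)`, the top of `P(λ)`, concentrated in degree zero. -/
def L (l : Λ) : GrMod 𝒜 :=
  (P h l).quot (radical (P h l)) (isHomogeneous_radical _)

/-- The injective module `I(λ) = Hom_k(e_λ A, k)`, realized as the space of all functionals on `A`
that vanish on `(1 - e_λ) A`. -/
def I (l : Λ) : GrMod 𝒜 :=
  GrMod.kernel (M := dualRegular 𝒜) (N := dualRegular 𝒜)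
    (letI := dualModule (k := k) (A := A)
     ofLin (M := dualRegular 𝒜) (N := dualRegular 𝒜)
      ({ toFun := fun f : Module.Dual k A => f ∘ₗ LinearMap.mulLeft k (1 - e l)
         map_add' := fun _ _ => rfl
         map_smul' := fun a f => LinearMap.ext fun x =>
          congrArg f (mul_assoc (1 - e l) x a) } : Module.Dual k A →ₗ[A] Module.Dual k A) <| by
      intro j f hf i hi x hx
      have h1 : (1 - e l) ∈ 𝒜 0 := Submodule.sub_mem _ SetLike.GradedOne.one_mem (h.mem l)
      have h2 : (1 - e l) * x ∈ 𝒜 (0 + i) := SetLike.GradedMul.mul_mem h1 hx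
      exact hf i hi _ (by rwa [zero_add] at h2))

section Order

variable [LinearOrder Λ]

/-- The trace in `M` of all `P(μ)` with `μ > λ`. -/
def traceAbove (e : Λ → A) (M : GrMod 𝒜) (l : Λ) : Submodule A M :=
  Submodule.span A {x | ∃ m, l < m ∧ ∃ y : M, x = e m • y}

theorem isHomogeneous_traceAbove (h : IsPositivelyGraded 𝒜 e) (M : GrMod 𝒜) (l : Λ) :
    M.IsHomogeneous (traceAbove e M l) := by
  refine M.isHomogeneous_span _ ?_
  rintro x ⟨m, hm, y, rfl⟩ j
  rw [proj_smul_e h]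
  exact Submodule.subset_span ⟨m, hm, _, rfl⟩

/-- The standard module `Δ(λ)`, the largest quotient of `P(λ)` whose composition factors `L(μ)`
all satisfy `μ ≤ λ`. -/
def Δ (l : Λ) : GrMod 𝒜 :=
  (P h l).quot (traceAbove e (P h l) l) (isHomogeneous_traceAbove h _ l)

/-- The largest submodule of `M` all of whose composition factors `L(μ)` satisfy `μ ≤ λ`. -/
def below (e : Λ → A) (M : GrMod 𝒜) (l : Λ) : Submodule A M where
  carrier := {x | ∀ m, l < m → ∀ a : A, e m • a • x = 0}
  zero_mem' := fun m _ a => by rw [smul_zero, smul_zero]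
  add_mem' := fun hx hy m hm a => by rw [smul_add, smul_add, hx m hm a, hy m hm a, add_zero]
  smul_mem' := fun b x hx m hm a => by rw [← mul_smul a b x]; exact hx m hm _

theorem isHomogeneous_below (h : IsPositivelyGraded 𝒜 e) (M : GrMod 𝒜) (l : Λ) :
    M.IsHomogeneous (below e M l) := by
  classical
  intro x hx i m hm a
  rw [← DirectSum.sum_support_decompose 𝒜 a, Finset.sum_smul, Finset.smul_sum]
  refine Finset.sum_eq_zero fun j _ => ?_
  rw [← M.smul_proj (SetLike.coe_mem _) i x, ← proj_smul_e h, hx m hm, map_zero]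

/-- The costandard module `∇(λ)`. -/
def nabla (l : Λ) : GrMod 𝒜 :=
  (I h l).sub (below e (I h l) l) (isHomogeneous_below h _ l)

/-- The space `e_λ M`, whose dimension is the multiplicity of `L(λ)` (up to shifts) in `M`. -/
def weightSpace (e : Λ → A) (M : GrMod 𝒜) (l : Λ) : Submodule k M :=
  LinearMap.range (Module.toModuleEnd k (S := A) M (e l))

/-- `A` is quasi-hereditary with respect to the given order on `Λ`: the multiplicity
`[Δ(λ) : L(λ)]` is one, and the kernel of `P(λ) → Δ(λ)` has a filtration with subquotients
of the form `Δ(μ)` (up to shifts), where `μ > λ`. -/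
structure IsQuasiHereditary : Prop where
  multiplicity_one : ∀ l, Module.finrank k (weightSpace e (Δ h l) l) = 1
  filtration : ∀ l, HasFiltration (fun M => ∃ m n, l < m ∧ Nonempty (M ≅ (Δ h m).shift n))
    ((P h l).sub (traceAbove e (P h l) l) (isHomogeneous_traceAbove h _ l))

/-- `M` is (isomorphic to) the graded tilting module `T(λ)`: it is indecomposable, has both a
standard and a costandard filtration, its composition factors are of the form `L(μ)` with `μ ≤ λ`
up to shifts, and the factor `L(λ)` appears exactly once, in degree zero. -/
structure IsTilting (l : Λ) (M : GrMod 𝒜) : Prop where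
  indecomposable : M.IsIndecomposable
  standard : HasFiltration (fun N => ∃ m n, Nonempty (N ≅ (Δ h m).shift n)) M
  costandard : HasFiltration (fun N => ∃ m n, Nonempty (N ≅ (nabla h m).shift n)) M
  weight_le : ∀ m, l < m → weightSpace e M m = ⊥
  multiplicity_one : Module.finrank k (weightSpace e M l) = 1
  degree_zero : weightSpace e M l ≤ M.gr 0

/-- Complexes `⋯ → X_{i+1} → X_i → X_{i-1} → ⋯` of graded modules. -/
abbrev Cplx (𝒜 : ℤ → Submodule k A) := ChainComplex (GrMod 𝒜) ℤ

/-- Exactness of a complex at position `i`. -/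
def ExactAt (X : Cplx 𝒜) (i : ℤ) : Prop :=
  Function.Exact (toLin (X.d (i + 1) i)) (toLin (X.d i (i - 1)))

/-- A linear complex of standard modules: `X_i` is a direct sum of modules `Δ(μ)⟨-i⟩`. -/
def IsLinearStandard (X : Cplx 𝒜) : Prop :=
  ∀ i, (X.X i).IsDirectSumOf fun M => ∃ m, Nonempty (M ≅ (Δ h m).shift (-i))

/-- A bounded linear complex of tilting modules: `X_i` is a direct sum of modules `T(μ)⟨-i⟩`,
and it is zero for all but finitely many `i`. -/
structure IsLinearTilting (X : Cplx 𝒜) : Prop where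
  linear : ∀ i, (X.X i).IsDirectSumOf fun M => ∃ m, IsTilting h m (M.shift i)
  bounded : ∃ n : ℕ, ∀ i : ℤ, (n : ℤ) < |i| → Subsingleton (X.X i)

/-- The complex `0 → M → X_0 → X_{-1} → ⋯` is exact. -/
structure IsCoresolution (M : GrMod 𝒜) (X : Cplx 𝒜) (f : M ⟶ X.X 0) : Prop where
  zero : ∀ i, 0 < i → Subsingleton (X.X i)
  injective : Function.Injective (toLin f)
  exact_zero : Function.Exact (toLin f) (toLin (X.d 0 (-1)))
  exact : ∀ i < 0, ExactAt X i

/-- The complex `⋯ → X_1 → X_0 → M → 0` is exact. -/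
structure IsResolution (M : GrMod 𝒜) (X : Cplx 𝒜) (f : X.X 0 ⟶ M) : Prop where
  zero : ∀ i < 0, Subsingleton (X.X i)
  surjective : Function.Surjective (toLin f)
  exact_zero : Function.Exact (toLin (X.d 1 0)) (toLin f)
  exact : ∀ i, 0 < i → ExactAt X i

/-- `A` is balanced: standard modules have linear tilting coresolutions, and costandard modules
have linear tilting resolutions. -/
structure IsBalanced : Prop where
  standard : ∀ l, ∃ (X : Cplx 𝒜) (f : Δ h l ⟶ X.X 0), IsLinearTilting h X ∧ IsCoresolution _ X f
  costandard : ∀ l, ∃ (X : Cplx 𝒜) (f : X.X 0 ⟶ nabla h l),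
    IsLinearTilting h X ∧ IsResolution _ X f

/-- The complex `X`, with the augmentation `p : X_0 → L(λ)`, is a BGG complex of `L(λ)`. -/
structure IsBGGComplex (l : Λ) (X : Cplx 𝒜) (p : X.X 0 ⟶ L h l) : Prop where
  linear : IsLinearStandard h X
  zero : ∀ i < 0, Subsingleton (X.X i)
  surjective : Function.Surjective (toLin p)
  d_comp : X.d 1 0 ≫ p = 0

/-- A BGG resolution of `L(λ)` is an exact BGG complex. -/
structure IsBGGResolution (l : Λ) (X : Cplx 𝒜) (p : X.X 0 ⟶ L h l) : Prop
    extends IsBGGComplex h l X p where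
  exact : IsResolution (L h l) X p

/-- The complex `T` is a linear complex of tilting modules that represents `L(λ)`: its homology is
zero except in position `0`, where it is identified with `L(λ)` by means of the map `r` from the
module of cycles. -/
structure IsTiltingModel (l : Λ) (T : Cplx 𝒜) (r : GrMod.kernel (T.d 0 (-1)) ⟶ L h l) : Prop where
  linear : IsLinearTilting h T
  exact : ∀ i, i ≠ 0 → ExactAt T i
  surjective : Function.Surjective (toLin r)
  ker : ∀ z : GrMod.kernel (T.d 0 (-1)), toLin r z = 0 ↔ ∃ y, toLin (T.d 1 0) y = z.1

/-- A chain map `f` from an augmented complex to a tilting model is compatible with the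
identifications with `L(λ)` in homology. -/
def Compatible {l : Λ} {X T : Cplx 𝒜} (p : X.X 0 ⟶ L h l)
    (r : GrMod.kernel (T.d 0 (-1)) ⟶ L h l) (f : X ⟶ T) : Prop :=
  ∀ x : X.X 0, ∃ hx : toLin (f.f 0) x ∈ LinearMap.ker (toLin (T.d 0 (-1))),
    toLin r ⟨toLin (f.f 0) x, hx⟩ = toLin p x

/-- A subcomplex: homogeneous submodules that are stable under the differential. -/
structure Subcomplex (T : Cplx 𝒜) where
  obj : ∀ i, Submodule A (T.X i)
  homogeneous : ∀ i, (T.X i).IsHomogeneous (obj i)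
  d_mem : ∀ i, ∀ x ∈ obj i, toLin (T.d i (i - 1)) x ∈ obj (i - 1)

end Order

end Algebra

end BGG

/-! Degree zero maps from `Δ(m)⟨-i⟩` to `M` are the highest weight vectors of weight `m` and degree
`i` in `M`, so maps out of linear complexes of standard modules are governed by the degrees of such
vectors. In a BGG resolution the term in position `i` starts in degree `i`, and its degree `i` part
is spanned by generators. In a linear tilting complex, highest weight vectors in position `i` have
degree at least `i` (`IsTilting.eq_zero_of_isHW`). This is where tilting resolutions of costandard
modules enter: `T(l)` embeds into the term in position `0` of the resolution of `∇(l)`, the term in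
position `1` involves only `T(κ)⟨-1⟩` with `κ < l`, and one inducts on `l`.

The second ingredient is Ext-orthogonality. The classes `Good` and `CoGood` contain the modules with
standard and costandard filtrations; tilting modules lie in both. Closure properties make the cycles
of tilting complexes `CoGood` to the left of the homology and `Good` to the right, so highest weight
vectors lift along the differentials (`IsHW.exists_lift`). Lifting gives existence and the degree
bound gives uniqueness of compatible chain maps from a BGG resolution; `HWLifting` treats BGG
resolutions and tilting models as targets alike. Uniqueness of BGG resolutions is then formal.

A BGG resolution is bounded, since weights drop strictly along it. Gluing tilting coresolutions of
its terms by iterated twisted sums gives a linear tilting complex `T₀` that contains the resolution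
with acyclic quotient, hence represents `L(l)`. For an arbitrary tilting model `T`, Ext-vanishing
yields a compatible chain map from `T` to `T₀`. By uniqueness, its composite with the map from the
resolution to `T` is the inclusion into `T₀`, so the map to `T` is injective. Its image does not
depend on the resolution, because all BGG resolutions are isomorphic over `L(l)`. -/

namespace BGG

/-! ### Vanishing of Ext groups and dimension shifting -/

section ExtVanishing

open Abelian

variable {R : Type u} [Ring R]
variable {X Y Z M N : Type u} [AddCommGroup X] [Module R X] [AddCommGroup Y] [Module R Y]
  [AddCommGroup Z] [Module R Z] [AddCommGroup M] [Module R M] [AddCommGroup N] [Module R N]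

/-- The vanishing of `Ext^n(M, N)`. -/
def ExtVanishes (R : Type u) [Ring R] (M N : Type u) [AddCommGroup M] [Module R M]
    [AddCommGroup N] [Module R N] (n : ℕ) : Prop :=
  ∀ x : Ext (ModuleCat.of R M) (ModuleCat.of R N) n, x = 0

theorem shortExact_of {f : X →ₗ[R] Y} {g : Y →ₗ[R] Z} (hf : Function.Injective f)
    (hfg : Function.Exact f g) (hg : Function.Surjective g) :
    (ModuleCat.shortComplexOfCompEqZero f g hfg.linearMap_comp_eq_zero).ShortExact :=
  ModuleCat.shortComplex_shortExact _ hfg hf hg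

theorem ExtVanishes.of_projective [Module.Projective R M] (n : ℕ) :
    ExtVanishes R M N (n + 1) := by
  have : Projective (ModuleCat.of R M) := (IsProjective.iff_projective M).mp inferInstance
  exact fun x => x.eq_zero_of_projective

theorem ExtVanishes.of_subsingleton_left [Subsingleton M] (n : ℕ) : ExtVanishes R M N n := by
  intro x
  have h : 𝟙 (ModuleCat.of R M) = 0 := by
    ext y
    exact Subsingleton.elim (α := M) _ _
  rw [← x.mk₀_id_comp, h, Ext.mk₀_zero, Ext.zero_comp]

theorem ExtVanishes.of_subsingleton_right [Subsingleton N] (n : ℕ) : ExtVanishes R M N n := by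
  intro x
  have h : 𝟙 (ModuleCat.of R N) = 0 := by
    ext y
    exact Subsingleton.elim (α := N) _ _
  rw [← x.comp_mk₀_id, h, Ext.mk₀_zero, Ext.comp_zero]

/-- The identity of `M` is a sum of maps that factor through the `F j`, and a class is its own
composite with the identity. Orthogonality of the summands plays no role. -/
theorem ExtVanishes.of_sum_left {J : Type*} [Fintype J] {F : J → Type u}
    [∀ j, AddCommGroup (F j)] [∀ j, Module R (F j)] (i : ∀ j, F j →ₗ[R] M) (p : ∀ j, M →ₗ[R] F j)
    (hip : ∀ x, ∑ j, i j (p j x) = x) {n : ℕ} (hF : ∀ j, ExtVanishes R (F j) N n) :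
    ExtVanishes R M N n := by
  intro x
  have h : 𝟙 (ModuleCat.of R M) = ∑ j, ModuleCat.ofHom (p j) ≫ ModuleCat.ofHom (i j) := by
    ext y
    simpa [ModuleCat.hom_sum, LinearMap.sum_apply] using (hip y).symm
  rw [← x.mk₀_id_comp, h, Ext.mk₀_sum, Ext.sum_comp]
  refine Finset.sum_eq_zero fun j _ => ?_
  rw [← Ext.mk₀_comp_mk₀_assoc, hF j ((Ext.mk₀ (ModuleCat.ofHom (i j))).comp x (zero_add n)),
    Ext.comp_zero]

theorem ExtVanishes.of_sum_right {J : Type*} [Fintype J] {F : J → Type u}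
    [∀ j, AddCommGroup (F j)] [∀ j, Module R (F j)] (i : ∀ j, F j →ₗ[R] N) (p : ∀ j, N →ₗ[R] F j)
    (hip : ∀ x, ∑ j, i j (p j x) = x) {n : ℕ} (hF : ∀ j, ExtVanishes R M (F j) n) :
    ExtVanishes R M N n := by
  intro x
  have h : 𝟙 (ModuleCat.of R N) = ∑ j, ModuleCat.ofHom (p j) ≫ ModuleCat.ofHom (i j) := by
    ext y
    simpa [ModuleCat.hom_sum, LinearMap.sum_apply] using (hip y).symm
  rw [← x.comp_mk₀_id, h, Ext.mk₀_sum, Ext.comp_sum]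
  refine Finset.sum_eq_zero fun j _ => ?_
  rw [← Ext.mk₀_comp_mk₀, ← Ext.comp_assoc_of_third_deg_zero,
    hF j (x.comp (Ext.mk₀ (ModuleCat.ofHom (p j))) (add_zero n)), Ext.zero_comp]

variable {f : X →ₗ[R] Y} {g : Y →ₗ[R] Z} (hf : Function.Injective f)
    (hfg : Function.Exact f g) (hg : Function.Surjective g)

include hf hfg hg

theorem ExtVanishes.middle_left {n : ℕ} (hX : ExtVanishes R X N n) (hZ : ExtVanishes R Z N n) :
    ExtVanishes R Y N n := by
  intro x
  obtain ⟨y, hy⟩ := Ext.contravariant_sequence_exact₂ (shortExact_of hf hfg hg) _ x (hX _)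
  rw [← hy, hZ y, Ext.comp_zero]

theorem ExtVanishes.middle_right {n : ℕ} (hX : ExtVanishes R M X n) (hZ : ExtVanishes R M Z n) :
    ExtVanishes R M Y n := by
  intro x
  obtain ⟨y, hy⟩ := Ext.covariant_sequence_exact₂ _ (shortExact_of hf hfg hg) x (hZ _)
  rw [← hy, hX y, Ext.zero_comp]

theorem ExtVanishes.kernel_left {n : ℕ} (hY : ExtVanishes R Y N n)
    (hZ : ExtVanishes R Z N (n + 1)) : ExtVanishes R X N n := by
  intro x
  obtain ⟨y, hy⟩ := Ext.contravariant_sequence_exact₁ (shortExact_of hf hfg hg) _ x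
    (add_comm 1 n) (hZ _)
  rw [← hy, hY y, Ext.comp_zero]

theorem ExtVanishes.cokernel_left {n : ℕ} (hX : ExtVanishes R X N n)
    (hY : ExtVanishes R Y N (n + 1)) : ExtVanishes R Z N (n + 1) := by
  intro x
  obtain ⟨y, hy⟩ := Ext.contravariant_sequence_exact₃ (shortExact_of hf hfg hg) _ x
    (hY _) (add_comm 1 n)
  rw [← hy, hX y, Ext.comp_zero]

theorem ExtVanishes.cokernel_right {n : ℕ} (hY : ExtVanishes R M Y n)
    (hX : ExtVanishes R M X (n + 1)) : ExtVanishes R M Z n := by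
  intro x
  obtain ⟨y, hy⟩ := Ext.covariant_sequence_exact₃ _ (shortExact_of hf hfg hg) x rfl (hX _)
  rw [← hy, hY y, Ext.zero_comp]

/-- If all maps `X → N` extend to `Y`, then `Ext^1(Z, N)` embeds into `Ext^1(Y, N)`. -/
theorem ExtVanishes.one_of_extend (hext : ∀ u : X →ₗ[R] N, ∃ v : Y →ₗ[R] N, v ∘ₗ f = u)
    (hY : ExtVanishes R Y N 1) : ExtVanishes R Z N 1 := by
  intro x
  obtain ⟨y, hy⟩ := Ext.contravariant_sequence_exact₃ (shortExact_of hf hfg hg) _ x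
    (hY _) (rfl : 1 + 0 = 1)
  obtain ⟨u, rfl⟩ := (Ext.mk₀_bijective _ _).2 y
  obtain ⟨v, hv⟩ := hext u.hom
  -- The class comes from `u : X → N` through the connecting map. Once `u` factors through `f`, the
  -- connecting map kills it, since `f` composed with the extension class is zero.
  have : u = (ModuleCat.shortComplexOfCompEqZero f g hfg.linearMap_comp_eq_zero).f ≫
      ModuleCat.ofHom v := by
    ext z
    exact (LinearMap.congr_fun hv z).symm
  rw [← hy, this, ← Ext.mk₀_comp_mk₀, ShortComplex.ShortExact.extClass_comp_assoc]

theorem ExtVanishes.extend (hZ : ExtVanishes R Z N 1) (u : X →ₗ[R] N) :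
    ∃ v : Y →ₗ[R] N, ∀ x, v (f x) = u x := by
  obtain ⟨y, hy⟩ := Ext.contravariant_sequence_exact₁ (shortExact_of hf hfg hg) _
    (Ext.mk₀ (ModuleCat.ofHom u)) (rfl : 1 + 0 = 1) (hZ _)
  obtain ⟨v, rfl⟩ := (Ext.mk₀_bijective _ _).2 y
  rw [Ext.mk₀_comp_mk₀] at hy
  have h := (Ext.mk₀_bijective _ _).1 hy
  exact ⟨v.hom, fun x => congrArg (fun t => t.hom x) h⟩

theorem ExtVanishes.lift (hX : ExtVanishes R M X 1) (u : M →ₗ[R] Z) :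
    ∃ v : M →ₗ[R] Y, ∀ x, g (v x) = u x := by
  obtain ⟨y, hy⟩ := Ext.covariant_sequence_exact₃ _ (shortExact_of hf hfg hg)
    (Ext.mk₀ (ModuleCat.ofHom u)) (rfl : 0 + 1 = 1) (hX _)
  obtain ⟨v, rfl⟩ := (Ext.mk₀_bijective _ _).2 y
  rw [Ext.mk₀_comp_mk₀] at hy
  have h := (Ext.mk₀_bijective _ _).1 hy
  exact ⟨v.hom, fun x => congrArg (fun t => t.hom x) h⟩

end ExtVanishing

end BGG
namespace BGG

/-! ### Graded morphisms and their construction from ungraded maps -/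

section GradedHoms

variable {k A : Type u} [Field k] [Ring A] [Algebra k A] {𝒜 : ℤ → Submodule k A}

namespace GrMod

variable {M N X Y E F : GrMod 𝒜}

@[simp] theorem toLin_comp (f : X ⟶ Y) (g : Y ⟶ E) (x : X) :
    toLin (f ≫ g) x = toLin g (toLin f x) := rfl

@[simp] theorem toLin_id (x : X) : toLin (𝟙 X) x = x := rfl

@[simp] theorem toLin_zero (x : X) : toLin (0 : X ⟶ Y) x = 0 := rfl

@[simp] theorem toLin_add (f g : X ⟶ Y) (x : X) : toLin (f + g) x = toLin f x + toLin g x := rfl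

@[simp] theorem toLin_neg (f : X ⟶ Y) (x : X) : toLin (-f) x = -toLin f x := rfl

@[simp] theorem toLin_sub (f g : X ⟶ Y) (x : X) : toLin (f - g) x = toLin f x - toLin g x := by
  rw [sub_eq_add_neg, toLin_add, toLin_neg, sub_eq_add_neg]

@[simp] theorem toLin_ofLin (f : M →ₗ[A] N) (hf) (x : M) : toLin (ofLin f hf) x = f x := rfl

theorem toLin_sum {J : Type*} (s : Finset J) (f : J → (X ⟶ Y)) (x : X) :
    toLin (∑ j ∈ s, f j) x = ∑ j ∈ s, toLin (f j) x := by
  classical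
  induction s using Finset.induction_on with
  | empty => simp
  | insert a s ha ih => rw [Finset.sum_insert ha, Finset.sum_insert ha, toLin_add, ih]

theorem hom_ext {f g : X ⟶ Y} (h : ∀ x, toLin f x = toLin g x) : f = g :=
  Subtype.ext (LinearMap.ext h)

theorem toLin_mem (f : X ⟶ Y) {i : ℤ} {x : X} (hx : x ∈ X.gr i) : toLin f x ∈ Y.gr i :=
  f.2 i x hx

theorem induction_homogeneous {p : M → Prop} (hadd : ∀ x y, p x → p y → p (x + y)) (h0 : p 0)
    (hp : ∀ i, ∀ x ∈ M.gr i, p x) (x : M) : p x := by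
  classical
  obtain ⟨s, hs⟩ := M.exists_sum_proj x
  rw [hs]
  exact Finset.sum_induction _ p hadd h0 fun i _ => hp i _ (M.proj_mem i x)

theorem hom_ext_homogeneous {f g : X ⟶ Y} (h : ∀ i, ∀ x ∈ X.gr i, toLin f x = toLin g x) :
    f = g := by
  refine hom_ext fun x => ?_
  refine induction_homogeneous (p := fun x => toLin f x = toLin g x) ?_ (by simp) h x
  intro x y hx hy
  rw [map_add, map_add, hx, hy]

theorem toLin_proj (f : X ⟶ Y) (i : ℤ) (x : X) :
    toLin f (X.proj i x) = Y.proj i (toLin f x) := by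
  refine induction_homogeneous (p := fun x => toLin f (X.proj i x) = Y.proj i (toLin f x))
    ?_ (by simp) ?_ x
  · intro x y hx hy
    rw [map_add, map_add, hx, hy, map_add, map_add]
  · intro l z hz
    by_cases h : i = l
    · subst h
      rw [X.proj_of_mem hz, Y.proj_of_mem (toLin_mem f hz)]
    · rw [X.proj_of_mem_ne hz h, Y.proj_of_mem_ne (toLin_mem f hz) h, map_zero]

theorem mem_gr_of_proj_eq {i : ℤ} {x : M} (h : M.proj i x = x) : x ∈ M.gr i :=
  h ▸ M.proj_mem i x

theorem eq_zero_of_mem_mem {i j : ℤ} {x : M} (hi : x ∈ M.gr i) (hj : x ∈ M.gr j) (h : i ≠ j) :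
    x = 0 := by
  rw [← M.proj_of_mem hi, M.proj_of_mem_ne hj h]

theorem mem_gr_of_injective {f : X ⟶ Y} (hf : Function.Injective (toLin f)) {i : ℤ} {x : X}
    (hx : toLin f x ∈ Y.gr i) : x ∈ X.gr i := by
  refine mem_gr_of_proj_eq (hf ?_)
  rw [toLin_proj, Y.proj_of_mem hx]

theorem exists_mem_gr_of_mem_range {f : X ⟶ Y} {i : ℤ} {y : Y} (hy : y ∈ Y.gr i)
    (h : ∃ x, toLin f x = y) : ∃ x ∈ X.gr i, toLin f x = y := by
  obtain ⟨x, rfl⟩ := h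
  exact ⟨X.proj i x, X.proj_mem i x, by rw [toLin_proj, Y.proj_of_mem hy]⟩

theorem isHomogeneous_range (f : X ⟶ Y) : Y.IsHomogeneous (LinearMap.range (toLin f)) := by
  rintro _ ⟨x, rfl⟩ i
  exact ⟨X.proj i x, toLin_proj f i x⟩

theorem exists_factor {f : N ⟶ E} (hf : Function.Injective (toLin f)) (u : Y ⟶ E)
    (hu : ∀ y, ∃ n, toLin f n = toLin u y) : ∃ v : Y ⟶ N, ∀ y, toLin f (toLin v y) = toLin u y := by
  let φ := LinearEquiv.ofInjective (toLin f) hf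
  let w : Y →ₗ[A] N := φ.symm.toLinearMap ∘ₗ (toLin u).codRestrict (LinearMap.range (toLin f)) hu
  have hw : ∀ y, toLin f (w y) = toLin u y := fun y =>
    congrArg Subtype.val (φ.apply_symm_apply ⟨toLin u y, hu y⟩)
  exact ⟨ofLin w fun i x hx => mem_gr_of_injective hf ((hw x).symm ▸ toLin_mem u hx), hw⟩

theorem exists_desc {q : Y ⟶ X} (hq : Function.Surjective (toLin q)) (u : Y ⟶ N)
    (hu : ∀ y, toLin q y = 0 → toLin u y = 0) :
    ∃ v : X ⟶ N, ∀ y, toLin v (toLin q y) = toLin u y := by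
  let φ := (toLin q).quotKerEquivOfSurjective hq
  let w : X →ₗ[A] N := (LinearMap.ker (toLin q)).liftQ (toLin u) hu ∘ₗ φ.symm.toLinearMap
  have hw : ∀ y, w (toLin q y) = toLin u y := by
    intro y
    have : φ.symm (toLin q y) = Submodule.Quotient.mk y := by
      rw [LinearEquiv.symm_apply_eq]
      rfl
    simp only [w, LinearMap.comp_apply, LinearEquiv.coe_coe, this]
    exact Submodule.liftQ_apply _ _ _
  refine ⟨ofLin w fun i x hx => ?_, hw⟩
  obtain ⟨y, hy, rfl⟩ := exists_mem_gr_of_mem_range hx (hq x)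
  rw [hw]
  exact toLin_mem u hy

variable [GradedAlgebra 𝒜]

theorem linear_of_homogeneous (f : M →ₗ[k] N)
    (hf : ∀ i, ∀ a ∈ 𝒜 i, ∀ j, ∀ x ∈ M.gr j, f (a • x) = a • f x) (a : A) (x : M) :
    f (a • x) = a • f x := by
  classical
  refine induction_homogeneous (p := fun x => f (a • x) = a • f x) ?_ (by simp) ?_ x
  · intro x y hx hy
    rw [smul_add, map_add, hx, hy, map_add, smul_add]
  · intro j x hx
    rw [← DirectSum.sum_support_decompose 𝒜 a, Finset.sum_smul, map_sum, Finset.sum_smul]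
    exact Finset.sum_congr rfl fun i _ => hf i _ (SetLike.coe_mem _) j x hx

/-- The component of degree zero of a linear map. -/
theorem exists_degree_zero_part (u : M →ₗ[A] N) :
    ∃ v : M ⟶ N, ∀ i, ∀ x ∈ M.gr i, toLin v x = N.proj i (u x) := by
  classical
  -- On the component of degree `i`, keep only the degree `i` part of `u`. The result is `A`-linear
  -- because projections commute with homogeneous scalars up to a shift of degree.
  let w : M →ₗ[k] N := (DirectSum.toModule k ℤ N fun i =>
    N.proj i ∘ₗ u.restrictScalars k ∘ₗ (M.gr i).subtype) ∘ₗ M.decomp.symm.toLinearMap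
  have hw : ∀ i, ∀ x ∈ M.gr i, w x = N.proj i (u x) := by
    intro i x hx
    simp [w, M.symm_of_mem hx, DirectSum.toModule_lof]
  have hlin : ∀ (a : A) (x : M), w (a • x) = a • w x := by
    refine linear_of_homogeneous w fun i a ha j x hx => ?_
    rw [hw _ _ (M.smul_mem ha hx), hw _ _ hx, map_smul, N.smul_proj ha]
  refine ⟨ofLin { w with map_smul' := hlin } fun i x hx => ?_, hw⟩
  change w x ∈ _
  rw [hw i x hx]
  exact N.proj_mem i _

/-- Ext is taken over ungraded modules, so vanishing first gives an ungraded extension. Its degree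
zero part still extends `u`, because `f` and `u` preserve degrees. As `f` need not be injective, the
extension is made from the range of `f`. -/
theorem exists_extend (f : X ⟶ Y) (u : X ⟶ N) (hu : ∀ x, toLin f x = 0 → toLin u x = 0)
    (hext : ExtVanishes A (Y ⧸ LinearMap.range (toLin f)) N 1) :
    ∃ v : Y ⟶ N, f ≫ v = u := by
  let R := LinearMap.range (toLin f)
  let u' : R →ₗ[A] N := (LinearMap.ker (toLin f)).liftQ (toLin u) hu ∘ₗ
    (toLin f).quotKerEquivRange.symm.toLinearMap
  have hu' : ∀ x, u' ⟨toLin f x, x, rfl⟩ = toLin u x := by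
    intro x
    have : (toLin f).quotKerEquivRange.symm ⟨toLin f x, x, rfl⟩ = Submodule.Quotient.mk x := by
      rw [LinearEquiv.symm_apply_eq]
      rfl
    simp only [u', LinearMap.comp_apply, LinearEquiv.coe_coe, this]
    exact Submodule.liftQ_apply _ _ _
  obtain ⟨v', hv'⟩ := ExtVanishes.extend R.injective_subtype
    (LinearMap.exact_subtype_mkQ R) R.mkQ_surjective hext u'
  obtain ⟨v, hv⟩ := exists_degree_zero_part v'
  refine ⟨v, hom_ext_homogeneous fun i x hx => ?_⟩
  rw [toLin_comp, hv i _ (toLin_mem f hx)]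
  have := hv' ⟨toLin f x, x, rfl⟩
  rw [hu'] at this
  change N.proj i (v' (R.subtype ⟨toLin f x, x, rfl⟩)) = _
  rw [this, N.proj_of_mem (toLin_mem u hx)]

theorem exists_lift_linear (g : E ⟶ F) {M : Type u} [AddCommGroup M] [Module A M] (u : M →ₗ[A] F)
    (hu : ∀ x, ∃ y, toLin g y = u x) (hext : ExtVanishes A M (LinearMap.ker (toLin g)) 1) :
    ∃ v : M →ₗ[A] E, ∀ x, toLin g (v x) = u x := by
  let u' : M →ₗ[A] LinearMap.range (toLin g) := u.codRestrict _ hu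
  have hex : Function.Exact (LinearMap.ker (toLin g)).subtype (toLin g).rangeRestrict := by
    intro y
    rw [← LinearMap.mem_ker, LinearMap.ker_rangeRestrict]
    simp
  obtain ⟨v', hv'⟩ := ExtVanishes.lift (LinearMap.ker (toLin g)).injective_subtype hex
    (toLin g).surjective_rangeRestrict hext u'
  exact ⟨v', fun x => congrArg Subtype.val (hv' x)⟩

theorem exists_lift (g : E ⟶ F) (u : M ⟶ F) (hu : ∀ x, ∃ y, toLin g y = toLin u x)
    (hext : ExtVanishes A M (LinearMap.ker (toLin g)) 1) : ∃ v : M ⟶ E, v ≫ g = u := by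
  obtain ⟨v', hv'⟩ := exists_lift_linear g (toLin u) hu hext
  obtain ⟨v, hv⟩ := exists_degree_zero_part v'
  refine ⟨v, hom_ext_homogeneous fun i x hx => ?_⟩
  rw [toLin_comp, hv i _ hx, toLin_proj, hv', F.proj_of_mem (toLin_mem u hx)]

theorem shift_shift (M : GrMod 𝒜) (a b : ℤ) : (M.shift a).shift b = M.shift (a + b) := by
  have h : (fun j => M.gr (a + (b + j))) = fun j => M.gr (a + b + j) := by
    funext j
    rw [add_assoc]
  simp only [shift]
  congr

/-- The shift of a morphism. -/
def shiftHom (f : X ⟶ Y) (n : ℤ) : X.shift n ⟶ Y.shift n :=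
  ofLin (M := X.shift n) (N := Y.shift n) (show X →ₗ[A] Y from f.1) fun i x hx => f.2 (n + i) x hx

/-- A degree zero isomorphism, as a linear equivalence. -/
def toLinearEquiv (f : X ≅ Y) : X ≃ₗ[A] Y where
  __ := toLin f.hom
  invFun := toLin f.inv
  left_inv x := by
    change toLin (f.hom ≫ f.inv) x = x
    rw [f.hom_inv_id]
    rfl
  right_inv x := by
    change toLin (f.inv ≫ f.hom) x = x
    rw [f.inv_hom_id]
    rfl

end GrMod

end GradedHoms

end BGG
namespace BGG

/-! ### Highest weight vectors, standard and costandard modules -/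

section Standard

open GrMod

variable {k A : Type u} [Field k] [Ring A] [Algebra k A] [Module.Finite k A]
variable {Λ : Type w} [Fintype Λ] [LinearOrder Λ]
variable {𝒜 : ℤ → Submodule k A} [GradedAlgebra 𝒜] {e : Λ → A}

/-- Highest weight vectors of weight `l`; they correspond to the maps from `Δ(l)`. -/
def IsHW (e : Λ → A) {M : Type u} [AddCommGroup M] [Module A M] (l : Λ) (v : M) : Prop :=
  e l • v = v ∧ ∀ m, l < m → ∀ a : A, e m • a • v = 0

theorem IsHW.map {M N : Type u} [AddCommGroup M] [Module A M] [AddCommGroup N] [Module A N]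
    {l : Λ} {v : M} (hv : IsHW e l v) (f : M →ₗ[A] N) : IsHW e l (f v) :=
  ⟨by rw [← map_smul, hv.1], fun m hm a => by rw [← map_smul, ← map_smul, hv.2 m hm, map_zero]⟩

theorem IsHW.of_map {M N : Type u} [AddCommGroup M] [Module A M] [AddCommGroup N] [Module A N]
    {l : Λ} {v : M} {f : M →ₗ[A] N} (hf : Function.Injective f) (hv : IsHW e l (f v)) :
    IsHW e l v :=
  ⟨hf (by rw [map_smul, hv.1]), fun m hm a => hf (by
    rw [map_smul, map_smul, hv.2 m hm, map_zero])⟩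

theorem IsHW.proj (h : IsPositivelyGraded 𝒜 e) {M : GrMod 𝒜} {l : Λ} {v : M} (hv : IsHW e l v)
    (i : ℤ) : IsHW e l (M.proj i v) :=
  ⟨by rw [← proj_smul_e h, hv.1], isHomogeneous_below h M l v hv.2 i⟩

variable (h : IsPositivelyGraded 𝒜 e)

include h in
theorem IsPositivelyGraded.mul_self (l : Λ) : e l * e l = e l := h.idem.idem l

include h in
theorem IsPositivelyGraded.smul_smul_self (l : Λ) {M : Type u} [AddCommGroup M] [Module A M]
    (x : M) : e l • e l • x = e l • x := by
  rw [smul_smul, h.mul_self]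

include h in
theorem IsPositivelyGraded.smul_smul_ne {l m : Λ} (hlm : l ≠ m) {M : Type u} [AddCommGroup M]
    [Module A M] (x : M) : e l • e m • x = 0 := by
  rw [smul_smul, h.idem.ortho hlm, zero_smul]

include h in
theorem IsPositivelyGraded.smul_mem_gr (l : Λ) {M : GrMod 𝒜} {i : ℤ} {x : M} (hx : x ∈ M.gr i) :
    e l • x ∈ M.gr i := by
  have := M.smul_mem (h.mem l) hx
  rwa [zero_add] at this

/-- The generator of `Δ(l)`. -/
def Δ.gen (l : Λ) : Δ h l :=
  (traceAbove e (P h l) l).mkQ (⟨e l, Submodule.subset_span rfl⟩ : Submodule.span A {e l})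

include h in
theorem P.smul_gen {l : Λ} (x : Submodule.span A {e l}) : (x : A) •
    (⟨e l, Submodule.subset_span rfl⟩ : Submodule.span A {e l}) = x := by
  obtain ⟨y, hy⟩ := x
  obtain ⟨b, rfl⟩ := Submodule.mem_span_singleton.mp hy
  refine Subtype.ext ?_
  change (b • e l) * e l = b • e l
  rw [smul_eq_mul, mul_assoc, h.mul_self]

theorem Δ.gen_mem (l : Λ) : Δ.gen h l ∈ (Δ h l).gr 0 :=
  ⟨⟨e l, Submodule.subset_span rfl⟩, h.mem l, rfl⟩

theorem Δ.exists_smul_gen {l : Λ} (x : Δ h l) : ∃ a : A, x = a • Δ.gen h l := by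
  obtain ⟨y, rfl⟩ := Submodule.mkQ_surjective _ x
  refine ⟨(show Submodule.span A {e l} from y).1, ?_⟩
  exact congrArg (traceAbove e (P h l) l).mkQ (P.smul_gen h y).symm

theorem Δ.smul_eq_zero {l m : Λ} (hm : l < m) (x : Δ h l) : e m • x = 0 := by
  obtain ⟨y, rfl⟩ := Submodule.mkQ_surjective _ x
  refine (map_smul _ _ _).symm.trans ?_
  exact (Submodule.Quotient.mk_eq_zero _).mpr (Submodule.subset_span ⟨m, hm, y, rfl⟩)

theorem Δ.isHW_gen (l : Λ) : IsHW e l (Δ.gen h l) := by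
  refine ⟨?_, fun m hm a => Δ.smul_eq_zero h hm _⟩
  refine (map_smul (traceAbove e (P h l) l).mkQ (e l) _).symm.trans ?_
  exact congrArg _ (P.smul_gen h (⟨e l, Submodule.subset_span rfl⟩ : Submodule.span A {e l}))

theorem Δ.hom_ext_linear {l : Λ} {M : Type u} [AddCommGroup M] [Module A M]
    {f g : Δ h l →ₗ[A] M} (hfg : f (Δ.gen h l) = g (Δ.gen h l)) : f = g := by
  ext x
  obtain ⟨a, rfl⟩ := Δ.exists_smul_gen h x
  rw [map_smul, map_smul, hfg]

theorem Δ.exists_hom {l : Λ} {M : Type u} [AddCommGroup M] [Module A M] {v : M}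
    (hv : IsHW e l v) : ∃ f : Δ h l →ₗ[A] M, f (Δ.gen h l) = v := by
  let φ : P h l →ₗ[A] M := (LinearMap.toSpanSingleton A M v) ∘ₗ (Submodule.span A {e l}).subtype
  have hφ : traceAbove e (P h l) l ≤ LinearMap.ker φ := by
    refine Submodule.span_le.mpr ?_
    rintro _ ⟨m, hm, y, rfl⟩
    have : φ (e m • y) = e m • (show Submodule.span A {e l} from y).1 • v := map_smul φ _ _
    exact this.trans (hv.2 m hm _)
  refine ⟨(traceAbove e (P h l) l).liftQ φ hφ, ?_⟩
  refine (Submodule.liftQ_apply _ _ _).trans ?_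
  exact hv.1

/-- The graded version of the universal property of `Δ(l)`. -/
theorem Δ.exists_shift_hom {l : Λ} {M : GrMod 𝒜} {v : M} (hv : IsHW e l v) {i n : ℤ}
    (hi : v ∈ M.gr i) (hn : n + i = 0) :
    ∃ f : (Δ h l).shift n ⟶ M, toLin f (Δ.gen h l) = v := by
  obtain ⟨f, hf⟩ := Δ.exists_hom h hv
  obtain ⟨g, hg⟩ := exists_degree_zero_part (M := (Δ h l).shift n) f
  refine ⟨g, ?_⟩
  refine (hg i _ ?_).trans ?_
  · change Δ.gen h l ∈ (Δ h l).gr (n + i)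
    rw [hn]
    exact Δ.gen_mem h l
  · exact (congrArg _ hf).trans (M.proj_of_mem hi)

instance P.projective (l : Λ) : Module.Projective A (P h l) := by
  refine Module.Projective.of_split (M := A) (Submodule.span A {e l}).subtype
    (LinearMap.toSpanSingleton A (Submodule.span A {e l}) ⟨e l, Submodule.subset_span rfl⟩) ?_
  ext x : 1
  exact P.smul_gen h x

theorem traceAbove.hom_ext_zero {l : Λ} {M : Type u} [AddCommGroup M] [Module A M]
    (hM : ∀ m, l < m → ∀ x : M, e m • x = 0) (f : traceAbove e (P h l) l →ₗ[A] M) : f = 0 := by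
  ext ⟨x, hx⟩
  induction hx using Submodule.span_induction with
  | mem x hx =>
    obtain ⟨m, hm, y, rfl⟩ := hx
    have h1 : e m • y ∈ traceAbove e (P h l) l := Submodule.subset_span ⟨m, hm, y, rfl⟩
    have h2 : (⟨e m • y, h1⟩ : traceAbove e (P h l) l) = e m • ⟨e m • y, h1⟩ :=
      Subtype.ext (h.smul_smul_self m y).symm
    rw [h2, map_smul, hM m hm, LinearMap.zero_apply]
  | zero => exact map_zero f
  | add x y hx hy h1 h2 =>
    refine (map_add f ⟨x, hx⟩ ⟨y, hy⟩).trans ?_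
    rw [h1, h2]
    exact add_zero _
  | smul a x hx h1 =>
    refine (map_smul f a ⟨x, hx⟩).trans ?_
    rw [h1]
    exact smul_zero _

section Costandard

/-- The functional on `A` given by an element of `∇(l)`. -/
def nabla.fn {l : Λ} (x : nabla h l) : Module.Dual k A := x.1.1

theorem nabla.ext_fn {l : Λ} {x y : nabla h l}
    (hxy : ∀ a : A, nabla.fn h x a = nabla.fn h y a) : x = y :=
  Subtype.ext (Subtype.ext (LinearMap.ext hxy))

/-- The value at `1` of an element of `∇(l)`, regarded as a functional on `A`. -/
def nabla.ev (l : Λ) : nabla h l →ₗ[k] k where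
  toFun x := nabla.fn h x 1
  map_add' _ _ := rfl
  map_smul' _ _ := rfl

theorem nabla.smul_apply {l : Λ} (x : nabla h l) (a b : A) :
    nabla.fn h (a • x) b = nabla.fn h x (b * a) := rfl

theorem nabla.ev_smul {l : Λ} (x : nabla h l) (a : A) :
    nabla.ev h l (a • x) = nabla.fn h x a := by
  change nabla.fn h (a • x) 1 = _
  rw [nabla.smul_apply, one_mul]

theorem nabla.ext_ev {l : Λ} {x y : nabla h l}
    (hxy : ∀ a : A, nabla.ev h l (a • x) = nabla.ev h l (a • y)) : x = y := by
  refine nabla.ext_fn h fun a => ?_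
  rw [← nabla.ev_smul, ← nabla.ev_smul, hxy]

theorem nabla.ev_e_smul {l : Λ} (x : nabla h l) :
    nabla.ev h l (e l • x) = nabla.ev h l x := by
  have h0 : ∀ a, nabla.fn h x ((1 - e l) * a) = 0 := fun a =>
    congrArg (fun t : Module.Dual k A => t a) (x.1.2 : _ = (0 : Module.Dual k A))
  have := h0 1
  rw [mul_one, map_sub, sub_eq_zero] at this
  rw [nabla.ev_smul]
  exact this.symm

theorem nabla.smul_eq_zero {l m : Λ} (hm : l < m) (x : nabla h l) : e m • x = 0 := by
  have := x.2 m hm 1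
  rw [one_smul] at this
  exact Subtype.ext this

theorem nabla.gr_apply {l : Λ} {x : nabla h l} {j : ℤ} (hx : x ∈ (nabla h l).gr j) {i : ℤ}
    (hi : i ≠ -j) {a : A} (ha : a ∈ 𝒜 i) : nabla.ev h l (a • x) = 0 := by
  rw [nabla.ev_smul]
  exact (show ∀ i, i ≠ -j → ∀ a ∈ 𝒜 i, nabla.fn h x a = 0 from hx) i hi a ha

/-- Functionals on a module give rise to maps to `∇(l)`. -/
theorem nabla.exists_hom {l : Λ} {M : Type u} [AddCommGroup M] [Module k M] [Module A M]
    [IsScalarTower k A M] (θ : M →ₗ[k] k)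
    (hθ : ∀ m, l < m → ∀ (a b : A) (x : M), θ (e l • a • e m • b • x) = 0) :
    ∃ f : M →ₗ[A] nabla h l, ∀ x, nabla.ev h l (f x) = θ (e l • x) := by
  have smul_comm' : ∀ (a : A) (c : k) (x : M), a • c • x = c • a • x := by
    intro a c x
    rw [← one_smul A x, ← smul_assoc c (1 : A) x, smul_smul a, mul_smul_comm, smul_assoc, mul_one,
      one_smul]
  -- The functional attached to `x` must vanish on `(1 - e l) A` to lie in `I(l)`, whence the factor
  -- `e l`; the hypothesis on `θ` then excludes the weights above `l`.
  let F : M → Module.Dual k A := fun x =>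
    { toFun := fun a => θ (e l • a • x)
      map_add' := fun a b => by rw [add_smul, smul_add, map_add]
      map_smul' := fun c a => by rw [smul_assoc, smul_comm', map_smul, RingHom.id_apply] }
  have hI : ∀ x a, F x ((1 - e l) * a) = 0 := by
    intro x a
    change θ (e l • ((1 - e l) * a) • x) = 0
    rw [smul_smul, ← mul_assoc, mul_sub, mul_one, h.mul_self, sub_self, zero_mul, zero_smul,
      map_zero]
  refine ⟨{ toFun := fun x => ⟨⟨F x, LinearMap.ext (hI x)⟩, ?_⟩, map_add' := ?_, map_smul' := ?_ },
    ?_⟩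
  · intro m hm b
    refine Subtype.ext (LinearMap.ext fun a => ?_)
    change θ (e l • (a * e m * b) • x) = 0
    rw [mul_smul, mul_smul]
    exact hθ m hm a b x
  · intro x y
    refine nabla.ext_fn h fun a => ?_
    change θ (e l • a • (x + y)) = θ (e l • a • x) + θ (e l • a • y)
    rw [smul_add, smul_add, map_add]
  · intro b x
    refine nabla.ext_fn h fun a => ?_
    change θ (e l • a • b • x) = θ (e l • (a * b) • x)
    rw [mul_smul]
  · intro x
    change θ (e l • (1 : A) • x) = _
    rw [one_smul]

end Costandard

end Standard

end BGG
namespace BGG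

/-! ### Ext-orthogonality of standard and costandard filtrations -/

section ExtOrthogonality

open GrMod

theorem ExtVanishes.of_equiv_left {R : Type u} [Ring R] {M M' N : Type u} [AddCommGroup M]
    [Module R M] [AddCommGroup M'] [Module R M'] [AddCommGroup N] [Module R N] (f : M ≃ₗ[R] M')
    {n : ℕ} (hM : ExtVanishes R M N n) : ExtVanishes R M' N n :=
  .of_sum_left (J := Unit) (fun _ => f.toLinearMap) (fun _ => f.symm.toLinearMap) (by simp)
    fun _ => hM

theorem ExtVanishes.of_equiv_right {R : Type u} [Ring R] {M N N' : Type u} [AddCommGroup M]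
    [Module R M] [AddCommGroup N] [Module R N] [AddCommGroup N'] [Module R N'] (f : N ≃ₗ[R] N')
    {n : ℕ} (hM : ExtVanishes R M N n) : ExtVanishes R M N' n :=
  .of_sum_right (J := Unit) (fun _ => f.toLinearMap) (fun _ => f.symm.toLinearMap) (by simp)
    fun _ => hM

variable {k A : Type u} [Field k] [Ring A] [Algebra k A] [Module.Finite k A]
variable {Λ : Type w} [Fintype Λ] [LinearOrder Λ]
variable {𝒜 : ℤ → Submodule k A} [GradedAlgebra 𝒜] {e : Λ → A} (h : IsPositivelyGraded 𝒜 e)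

/-- The modules `N` with `Ext^1(Δ(l), N) = 0` for all `l`. -/
def CoGood (N : Type u) [AddCommGroup N] [Module A N] : Prop :=
  ∀ l, ExtVanishes A (Δ h l) N 1

/-- The modules `M` with `Ext^n(M, N) = 0` for all `n > 0` and all `N` in `CoGood`. -/
def Good (M : Type u) [AddCommGroup M] [Module A M] : Prop :=
  ∀ (N : Type u) [AddCommGroup N] [Module A N], CoGood h N → ∀ n, ExtVanishes A M N (n + 1)

theorem coGood_nabla (l : Λ) : CoGood h (nabla h l) := by
  intro m
  let X := traceAbove e (P h m) m
  refine ExtVanishes.one_of_extend X.injective_subtype (LinearMap.exact_subtype_mkQ X)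
    X.mkQ_surjective (fun u => ?_) (ExtVanishes.of_projective 0)
  -- It suffices to extend maps from the trace `X` to `P(m)`. If `l ≤ m`, then `X` is generated by
  -- weights that do not occur in `∇(l)`, and every such map is zero.
  rcases le_or_gt l m with hlm | hlm
  · have : u = 0 := traceAbove.hom_ext_zero h
      (fun m' hm' x => nabla.smul_eq_zero h (hlm.trans_lt hm') x) u
    exact ⟨0, by rw [this, LinearMap.zero_comp]⟩
  -- If `m < l`, any linear extension of the functional will do: the condition for it to define a
  -- map to `∇(l)` concerns only vectors generated by weights above `l`. These lie in `X`, where the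
  -- condition holds since `u` lands in `∇(l)`.
  · obtain ⟨θ, hθ⟩ := LinearMap.exists_extend (p := X.restrictScalars k)
      (nabla.ev h l ∘ₗ u.restrictScalars k)
    have hθ' : ∀ x (hx : x ∈ X), θ x = nabla.ev h l (u ⟨x, hx⟩) := fun x hx =>
      LinearMap.congr_fun hθ ⟨x, hx⟩
    obtain ⟨f, hf⟩ := nabla.exists_hom h (l := l) θ (by
      intro m' hm' a b x
      have h1 : e m' • b • x ∈ X := Submodule.subset_span ⟨m', hlm.trans hm', b • x, rfl⟩
      have h2 : e l • a • e m' • b • x ∈ X := X.smul_mem _ (X.smul_mem _ h1)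
      have h3 : (⟨e l • a • e m' • b • x, h2⟩ : X) = e l • a • e m' • ⟨e m' • b • x, h1⟩ :=
        Subtype.ext (congrArg (fun t => e l • a • t) (h.smul_smul_self m' (b • x)).symm)
      rw [hθ' _ h2, h3, map_smul u, map_smul u, map_smul u, nabla.smul_eq_zero h hm', smul_zero,
        smul_zero, map_zero])
    refine ⟨f, ?_⟩
    ext ⟨x, hx⟩ : 1
    refine nabla.ext_ev h fun a => ?_
    have h1 : e l • a • x ∈ X := X.smul_mem _ (X.smul_mem _ hx)
    have h2 : (⟨e l • a • x, h1⟩ : X) = e l • a • ⟨x, hx⟩ := rfl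
    change nabla.ev h l (a • f x) = _
    rw [← map_smul, hf, hθ' _ h1, h2, map_smul u, nabla.ev_e_smul, map_smul u]

theorem GrMod.HasFiltration.mono {S S' : GrMod 𝒜 → Prop} (hS : ∀ N, S N → S' N) {M : GrMod 𝒜}
    (hM : HasFiltration S M) : HasFiltration S' M := by
  induction hM with
  | zero M hM => exact .zero M hM
  | extension f g hf hfg hg _ hQ ih => exact .extension f g hf hfg hg ih (hS _ hQ)

variable {h}

theorem CoGood.of_equiv {N N' : Type u} [AddCommGroup N] [Module A N] [AddCommGroup N']
    [Module A N'] (f : N ≃ₗ[A] N') (hN : CoGood h N) : CoGood h N' :=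
  fun l => (hN l).of_equiv_right f

theorem Good.of_equiv {N N' : Type u} [AddCommGroup N] [Module A N] [AddCommGroup N']
    [Module A N'] (f : N ≃ₗ[A] N') (hN : Good h N) : Good h N' :=
  fun M _ _ hM n => (hN M hM n).of_equiv_left f

theorem CoGood.of_subsingleton {N : Type u} [AddCommGroup N] [Module A N] [Subsingleton N] :
    CoGood h N :=
  fun _ => .of_subsingleton_right _

theorem Good.of_subsingleton {N : Type u} [AddCommGroup N] [Module A N] [Subsingleton N] :
    Good h N :=
  fun _ _ _ _ _ => .of_subsingleton_left _

theorem GrMod.HasFiltration.coGood {M : GrMod 𝒜}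
    (hM : HasFiltration (fun N => ∃ m n, Nonempty (N ≅ (nabla h m).shift n)) M) :
    CoGood h M := by
  induction hM with
  | zero M hM => exact .of_subsingleton
  | extension f g hf hfg hg hN hQ ih =>
    obtain ⟨m, n, ⟨φ⟩⟩ := hQ
    have := (coGood_nabla h m).of_equiv (toLinearEquiv φ.symm)
    exact fun l => .middle_right hf hfg hg (ih l) (this l)

/-- `Ext`-vanishing extends from standard modules to modules with a standard filtration. -/
theorem GrMod.HasFiltration.extVanishes {M : GrMod 𝒜}
    (hM : HasFiltration (fun N => ∃ m n, Nonempty (N ≅ (Δ h m).shift n)) M)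
    {N : Type u} [AddCommGroup N] [Module A N] {n : ℕ}
    (hN : ∀ m, ExtVanishes A (Δ h m) N n) : ExtVanishes A M N n := by
  induction hM with
  | zero M hM => exact .of_subsingleton_left _
  | extension f g hf hfg hg _ hQ ih =>
    obtain ⟨m, n, ⟨φ⟩⟩ := hQ
    have : ExtVanishes A (Δ h m) N _ := hN m
    exact .middle_left hf hfg hg ih (this.of_equiv_left (toLinearEquiv φ.symm))

/-- Dimension shifting along the kernel of `P(l) → Δ(l)`, which is again filtered by standard
modules. This turns vanishing of the first Ext group into vanishing of all higher ones. -/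
theorem good_standard (hq : IsQuasiHereditary h) (l : Λ) : Good h (Δ h l) := by
  intro N _ _ hN n
  induction n generalizing l with
  | zero => exact hN l
  | succ n ih =>
    let X := traceAbove e (P h l) l
    have hX : ExtVanishes A X N (n + 1) :=
      HasFiltration.extVanishes ((hq.filtration l).mono fun N ⟨m, n, _, hφ⟩ => ⟨m, n, hφ⟩) ih
    exact .cokernel_left X.injective_subtype (LinearMap.exact_subtype_mkQ X)
      X.mkQ_surjective hX (.of_projective _)

theorem GrMod.HasFiltration.good (hq : IsQuasiHereditary h) {M : GrMod 𝒜}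
    (hM : HasFiltration (fun N => ∃ m n, Nonempty (N ≅ (Δ h m).shift n)) M) : Good h M :=
  fun N _ _ hN n => HasFiltration.extVanishes hM fun m => good_standard hq m N hN n

/-- `Ext^1(Δ, Z)` lies between `Ext^1(Δ, Y)` and `Ext^2(Δ, X)`; the latter vanishes by
`good_standard`. -/
theorem CoGood.cokernel (hq : IsQuasiHereditary h) {X Y Z : Type u} [AddCommGroup X] [Module A X]
    [AddCommGroup Y] [Module A Y] [AddCommGroup Z] [Module A Z] {f : X →ₗ[A] Y} {g : Y →ₗ[A] Z}
    (hf : Function.Injective f) (hfg : Function.Exact f g) (hg : Function.Surjective g)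
    (hX : CoGood h X) (hY : CoGood h Y) : CoGood h Z :=
  fun l => .cokernel_right hf hfg hg (hY l) (good_standard hq l X hX 1)

theorem Good.kernel {X Y Z : Type u} [AddCommGroup X] [Module A X]
    [AddCommGroup Y] [Module A Y] [AddCommGroup Z] [Module A Z] {f : X →ₗ[A] Y} {g : Y →ₗ[A] Z}
    (hf : Function.Injective f) (hfg : Function.Exact f g) (hg : Function.Surjective g)
    (hY : Good h Y) (hZ : Good h Z) : Good h X :=
  fun N _ _ hN n => .kernel_left hf hfg hg (hY N hN n) (hZ N hN (n + 1))

/-- Highest weight vectors lift along maps whose kernel is in `CoGood`. -/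
theorem IsHW.exists_lift {E F : GrMod 𝒜} (g : E ⟶ F) (hg : CoGood h (LinearMap.ker (toLin g)))
    {l : Λ} {i : ℤ} {v : F} (hv : IsHW e l v) (hi : v ∈ F.gr i) (hr : ∃ x, toLin g x = v) :
    ∃ x ∈ E.gr i, IsHW e l x ∧ toLin g x = v := by
  obtain ⟨u, hu⟩ := Δ.exists_hom h hv
  obtain ⟨w, hw⟩ := exists_lift_linear g u (by
    obtain ⟨x, hx⟩ := hr
    intro y
    obtain ⟨a, rfl⟩ := Δ.exists_smul_gen h y
    exact ⟨a • x, by rw [map_smul, map_smul, hx, hu]⟩) (hg l)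
  refine ⟨E.proj i (w (Δ.gen h l)), E.proj_mem _ _, ((Δ.isHW_gen h l).map w).proj h i, ?_⟩
  rw [toLin_proj, hw, hu, F.proj_of_mem hi]

end ExtOrthogonality

end BGG
namespace BGG

/-! ### Finite direct sums of graded modules -/

section DirectSums

variable {k A : Type u} [Field k] [Ring A] [Algebra k A] {𝒜 : ℤ → Submodule k A}

namespace GrMod

/-- The projections and inclusions of a decomposition of `M` into a finite direct sum of modules
that have the property `S`. -/
structure Decomposition (S : GrMod 𝒜 → Prop) (M : GrMod 𝒜) where
  J : Type
  [fintype : Fintype J]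
  F : J → GrMod 𝒜
  prop : ∀ j, S (F j)
  ι : ∀ j, F j ⟶ M
  π : ∀ j, M ⟶ F j
  π_ι : ∀ j x, toLin (π j) (toLin (ι j) x) = x
  π_ι_ne : ∀ i j, i ≠ j → ∀ x, toLin (π j) (toLin (ι i) x) = 0
  total : ∀ x, ∑ j, toLin (ι j) (toLin (π j) x) = x

attribute [instance] Decomposition.fintype

theorem IsDirectSumOf.decomposition {S : GrMod 𝒜 → Prop} {M : GrMod 𝒜} (hM : IsDirectSumOf S M) :
    Nonempty (Decomposition S M) := by
  obtain ⟨n, F, hF, b, ⟨hb⟩, ⟨φ⟩⟩ := hM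
  refine ⟨⟨Fin n, F, hF, fun j => b.ι j ≫ φ.inv, fun j => φ.hom ≫ b.π j, ?_, ?_, ?_⟩⟩
  · intro j x
    rw [← toLin_comp]
    simp
  · intro i j hij x
    rw [← toLin_comp]
    simp [Limits.bicone_ι_π_ne b hij]
  · intro x
    have h1 := Limits.IsBilimit.total hb
    have h2 : ∑ j, (φ.hom ≫ b.π j) ≫ b.ι j ≫ φ.inv = 𝟙 M := by
      have : ∀ j, (φ.hom ≫ b.π j) ≫ b.ι j ≫ φ.inv = φ.hom ≫ (b.π j ≫ b.ι j) ≫ φ.inv := by simp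
      simp only [this]
      rw [← Preadditive.comp_sum, ← Preadditive.sum_comp, h1]
      simp
    have h3 := congrArg (fun t => toLin t x) h2
    rw [toLin_sum] at h3
    exact h3

theorem Decomposition.isDirectSumOf {S : GrMod 𝒜 → Prop} {M : GrMod 𝒜} (D : Decomposition S M) :
    IsDirectSumOf S M := by
  classical
  let ε := (Fintype.equivFin D.J).symm
  let b : Limits.Bicone fun j => D.F (ε j) :=
    { pt := M
      π := fun j => D.π (ε j)
      ι := fun j => D.ι (ε j)
      ι_π := by
        intro i j
        by_cases hij : i = j
        · subst hij
          rw [dif_pos rfl]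
          exact hom_ext fun x => D.π_ι _ x
        · rw [dif_neg hij]
          exact hom_ext fun x => D.π_ι_ne _ _ (fun h => hij (ε.injective h)) x }
  refine ⟨_, fun j => D.F (ε j), fun j => D.prop _, b, ⟨Limits.isBilimitOfTotal b ?_⟩, ⟨Iso.refl _⟩⟩
  refine hom_ext fun x => ?_
  rw [toLin_sum]
  exact (Equiv.sum_comp ε fun j => toLin (D.ι j) (toLin (D.π j) x)).trans (D.total x)

namespace Decomposition

variable {S : GrMod 𝒜 → Prop} {M : GrMod 𝒜} (D : Decomposition S M)

theorem ι_injective (j : D.J) : Function.Injective (toLin (D.ι j)) :=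
  Function.LeftInverse.injective (g := toLin (D.π j)) (D.π_ι j)

theorem eq_zero {x : M} (hx : ∀ j, toLin (D.π j) x = 0) : x = 0 := by
  rw [← D.total x]
  exact Finset.sum_eq_zero fun j _ => by rw [hx, map_zero]

theorem exists_ne_zero {x : M} (hx : x ≠ 0) : ∃ j, toLin (D.π j) x ≠ 0 := by
  by_contra! h
  exact hx (D.eq_zero h)

/-- Lifting problems against direct sums can be solved on the summands. -/
theorem exists_lift {E F : GrMod 𝒜} (g : E ⟶ F) (u : M ⟶ F)
    (hu : ∀ j, ∃ v : D.F j ⟶ E, v ≫ g = D.ι j ≫ u) : ∃ v : M ⟶ E, v ≫ g = u := by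
  choose v hv using hu
  refine ⟨∑ j, D.π j ≫ v j, hom_ext fun x => ?_⟩
  rw [Preadditive.sum_comp, toLin_sum]
  simp only [Category.assoc, hv]
  simp only [toLin_comp]
  rw [← map_sum, D.total]

theorem hom_ext {N : GrMod 𝒜} {f g : M ⟶ N} (hfg : ∀ j, D.ι j ≫ f = D.ι j ≫ g) : f = g := by
  refine GrMod.hom_ext fun x => ?_
  rw [← D.total x, map_sum, map_sum]
  exact Finset.sum_congr rfl fun j _ => congrArg (fun t => toLin t (toLin (D.π j) x)) (hfg j)

/-- The shift of a decomposition. -/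
def shift {S' : GrMod 𝒜 → Prop} (n : ℤ) (hS : ∀ N, S N → S' (N.shift n)) :
    Decomposition S' (M.shift n) where
  J := D.J
  F j := (D.F j).shift n
  prop j := hS _ (D.prop j)
  ι j := shiftHom (D.ι j) n
  π j := shiftHom (D.π j) n
  π_ι := D.π_ι
  π_ι_ne := D.π_ι_ne
  total := D.total

end Decomposition

/-- A zero module. -/
def zero : GrMod 𝒜 where
  carrier := PUnit
  gr _ := ⊤
  isInternal := isInternal_of_proj _ (fun _ => 0) (fun _ _ => trivial)
    (fun _ _ _ => Subsingleton.elim _ _) (fun _ _ _ _ _ => rfl)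
    fun _ => ⟨∅, Subsingleton.elim _ _⟩
  smul_mem _ _ := trivial

instance : Subsingleton (zero : GrMod 𝒜) := inferInstanceAs (Subsingleton PUnit)

/-- The decomposition of a zero module. -/
def Decomposition.ofSubsingleton (S : GrMod 𝒜 → Prop) (M : GrMod 𝒜) [Subsingleton M] :
    Decomposition S M where
  J := Empty
  F := Empty.elim
  prop := fun j => j.elim
  ι := fun j => j.elim
  π := fun j => j.elim
  π_ι := fun j => j.elim
  π_ι_ne := fun j => j.elim
  total := fun _ => Subsingleton.elim _ _

/-- The direct sum of two graded modules. -/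
def prod (M N : GrMod 𝒜) : GrMod 𝒜 where
  carrier := M × N
  gr i := (M.gr i).prod (N.gr i)
  isInternal := by
    refine isInternal_of_proj _ (fun j => (M.proj j).prodMap (N.proj j))
      (fun j x => ⟨M.proj_mem _ _, N.proj_mem _ _⟩)
      (fun j x hx => Prod.ext (M.proj_of_mem hx.1) (N.proj_of_mem hx.2))
      (fun i j x hx h => Prod.ext (M.proj_of_mem_ne hx.1 h) (N.proj_of_mem_ne hx.2 h)) ?_
    classical
    intro x
    obtain ⟨s, hs⟩ := M.exists_sum_proj x.1
    obtain ⟨t, ht⟩ := N.exists_sum_proj x.2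
    have key : ∀ (M : GrMod 𝒜) (s t : Finset ℤ) (x : M), x = ∑ i ∈ s, M.proj i x → s ⊆ t →
        x = ∑ i ∈ t, M.proj i x := by
      intro M s t x hs hst
      rw [← Finset.sum_subset hst]
      · exact hs
      · intro i _ hi
        rw [hs, map_sum]
        refine Finset.sum_eq_zero fun j hj => M.proj_of_mem_ne (M.proj_mem j x) ?_
        rintro rfl
        exact hi hj
    refine ⟨s ∪ t, Prod.ext ?_ ?_⟩
    · rw [Prod.fst_sum]
      exact key M s _ x.1 hs Finset.subset_union_left
    · rw [Prod.snd_sum]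
      exact key N t _ x.2 ht Finset.subset_union_right
  smul_mem ha hx := ⟨M.smul_mem ha hx.1, N.smul_mem ha hx.2⟩

/-- The map to a direct sum of two graded modules. -/
def prodLift {X M N : GrMod 𝒜} (f : X ⟶ M) (g : X ⟶ N) : X ⟶ M.prod N :=
  ofLin (M := X) (N := M.prod N) ((toLin f).prod (toLin g)) fun i x hx => ⟨f.2 i x hx, g.2 i x hx⟩

/-- The first projection. -/
def prodFst (M N : GrMod 𝒜) : M.prod N ⟶ M :=
  ofLin (M := M.prod N) (N := M) (LinearMap.fst A M N) fun _ _ hx => hx.1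

/-- The second projection. -/
def prodSnd (M N : GrMod 𝒜) : M.prod N ⟶ N :=
  ofLin (M := M.prod N) (N := N) (LinearMap.snd A M N) fun _ _ hx => hx.2

/-- The decomposition of a direct sum of two modules. -/
def Decomposition.prod {S : GrMod 𝒜 → Prop} {M N : GrMod 𝒜} (D : Decomposition S M)
    (D' : Decomposition S N) : Decomposition S (M.prod N) where
  J := D.J ⊕ D'.J
  F := Sum.elim D.F D'.F
  prop := by
    rintro (j | j)
    · exact D.prop j
    · exact D'.prop j
  ι := fun j => match j with
    | .inl j => prodLift (D.ι j) 0
    | .inr j => prodLift 0 (D'.ι j)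
  π := fun j => match j with
    | .inl j => prodFst M N ≫ D.π j
    | .inr j => prodSnd M N ≫ D'.π j
  π_ι := by
    rintro (j | j) x
    · exact D.π_ι j x
    · exact D'.π_ι j x
  π_ι_ne := by
    rintro (i | i) (j | j) hij x
    · exact D.π_ι_ne i j (fun h => hij (congrArg _ h)) x
    · exact map_zero (toLin (D'.π j))
    · exact map_zero (toLin (D.π j))
    · exact D'.π_ι_ne i j (fun h => hij (congrArg _ h)) x
  total := by
    intro x
    rw [Fintype.sum_sum_type]
    have h1 : ∀ j, toLin (prodLift (D.ι j) (0 : _ ⟶ N)) (toLin (prodFst M N ≫ D.π j) x) =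
        LinearMap.inl A M N (toLin (D.ι j) (toLin (D.π j) x.1)) := fun _ => rfl
    have h2 : ∀ j, toLin (prodLift (0 : _ ⟶ M) (D'.ι j)) (toLin (prodSnd M N ≫ D'.π j) x) =
        LinearMap.inr A M N (toLin (D'.ι j) (toLin (D'.π j) x.2)) := fun _ => rfl
    refine (congrArg₂ (· + ·) ((Finset.sum_congr rfl fun j _ => h1 j).trans
      ((map_sum _ _ _).symm.trans (congrArg _ (D.total x.1)))) ((Finset.sum_congr rfl fun j _ =>
      h2 j).trans ((map_sum _ _ _).symm.trans (congrArg _ (D'.total x.2))))).trans ?_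
    exact Prod.ext (add_zero x.1) (zero_add x.2)

/-- Induction over the number of direct summands. -/
theorem IsDirectSumOf.induction {S p : GrMod 𝒜 → Prop} (hzero : ∀ M : GrMod 𝒜, Subsingleton M → p M)
    (hprod : ∀ M N, S M → p N → p (M.prod N))
    (hiso : ∀ (M N : GrMod 𝒜) (_ : M ≅ N), p M → p N) {M : GrMod 𝒜} (hM : IsDirectSumOf S M) :
    p M := by
  obtain ⟨n, F, hF, b, ⟨hb⟩, ⟨φ⟩⟩ := hM
  -- Biproducts are unique up to isomorphism, so the given one may be replaced by one built with
  -- iterated `prod`.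
  suffices ∃ D : Limits.Bicone F, Nonempty D.IsBilimit ∧ p D.pt by
    obtain ⟨D, ⟨hD⟩, hp⟩ := this
    exact hiso _ _ (φ ≪≫ hb.isLimit.conePointUniqueUpToIso hD.isLimit).symm hp
  clear φ hb b M
  induction n with
  | zero =>
    refine ⟨{ pt := zero, π := fun j => j.elim0, ι := fun j => j.elim0, ι_π := fun j => j.elim0 },
      ⟨Limits.isBilimitOfTotal _ (GrMod.hom_ext fun x => Subsingleton.elim (α := PUnit) _ _)⟩,
      hzero _ inferInstance⟩
  | succ n ih =>
    obtain ⟨D, ⟨hD⟩, hp⟩ := ih (fun j => F j.succ) fun j => hF _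
    refine ⟨{ pt := (F 0).prod D.pt
              π := fun j => Fin.cases (motive := fun j => (F 0).prod D.pt ⟶ F j)
                (prodFst _ _) (fun j => prodSnd _ _ ≫ D.π j) j
              ι := fun j => Fin.cases (motive := fun j => F j ⟶ (F 0).prod D.pt)
                (prodLift (𝟙 _) 0) (fun j => prodLift 0 (D.ι j)) j
              ι_π := ?_ }, ⟨Limits.isBilimitOfTotal _ ?_⟩, hprod _ _ (hF 0) hp⟩
    · intro i j
      induction i using Fin.cases with
      | zero =>
        induction j using Fin.cases with
        | zero =>
          rw [dif_pos rfl]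
          exact GrMod.hom_ext fun x => rfl
        | succ j =>
          rw [dif_neg (Fin.succ_ne_zero j).symm]
          exact GrMod.hom_ext fun x => map_zero (toLin (D.π j))
      | succ i =>
        induction j using Fin.cases with
        | zero =>
          rw [dif_neg (Fin.succ_ne_zero i)]
          exact GrMod.hom_ext fun x => rfl
        | succ j =>
          have h1 : prodLift (0 : F i.succ ⟶ F 0) (D.ι i) ≫ prodSnd _ _ ≫ D.π j =
            D.ι i ≫ D.π j := rfl
          refine h1.trans ?_
          by_cases hij : i = j
          · subst hij
            simp
          · rw [Limits.bicone_ι_π_ne D hij, dif_neg fun h => hij (Fin.succ_injective _ h)]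
    · rw [Fin.sum_univ_succ]
      refine GrMod.hom_ext fun x => ?_
      rw [toLin_add, toLin_sum]
      have h1 := congrArg (fun t => toLin t x.2) (Limits.IsBilimit.total hD)
      rw [toLin_sum] at h1
      have h2 : ∀ j : Fin n, toLin (((prodSnd (F 0) D.pt ≫ D.π j) ≫ prodLift 0 (D.ι j))) x =
        LinearMap.inr A (F 0) D.pt (toLin (D.π j ≫ D.ι j) x.2) := fun _ => rfl
      refine (congrArg₂ (· + ·) rfl ((Finset.sum_congr rfl fun j _ => h2 j).trans
        ((map_sum _ _ _).symm.trans (congrArg _ h1)))).trans ?_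
      exact Prod.ext (add_zero x.1) (zero_add x.2)

end GrMod

end DirectSums

end BGG
namespace BGG

/-! ### Weights, indecomposable modules and maps fixed on the top weight -/

section TiltingModules

open GrMod

variable {k A : Type u} [Field k] [Ring A] [Algebra k A] [Module.Finite k A]
variable {Λ : Type w} [Fintype Λ] [LinearOrder Λ]
variable {𝒜 : ℤ → Submodule k A} [GradedAlgebra 𝒜] {e : Λ → A} {h : IsPositivelyGraded 𝒜 e}

theorem smul_k_comm (M : GrMod 𝒜) (a : A) (c : k) (x : M) : a • c • x = c • a • x := by
  rw [← one_smul A x, ← smul_assoc c (1 : A) x, smul_smul a, mul_smul_comm, smul_assoc, mul_one,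
    one_smul]

theorem mem_weightSpace (h : IsPositivelyGraded 𝒜 e) {M : GrMod 𝒜} {l : Λ} {x : M} :
    x ∈ weightSpace e M l ↔ e l • x = x :=
  ⟨fun ⟨y, hy⟩ => hy ▸ h.smul_smul_self l y, fun hx => ⟨x, hx⟩⟩

theorem e_smul_mem_weightSpace {M : GrMod 𝒜} (l : Λ) (x : M) : e l • x ∈ weightSpace e M l :=
  ⟨x, rfl⟩

theorem exists_ne_zero_of_finrank {M : GrMod 𝒜} {l : Λ}
    (hM : Module.finrank k (weightSpace e M l) = 1) : ∃ y : M, y ≠ 0 ∧ y ∈ weightSpace e M l := by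
  have : Nontrivial (weightSpace e M l) := Module.nontrivial_of_finrank_pos (R := k) (by omega)
  obtain ⟨y, hy⟩ := exists_ne (0 : weightSpace e M l)
  exact ⟨y.1, fun h0 => hy (Subtype.ext h0), y.2⟩

theorem Δ.gen_ne_zero (hq : IsQuasiHereditary h) (l : Λ) : Δ.gen h l ≠ 0 := by
  obtain ⟨y, hy, -⟩ := exists_ne_zero_of_finrank (hq.multiplicity_one l)
  rintro h0
  obtain ⟨a, rfl⟩ := Δ.exists_smul_gen h y
  rw [h0, smul_zero] at hy
  exact hy rfl

theorem Δ.exists_eq_smul_gen (hq : IsQuasiHereditary h) {l : Λ} {x : Δ h l} (hx : e l • x = x) :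
    ∃ c : k, x = c • Δ.gen h l := by
  have h1 : (⟨Δ.gen h l, (mem_weightSpace h).mpr (Δ.isHW_gen h l).1⟩ : weightSpace e (Δ h l) l) ≠ 0 :=
    fun h0 => Δ.gen_ne_zero hq l (congrArg Subtype.val h0)
  obtain ⟨c, hc⟩ := (finrank_eq_one_iff_of_nonzero' _ h1).mp (hq.multiplicity_one l)
    ⟨x, (mem_weightSpace h).mpr hx⟩
  exact ⟨c, (congrArg Subtype.val hc).symm⟩

/-- The weight `l` occurs in `Δ(l)` in degree zero only. -/
theorem Δ.e_smul_eq_zero (hq : IsQuasiHereditary h) {l : Λ} {i : ℤ} (hi : i ≠ 0) {x : Δ h l}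
    (hx : x ∈ (Δ h l).gr i) : e l • x = 0 := by
  obtain ⟨c, hc⟩ := Δ.exists_eq_smul_gen hq (h.smul_smul_self l x)
  refine eq_zero_of_mem_mem (h.smul_mem_gr l hx) ?_ hi
  rw [hc]
  exact Submodule.smul_mem _ _ (Δ.gen_mem h l)

/-- Highest weight vectors of `∇(l)` have degree zero. -/
theorem nabla.eq_zero_of_isHW (hq : IsQuasiHereditary h) {l m : Λ} {j : ℤ} (hj : j ≠ 0)
    {v : nabla h l} (hvj : v ∈ (nabla h l).gr j) (hv : IsHW e m v) : v = 0 := by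
  classical
  rcases lt_or_ge l m with hlm | hlm
  · rw [← hv.1, nabla.smul_eq_zero h hlm]
  refine nabla.ext_ev h fun a => ?_
  rw [smul_zero, map_zero, ← DirectSum.sum_support_decompose 𝒜 a, Finset.sum_smul, map_sum]
  refine Finset.sum_eq_zero fun i _ => ?_
  have ha := SetLike.coe_mem (DirectSum.decompose 𝒜 a i)
  generalize ((DirectSum.decompose 𝒜 a i : 𝒜 i) : A) = b at ha
  -- An element of degree `j` of `∇(l)` pairs only with `A_{-j}`. For such `b`, the vector `b • v`
  -- is the image of `b • Δ.gen h m`, whose weight `l` part is zero: either `l` lies above `m`, or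
  -- `m = l` and `b` has nonzero degree.
  by_cases hij : i = -j
  · obtain ⟨f, hf⟩ := Δ.exists_hom h hv
    rw [← nabla.ev_e_smul, ← hf, ← map_smul f, ← map_smul f]
    suffices hz : e l • b • Δ.gen h m = 0 by rw [hz, map_zero, map_zero]
    rcases lt_trichotomy m l with hml | rfl | hml
    · exact Δ.smul_eq_zero h hml _
    · refine Δ.e_smul_eq_zero hq (i := i + 0) (by omega) ?_
      exact (Δ h m).smul_mem ha (Δ.gen_mem h m)
    · exact absurd hml hlm.not_gt
  · exact nabla.gr_apply h hvj hij ha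

/-- An endomorphism of an indecomposable module that fixes a nonzero vector is injective. -/
theorem GrMod.IsIndecomposable.injective {T : GrMod 𝒜} (hT : T.IsIndecomposable) (f : T ⟶ T) {y : T}
    (hy : y ≠ 0) (hf : toLin f y = y) : Function.Injective (toLin f) := by
  have h1 : IsNoetherian A T := isNoetherian_of_tower k inferInstance
  have h2 : IsArtinian A T := isArtinian_of_tower k inferInstance
  -- Fitting's lemma: for a suitable `n ≥ 1`, `T` is the direct sum of the kernel and the range of
  -- the `n`-th power. The projection onto the range is a nonzero idempotent because it fixes `y`,
  -- so it is the identity and the kernel is zero.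
  obtain ⟨n, hn, hc⟩ := ((Filter.eventually_ge_atTop 1).and
    (LinearMap.eventually_isCompl_ker_pow_range_pow (toLin f : Module.End A T))).exists
  let φ : Module.End A T := (toLin f : Module.End A T) ^ n
  have hφ : ∃ g : T ⟶ T, toLin g = φ := by
    clear hn hc
    induction n with
    | zero => exact ⟨𝟙 T, rfl⟩
    | succ n ih =>
      obtain ⟨g, hg⟩ := ih
      exact ⟨f ≫ g, by rw [show φ = (toLin f : Module.End A T) ^ n * toLin f from pow_succ _ _, ← hg]; rfl⟩
  obtain ⟨g, hg⟩ := hφ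
  let p := (LinearMap.range φ).projection (LinearMap.ker φ) hc.symm
  have hp : ∀ i, ∀ x ∈ T.gr i, p x ∈ T.gr i := by
    intro i x hx
    -- Kernel and range of a graded map are homogeneous, so the projection preserves degrees and
    -- indecomposability in the graded category applies.
    have hz : ∀ y, T.proj i (p y) = p (T.proj i y) := by
      intro y
      have h3 : y - p y ∈ LinearMap.ker φ := by
        rw [← Submodule.projection_apply_eq_zero_iff hc.symm, map_sub,
          Submodule.projection_apply_of_mem_left hc.symm (Submodule.projection_apply_mem hc.symm y)]
        exact sub_self _
      have h4 := isHomogeneous_ker g (y - p y) (by rwa [hg]) i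
      have h5 := isHomogeneous_range g (p y) (by
        rw [hg]; exact Submodule.projection_apply_mem hc.symm y) i
      rw [hg] at h4 h5
      have h6 : T.proj i y = T.proj i (p y) + T.proj i (y - p y) := by
        rw [← map_add]; congr 1; abel
      rw [h6, map_add, (Submodule.projection_apply_eq_zero_iff hc.symm).mpr h4,
        Submodule.projection_apply_of_mem_left hc.symm h5, add_zero]
    have := hz x
    rw [T.proj_of_mem hx] at this
    exact mem_gr_of_proj_eq this
  have hpp : ofLin p hp ≫ ofLin p hp = ofLin p hp := GrMod.hom_ext fun x =>
    Submodule.projection_apply_of_mem_left hc.symm (Submodule.projection_apply_mem hc.symm x)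
  have hyr : y ∈ LinearMap.range φ := by
    refine ⟨y, ?_⟩
    have : ∀ n : ℕ, ((toLin f : Module.End A T) ^ n) y = y := by
      intro n
      induction n with
      | zero => rfl
      | succ n ih =>
        rw [pow_succ, Module.End.mul_apply]
        exact (congrArg _ hf).trans ih
    exact this n
  have hpy : p y = y := Submodule.projection_apply_of_mem_left hc.symm hyr
  rcases hT.2 (ofLin p hp) hpp with h0 | h0
  · exact absurd (hpy.symm.trans (congrArg (fun t => toLin t y) h0)) hy
  · refine (injective_iff_map_eq_zero _).mpr fun x hx => ?_
    have hx' : x ∈ LinearMap.ker φ := by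
      obtain ⟨m, rfl⟩ : ∃ m, n = m + 1 := ⟨n - 1, by omega⟩
      rw [LinearMap.mem_ker, show φ = (toLin f : Module.End A T) ^ m * toLin f from pow_succ _ _,
        Module.End.mul_apply]
      exact (congrArg _ hx).trans (map_zero _)
    exact (congrArg (fun t => toLin t x) h0).symm.trans
      ((Submodule.projection_apply_eq_zero_iff hc.symm).mpr hx')

/-- The submodule of weight `l` of a module with a standard filtration and with weights at most `l`
generates freely, up to extensions that are invisible to modules in `CoGood`. -/
theorem GrMod.HasFiltration.exists_hom (hq : IsQuasiHereditary h) {M : GrMod 𝒜}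
    (hM : HasFiltration (fun N => ∃ m n, Nonempty (N ≅ (Δ h m).shift n)) M) {l : Λ}
    (hMl : ∀ m, l < m → ∀ x : M, e m • x = 0) {N : GrMod 𝒜} (hN : CoGood h N)
    (hNl : ∀ m, l < m → ∀ x : N, e m • x = 0) (φ : M →ₗ[k] N) :
    ∃ g : M →ₗ[A] N, ∀ x, e l • x = x → g x = e l • φ x := by
  induction hM with
  | zero M hM =>
    refine ⟨0, fun x _ => ?_⟩
    rw [Subsingleton.elim x 0, map_zero, map_zero, smul_zero]
  | @extension N' M Q f q hf hfq hqs _ hQ ih =>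
    obtain ⟨m, n, ⟨ψ⟩⟩ := hQ
    obtain ⟨g₁, hg₁⟩ := ih (fun m hm x => hf (by rw [map_smul, hMl m hm, map_zero]))
      (φ ∘ₗ (toLin f).restrictScalars k)
    have hQN : ExtVanishes A Q N 1 :=
      ExtVanishes.of_equiv_left (toLinearEquiv ψ.symm) (show ExtVanishes A (Δ h m) N 1 from hN m)
    obtain ⟨v, hv⟩ := ExtVanishes.extend hf hfq hqs hQN g₁
    have hker : ∀ x, e l • x = x → toLin q x = 0 → v x = e l • φ x := by
      intro x hx hqx
      obtain ⟨y, rfl⟩ := (hfq x).mp hqx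
      rw [hv, hg₁ y (hf (by rw [map_smul, hx]))]
      rfl
    let ψ' : Q ≃ₗ[A] Δ h m := toLinearEquiv (Y := (Δ h m).shift n) ψ
    -- The extension `v` is already correct on weight `l` vectors of the submodule. For `m < l` the
    -- quotient has no weight `l`; for `m > l` it is zero, since its generator would have a
    -- forbidden weight. For `m = l`, the error of `v` at a lift of the generator is a highest
    -- weight vector, because `N` has no weights above `l`. It therefore defines a map from the
    -- quotient that corrects `v`.
    rcases lt_trichotomy m l with hml | rfl | hml
    · refine ⟨v, fun x hx => hker x hx (ψ'.injective ?_)⟩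
      rw [← hx, map_smul, map_smul, map_zero]
      exact Δ.smul_eq_zero h hml _
    · obtain ⟨x₀, hx₀⟩ := hqs (ψ'.symm (Δ.gen h m))
      have hx₁ : toLin q (e m • x₀) = ψ'.symm (Δ.gen h m) := by
        rw [map_smul, hx₀, ← map_smul, (Δ.isHW_gen h m).1]
      obtain ⟨t, ht⟩ := Δ.exists_hom h (l := m) (v := e m • φ (e m • x₀) - v (e m • x₀))
        ⟨by rw [smul_sub, h.smul_smul_self, ← map_smul v, h.smul_smul_self],
          fun m' hm' a => hNl m' hm' _⟩
      refine ⟨v + t ∘ₗ ψ'.toLinearMap ∘ₗ toLin q, fun x hx => ?_⟩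
      obtain ⟨c, hc⟩ := Δ.exists_eq_smul_gen hq (x := ψ' (toLin q x)) (by
        rw [← map_smul, ← map_smul, hx])
      have h1 := hker (x - c • e m • x₀)
        (by rw [smul_sub, hx, smul_k_comm, h.smul_smul_self])
        (by
          have : toLin q (c • e m • x₀) = c • toLin q (e m • x₀) :=
            ((toLin q).restrictScalars k).map_smul c _
          rw [map_sub, this, hx₁, sub_eq_zero]
          refine ψ'.injective (hc.trans ?_)
          have h2 := ((ψ'.toLinearMap).restrictScalars k).map_smul c (ψ'.symm (Δ.gen h m))
          refine Eq.trans ?_ h2.symm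
          exact congrArg (c • ·) (ψ'.apply_symm_apply _).symm)
      have h2 : v (c • e m • x₀) = c • v (e m • x₀) := (v.restrictScalars k).map_smul c _
      have h3 : t (c • Δ.gen h m) = c • t (Δ.gen h m) := (t.restrictScalars k).map_smul c _
      rw [map_sub, h2, map_sub, map_smul φ, smul_sub, smul_k_comm] at h1
      change v x + t (ψ' (toLin q x)) = _
      rw [hc, h3, ht, smul_sub, ← sub_eq_zero]
      rw [← sub_eq_zero] at h1
      rw [← h1]
      abel
    · refine ⟨v, fun x hx => hker x hx (ψ'.injective ?_)⟩
      rw [map_zero]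
      obtain ⟨a, ha⟩ := Δ.exists_smul_gen h (ψ' (toLin q x))
      obtain ⟨y, hy⟩ := hqs (ψ'.symm (Δ.gen h m))
      have : Δ.gen h m = 0 := by
        rw [← (Δ.isHW_gen h m).1, ← ψ'.apply_symm_apply (Δ.gen h m), ← hy, ← map_smul, ← map_smul,
          hMl m hml, map_zero, map_zero]
      rw [ha, this, smul_zero]

end TiltingModules

end BGG
namespace BGG

/-! ### Cycles of tilting complexes and degrees of highest weight vectors -/

section Complexes

open GrMod

variable {k A : Type u} [Field k] [Ring A] [Algebra k A] [Module.Finite k A]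
variable {Λ : Type w} [Fintype Λ] [LinearOrder Λ]
variable {𝒜 : ℤ → Submodule k A} [GradedAlgebra 𝒜] {e : Λ → A} {h : IsPositivelyGraded 𝒜 e}

theorem exactAt_iff (X : Cplx 𝒜) {i j m : ℤ} (hj : i + 1 = j) (hm : m + 1 = i) :
    ExactAt X i ↔ ∀ x, toLin (X.d i m) x = 0 → ∃ y, toLin (X.d j i) y = x := by
  obtain rfl : m = i - 1 := by omega
  subst hj
  refine ⟨fun hX x => (hX x).mp, fun hX x => ⟨hX x, ?_⟩⟩
  rintro ⟨y, rfl⟩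
  rw [← toLin_comp, X.d_comp_d]
  rfl

theorem toLin_d_d (X : Cplx 𝒜) {i j m : ℤ} (x : X.X i) :
    toLin (X.d j m) (toLin (X.d i j) x) = 0 := by
  rw [← toLin_comp, X.d_comp_d]
  rfl

theorem toLin_comm {X Y : Cplx 𝒜} (f : X ⟶ Y) (i j : ℤ) (x : X.X i) :
    toLin (Y.d i j) (toLin (f.f i) x) = toLin (f.f j) (toLin (X.d i j) x) := by
  rw [← toLin_comp, f.comm, toLin_comp]

theorem shortExact_cycles (X : Cplx 𝒜) {i j m : ℤ} (hj : i + 1 = j) (hm : m + 1 = i)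
    (hX : ExactAt X i) :
    ∃ g : X.X j →ₗ[A] LinearMap.ker (toLin (X.d i m)),
      Function.Exact (LinearMap.ker (toLin (X.d j i))).subtype g ∧ Function.Surjective g := by
  refine ⟨(toLin (X.d j i)).codRestrict _ fun x => toLin_d_d X x, ?_, ?_⟩
  · intro x
    rw [Subtype.ext_iff]
    change toLin (X.d j i) x = 0 ↔ _
    simp
  · rintro ⟨x, hx⟩
    obtain ⟨y, hy⟩ := (exactAt_iff X hj hm).mp hX x hx
    exact ⟨y, Subtype.ext hy⟩

/-- By exactness, the cycles in position `i` are the cokernel of the inclusion of the cycles in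
position `i + 1` into `X_{i+1}`. Starting where the complex is zero, `CoGood.cokernel` propagates
the property to the right. -/
theorem coGood_cycles (hq : IsQuasiHereditary h) (X : Cplx 𝒜) (hX : ∀ i, CoGood h (X.X i))
    {n : ℤ} (hn : ∀ i, n < i → Subsingleton (X.X i)) {a : ℤ} (ha : ∀ i, a ≤ i → ExactAt X i) {i : ℤ}
    (hi : a ≤ i) {m : ℤ} (hm : m + 1 = i) : CoGood h (LinearMap.ker (toLin (X.d i m))) := by
  obtain ⟨s, hs⟩ : ∃ s : ℕ, n < i + s := ⟨(n + 1 - i).toNat, by omega⟩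
  induction s generalizing i m with
  | zero =>
    have := hn i (by simpa using hs)
    exact .of_subsingleton
  | succ s ih =>
    obtain ⟨g, hg, hgs⟩ := shortExact_cycles X rfl hm (ha i hi)
    exact .cokernel hq (Submodule.injective_subtype _) hg hgs
      (ih (i := i + 1) (by omega) rfl (by push_cast at hs; omega)) (hX _)

/-- Dually, the cycles in position `i` are the kernel of a surjection from `X_i` onto the cycles in
position `i - 1`, so `Good.kernel` propagates from the right end. -/
theorem good_cycles (X : Cplx 𝒜) (hX : ∀ i, Good h (X.X i))
    {n : ℤ} (hn : ∀ i, i < n → Subsingleton (X.X i)) {a : ℤ} (ha : ∀ i, i < a → ExactAt X i) {i : ℤ}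
    (hi : i ≤ a) {m : ℤ} (hm : m + 1 = i) : Good h (LinearMap.ker (toLin (X.d i m))) := by
  obtain ⟨s, hs⟩ : ∃ s : ℕ, i < n + s := ⟨(i - n + 1).toNat, by omega⟩
  induction s generalizing i m with
  | zero =>
    have := hn i (by simpa using hs)
    exact .of_subsingleton
  | succ s ih =>
    obtain ⟨g, hg, hgs⟩ := shortExact_cycles X hm (m := m - 1) (by omega) (ha m (by omega))
    exact .kernel (Submodule.injective_subtype _) hg hgs (hX _)
      (ih (i := m) (by omega) (by omega) (by push_cast at hs; omega))

theorem IsTilting.good (hq : IsQuasiHereditary h) {l : Λ} {M : GrMod 𝒜} (hM : IsTilting h l M) :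
    Good h M :=
  hM.standard.good hq

theorem IsTilting.coGood {l : Λ} {M : GrMod 𝒜} (hM : IsTilting h l M) : CoGood h M :=
  hM.costandard.coGood

theorem IsTilting.smul_eq_zero {l : Λ} {M : GrMod 𝒜} (hM : IsTilting h l M) {m : Λ} (hm : l < m)
    (x : M) : e m • x = 0 := by
  have h1 := e_smul_mem_weightSpace (e := e) (k := k) m x
  rw [hM.weight_le m hm] at h1
  exact h1

theorem IsTilting.not_smul_eq_zero {l : Λ} {M : GrMod 𝒜} {i : ℤ} (hM : IsTilting h l (M.shift i)) :
    ¬ ∀ x : M, e l • x = 0 := by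
  intro h0
  obtain ⟨y, hy0, hy⟩ := exists_ne_zero_of_finrank hM.multiplicity_one
  exact hy0 (((mem_weightSpace h).mp hy).symm.trans (h0 y))

theorem GrMod.Decomposition.smul_eq_zero {S : GrMod 𝒜 → Prop} {M : GrMod 𝒜} (D : Decomposition S M)
    {a : A} (ha : ∀ x : M, a • x = 0) (j : D.J) (x : D.F j) : a • x = 0 :=
  D.ι_injective j (by rw [map_smul, ha, map_zero])

theorem good_of_isDirectSumOf {S : GrMod 𝒜 → Prop} (hS : ∀ N, S N → Good h N) {M : GrMod 𝒜}
    (hM : IsDirectSumOf S M) : Good h M := by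
  obtain ⟨D⟩ := hM.decomposition
  exact fun N _ _ hN n => .of_sum_left (fun j => toLin (D.ι j)) (fun j => toLin (D.π j)) D.total
    fun j => hS _ (D.prop j) N hN n

theorem coGood_of_isDirectSumOf {S : GrMod 𝒜 → Prop} (hS : ∀ N, S N → CoGood h N) {M : GrMod 𝒜}
    (hM : IsDirectSumOf S M) : CoGood h M := by
  obtain ⟨D⟩ := hM.decomposition
  exact fun l => .of_sum_right (fun j => toLin (D.ι j)) (fun j => toLin (D.π j)) D.total
    fun j => hS _ (D.prop j) l

theorem IsLinearTilting.good (hq : IsQuasiHereditary h) {X : Cplx 𝒜} (hX : IsLinearTilting h X)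
    (i : ℤ) : Good h (X.X i) :=
  good_of_isDirectSumOf (fun N ⟨_, hm⟩ => (hm.good hq : Good h (N.shift i))) (hX.linear i)

theorem IsLinearTilting.coGood {X : Cplx 𝒜} (hX : IsLinearTilting h X) (i : ℤ) :
    CoGood h (X.X i) :=
  coGood_of_isDirectSumOf (fun N ⟨_, hm⟩ => (hm.coGood : CoGood h (N.shift i))) (hX.linear i)

theorem IsLinearTilting.exists_bound {X : Cplx 𝒜} (hX : IsLinearTilting h X) :
    ∃ n : ℤ, (∀ i, n < i → Subsingleton (X.X i)) ∧ ∀ i, i < -n → Subsingleton (X.X i) := by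
  obtain ⟨n, hn⟩ := hX.bounded
  exact ⟨n, fun i hi => hn i (lt_of_lt_of_le hi (le_abs_self i)), fun i hi =>
    hn i (lt_of_lt_of_le (by omega) (neg_le_abs i))⟩

section Resolutions

variable {l : Λ} {X : Cplx 𝒜} {p : X.X 0 ⟶ nabla h l} (hX : IsLinearTilting h X)
  (hp : IsResolution (nabla h l) X p)

-- If `m` bounds all weights of the complex, only summands `T(m)⟨-i⟩` contribute weight `m` in
-- position `i`, and they do so in degree `i`. Since this degree depends on the position, the
-- differential must kill weight `m`.
include hX in
theorem IsLinearTilting.e_smul_mem {m : Λ} (hm : ∀ m', m < m' → ∀ i, ∀ x : X.X i, e m' • x = 0)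
    (i : ℤ) (x : X.X i) : e m • x ∈ (X.X i).gr i := by
  obtain ⟨D⟩ := (hX.linear i).decomposition
  rw [← D.total (e m • x)]
  refine Submodule.sum_mem _ fun j _ => toLin_mem _ ?_
  obtain ⟨κ, hκ⟩ := D.prop j
  rw [map_smul]
  rcases lt_trichotomy κ m with hκm | rfl | hκm
  · have : e m • toLin (D.π j) x = 0 := hκ.smul_eq_zero hκm _
    rw [this]
    exact Submodule.zero_mem _
  · have : e κ • toLin (D.π j) x ∈ (D.F j).gr (i + 0) := hκ.degree_zero (e_smul_mem_weightSpace _ _)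
    rwa [add_zero] at this
  · exact absurd (D.smul_eq_zero (hm κ hκm i) j) hκ.not_smul_eq_zero

include hX in
theorem IsLinearTilting.d_e_smul {m : Λ} (hm : ∀ m', m < m' → ∀ i, ∀ x : X.X i, e m' • x = 0)
    (i j : ℤ) (x : X.X i) : toLin (X.d i j) (e m • x) = 0 := by
  by_cases hij : j + 1 = i
  · refine eq_zero_of_mem_mem (i := i) (j := j) (toLin_mem _ (hX.e_smul_mem hm i x)) ?_ (by omega)
    rw [map_smul]
    exact hX.e_smul_mem hm j _
  · rw [X.shape i j hij]
    rfl

include hX hp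

/-- A vector of the maximal weight is a cycle, hence a boundary; the weight `m` part of a boundary
is the image of a weight `m` vector, which is zero. -/
theorem IsResolution.e_smul_eq_zero_of {m : Λ}
    (hm : ∀ m', m < m' → ∀ i, ∀ x : X.X i, e m' • x = 0) {i : ℤ} (hi : 0 < i) (x : X.X i) :
    e m • x = 0 := by
  obtain ⟨y, hy⟩ := (exactAt_iff X rfl (sub_add_cancel i 1)).mp (hp.exact i hi) _
    (hX.d_e_smul hm i _ x)
  rw [← h.smul_smul_self, ← hy, ← map_smul, hX.d_e_smul hm]

/-- Descending induction over the weights. In position `0`, vectors of weight `m > l` are boundaries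
because `∇(l)` has no such weight. -/
theorem IsResolution.e_smul_eq_zero {m : Λ} (hm : l < m) (i : ℤ) (x : X.X i) : e m • x = 0 := by
  induction m using WellFoundedGT.induction generalizing i with
  | ind m ih =>
    have hm' : ∀ m', m < m' → ∀ i, ∀ x : X.X i, e m' • x = 0 := fun m' h1 i x =>
      ih m' h1 (hm.trans h1) i x
    rcases lt_trichotomy i 0 with hi | rfl | hi
    · have := hp.zero i hi
      exact Subsingleton.elim _ _
    · obtain ⟨y, hy⟩ := (hp.exact_zero (e m • x)).mp (by
        rw [map_smul, nabla.smul_eq_zero h hm])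
      rw [← h.smul_smul_self, ← hy, ← map_smul, hX.d_e_smul hm']
    · exact IsResolution.e_smul_eq_zero_of hX hp hm' hi x

end Resolutions

/-- All highest weight vectors of the tilting module `T(l)` have nonnegative degree. -/
theorem IsTilting.eq_zero_of_isHW (hq : IsQuasiHereditary h) (hb : IsBalanced h) {l : Λ}
    {T : GrMod 𝒜} (hT : IsTilting h l T) {j : ℤ} (hj : j < 0) {m : Λ} {v : T} (hvj : v ∈ T.gr j)
    (hv : IsHW e m v) : v = 0 := by
  induction l using WellFoundedLT.induction generalizing T j m with
  | ind l ih =>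
    obtain ⟨X, p, hX, hp⟩ := hb.costandard l
    have hwt : ∀ m, l < m → ∀ i, ∀ x : X.X i, e m • x = 0 := fun m hm i x =>
      IsResolution.e_smul_eq_zero hX hp hm i x
    obtain ⟨n, hn, -⟩ := hX.exists_bound
    have hex : ∀ i, 1 ≤ i → ExactAt X i := fun i hi => hp.exact i (by omega)
    have hker1 : CoGood h (LinearMap.ker (toLin (X.d 1 0))) :=
      coGood_cycles hq X hX.coGood hn hex le_rfl (by norm_num)
    -- Weight `l` is absent in position `1`, so only `T(κ)⟨-1⟩` with `κ < l` occur. The internal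
    -- shift turns `j ≤ 0` into `j - 1 < 0`, and induction applies.
    have hHW1 : ∀ j ≤ 0, ∀ m, ∀ v ∈ (X.X 1).gr j, IsHW e m v → v = 0 := by
      intro j hj m v hvj hv
      obtain ⟨D⟩ := (hX.linear 1).decomposition
      refine D.eq_zero fun s => ?_
      obtain ⟨κ, hκ⟩ := D.prop s
      have hκl : κ < l := by
        rcases lt_trichotomy κ l with h1 | rfl | h1
        · exact h1
        · exact absurd (D.smul_eq_zero (IsResolution.e_smul_eq_zero_of hX hp hwt one_pos) s)
            hκ.not_smul_eq_zero
        · exact absurd (D.smul_eq_zero (hwt κ h1 1) s) hκ.not_smul_eq_zero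
      refine ih κ hκl hκ (j := j - 1) (by omega) (m := m) ?_ (hv.map (toLin (D.π s)))
      change toLin (D.π s) v ∈ (D.F s).gr (1 + (j - 1))
      rw [add_sub_cancel]
      exact toLin_mem _ hvj
    -- Highest weight vectors of `∇(l)` have degree zero, so `v` dies under `p` and lifts to a
    -- highest weight vector in position `1` of the same negative degree.
    have hHW0 : ∀ j < 0, ∀ m, ∀ v ∈ (X.X 0).gr j, IsHW e m v → v = 0 := by
      intro j hj m v hvj hv
      have h1 : toLin p v = 0 := nabla.eq_zero_of_isHW hq hj.ne (toLin_mem p hvj) (hv.map _)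
      obtain ⟨x, hx, hxHW, rfl⟩ := hv.exists_lift (X.d 1 0) hker1 hvj ((hp.exact_zero v).mp h1)
      rw [hHW1 j hj.le m x hx hxHW, map_zero]
    obtain ⟨y, hy0, hyw⟩ := exists_ne_zero_of_finrank hT.multiplicity_one
    have hy : e l • y = y := (mem_weightSpace h).mp hyw
    have hydeg : y ∈ T.gr 0 := hT.degree_zero hyw
    obtain ⟨θ, hθ⟩ := Module.Projective.exists_dual_eq_one k hy0
    obtain ⟨r, hr⟩ := nabla.exists_hom h (l := l) θ fun m hm a b x => by
      rw [hT.smul_eq_zero hm, smul_zero, smul_zero, map_zero]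
    obtain ⟨w₀, hw₀⟩ := hp.surjective (r y)
    let w := e l • w₀
    have hw : e l • w = w := h.smul_smul_self _ _
    have hw0 : w ≠ 0 := by
      intro h0
      have h1 : toLin p w = r y := by rw [map_smul, hw₀, ← map_smul, hy]
      rw [h0, map_zero] at h1
      have h2 := hr y
      rw [← h1, map_zero, hy, hθ] at h2
      exact zero_ne_one h2
    have hwdeg : w ∈ (X.X 0).gr 0 := hX.e_smul_mem hwt 0 w₀
    obtain ⟨θ', hθ'⟩ := Module.Projective.exists_dual_eq_one k hw0
    -- Both `T` and `X_0` have standard and costandard filtrations on each summand and weights at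
    -- most `l`, so maps with `y ↦ w` and `w ↦ y` exist. Their degree zero parts do the same, and
    -- the composite fixes `y`; indecomposability then embeds `T` into `X_0`.
    obtain ⟨f, hf⟩ := hT.standard.exists_hom hq (fun m hm x => hT.smul_eq_zero hm x) (hX.coGood 0)
      (fun m hm x => hwt m hm 0 x) (θ.smulRight w)
    have hg : ∃ g : X.X 0 →ₗ[A] T, g w = y := by
      obtain ⟨D⟩ := (hX.linear 0).decomposition
      have key : ∀ s, ∃ g : D.F s →ₗ[A] T, ∀ x, e l • x = x →
          g x = e l • (θ'.smulRight y) (toLin (D.ι s) x) := by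
        intro s
        obtain ⟨κ, hκ⟩ := D.prop s
        exact hκ.standard.exists_hom hq (fun m hm x => D.smul_eq_zero (hwt m hm 0) s x) hT.coGood
          (fun m hm x => hT.smul_eq_zero hm x)
          ((θ'.smulRight y) ∘ₗ (toLin (D.ι s)).restrictScalars k)
      choose g hg using key
      refine ⟨∑ s, g s ∘ₗ toLin (D.π s), ?_⟩
      rw [LinearMap.sum_apply]
      have h1 : ∀ s, (g s ∘ₗ toLin (D.π s)) w =
          e l • (θ'.smulRight y) (toLin (D.ι s) (toLin (D.π s) w)) := fun s =>
        hg s _ (by rw [← map_smul, hw])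
      rw [Finset.sum_congr rfl fun s _ => h1 s, ← Finset.smul_sum, ← map_sum, D.total]
      rw [LinearMap.smulRight_apply, hθ', one_smul, hy]
    obtain ⟨g, hg⟩ := hg
    obtain ⟨f', hf'⟩ := exists_degree_zero_part f
    obtain ⟨g', hg'⟩ := exists_degree_zero_part g
    have hf'y : toLin f' y = w := by
      rw [hf' 0 y hydeg, hf y hy, LinearMap.smulRight_apply, hθ, one_smul, hw,
        (X.X 0).proj_of_mem hwdeg]
    have hg'w : toLin g' w = y := by
      rw [hg' 0 w hwdeg, hg, T.proj_of_mem hydeg]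
    have hinj := hT.indecomposable.injective (f' ≫ g') hy0 (by rw [toLin_comp, hf'y, hg'w])
    apply hinj
    rw [map_zero, toLin_comp, hHW0 j hj m _ (toLin_mem f' hvj) (hv.map _), map_zero]

theorem IsLinearTilting.eq_zero_of_isHW (hq : IsQuasiHereditary h) (hb : IsBalanced h)
    {X : Cplx 𝒜} (hX : IsLinearTilting h X) {i j : ℤ} (hj : j < i) {m : Λ} {v : X.X i}
    (hvj : v ∈ (X.X i).gr j) (hv : IsHW e m v) : v = 0 := by
  obtain ⟨D⟩ := (hX.linear i).decomposition
  refine D.eq_zero fun s => ?_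
  obtain ⟨κ, hκ⟩ := D.prop s
  refine hκ.eq_zero_of_isHW hq hb (j := j - i) (by omega) (m := m) ?_ (hv.map (toLin (D.π s)))
  change toLin (D.π s) v ∈ (D.F s).gr (i + (j - i))
  rw [add_sub_cancel]
  exact toLin_mem _ hvj

end Complexes

end BGG
namespace BGG

/-- Construction of a family of objects by recursion in both directions. -/
theorem exists_int_family {H : ℤ → Type*} (I : ∀ i, H i → Prop) (R : ∀ i j, H i → H j → Prop) {a : ℤ}
    (g₀ : H a) (h₀ : I a g₀)
    (up : ∀ i j, i + 1 = j → a ≤ i → ∀ g, I i g → ∃ g', I j g' ∧ R i j g g')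
    (down : ∀ i j, i + 1 = j → i < a → ∀ g, I j g → ∃ g', I i g' ∧ R i j g' g) :
    ∃ ψ : ∀ i, H i, ψ a = g₀ ∧ (∀ i, I i (ψ i)) ∧ ∀ i j, i + 1 = j → R i j (ψ i) (ψ j) := by
  choose u hu hu' using fun i => up i (i + 1) rfl
  choose d hd hd' using fun i => down (i - 1) i (by omega)
  let ψ : ∀ i, {g : H i // I i g} := fun i => i.inductionOn' (motive := fun i => {g : H i // I i g})
    a ⟨g₀, h₀⟩ (fun i hi g => ⟨u i hi g.1 g.2, hu _ _ _ _⟩)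
    (fun i hi g => ⟨d i (by omega) g.1 g.2, hd _ _ _ _⟩)
  refine ⟨fun i => (ψ i).1, ?_, fun i => (ψ i).2, ?_⟩
  · exact congrArg Subtype.val (Int.inductionOn'_self (motive := fun i => {g : H i // I i g}) ..)
  · intro i j hij
    rcases le_or_gt a i with hai | hai
    · subst hij
      have : ψ (i + 1) = _ :=
        Int.inductionOn'_add_one (motive := fun i => {g : H i // I i g}) hai
      beta_reduce
      rw [this]
      exact hu' _ _ _ _
    · obtain rfl : i = j - 1 := by omega
      have : ψ (j - 1) = _ :=
        Int.inductionOn'_sub_one (motive := fun i => {g : H i // I i g}) (by omega)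
      beta_reduce
      rw [this]
      exact hd' _ _ _ _

/-! ### Linear complexes of standard modules and their chain maps -/

section StandardComplexes

open GrMod

variable {k A : Type u} [Field k] [Ring A] [Algebra k A] [Module.Finite k A]
variable {Λ : Type w} [Fintype Λ] [LinearOrder Λ]
variable {𝒜 : ℤ → Submodule k A} [GradedAlgebra 𝒜] {e : Λ → A} {h : IsPositivelyGraded 𝒜 e}

/-- The inclusion of the kernel of a morphism. -/
def GrMod.kernelι {M N : GrMod 𝒜} (f : M ⟶ N) : GrMod.kernel f ⟶ M :=
  ofLin (M := GrMod.kernel f) (N := M) (LinearMap.ker (toLin f)).subtype fun _ _ hx => hx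

theorem GrMod.kernelι_injective {M N : GrMod 𝒜} (f : M ⟶ N) :
    Function.Injective (toLin (kernelι f)) := Subtype.val_injective

/-- The chain map given by a compatible family of morphisms. -/
def mkChainMap {X Y : Cplx 𝒜} (f : ∀ i, X.X i ⟶ Y.X i)
    (hf : ∀ i j, i + 1 = j → f j ≫ Y.d j i = X.d j i ≫ f i) : X ⟶ Y where
  f := f
  comm' i j hij := hf j i hij

theorem Δ.eq_zero_of_neg {l : Λ} {i : ℤ} (hi : i < 0) {x : Δ h l} (hx : x ∈ (Δ h l).gr i) :
    x = 0 := by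
  obtain ⟨y, hy, rfl⟩ := hx
  have h1 : (show Submodule.span A {e l} from y).1 ∈ 𝒜 i := hy
  rw [h.neg i hi] at h1
  have h2 : y = 0 := Subtype.ext h1
  exact (congrArg _ h2).trans (map_zero _)

theorem Δ.exists_of_mem_gr_zero {l : Λ} {x : Δ h l} (hx : x ∈ (Δ h l).gr 0) :
    ∃ c : k, x = c • Δ.gen h l := by
  obtain ⟨y, hy, rfl⟩ := hx
  have h1 : (show Submodule.span A {e l} from y).1 ∈ 𝒜 0 := hy
  have key : ∀ a ∈ 𝒜 0, ∃ c : k, a • Δ.gen h l = c • Δ.gen h l := by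
    intro a ha
    rw [h.zero] at ha
    induction ha using Submodule.span_induction with
    | mem a ha =>
      obtain ⟨m, rfl⟩ := ha
      by_cases hml : m = l
      · subst hml
        exact ⟨1, by rw [one_smul, (Δ.isHW_gen h m).1]⟩
      · exact ⟨0, by rw [zero_smul, ← (Δ.isHW_gen h l).1, h.smul_smul_ne hml]⟩
    | zero => exact ⟨0, by rw [zero_smul, zero_smul]⟩
    | add a b _ _ ha hb =>
      obtain ⟨c, hc⟩ := ha
      obtain ⟨d, hd⟩ := hb
      exact ⟨c + d, by rw [add_smul, hc, hd, add_smul]⟩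
    | smul t a _ ha =>
      obtain ⟨c, hc⟩ := ha
      exact ⟨t * c, by rw [smul_assoc, hc, mul_smul]⟩
  obtain ⟨c, hc⟩ := key _ h1
  refine ⟨c, ?_⟩
  rw [← hc]
  exact congrArg (traceAbove e (P h l) l).mkQ (P.smul_gen h y).symm

/-- Modules that are isomorphic to `Δ(m)⟨-i⟩` for some `m`. -/
def IsShiftedStandard (h : IsPositivelyGraded 𝒜 e) (i : ℤ) (M : GrMod 𝒜) : Prop :=
  ∃ m, Nonempty (M ≅ (Δ h m).shift (-i))

section DirectSumsOfStandards

variable {i : ℤ} {M : GrMod 𝒜}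

/-- Degree `i` of each summand `Δ(l)⟨-i⟩` is spanned by its generator, so a vector of weight `m`
there has components only in copies of `Δ(m)`. -/
theorem isHW_of_isDirectSumOf (hM : IsDirectSumOf (IsShiftedStandard h i) M) {v : M}
    (hvi : v ∈ M.gr i) {m : Λ} (hv : e m • v = v) : IsHW e m v := by
  obtain ⟨D⟩ := hM.decomposition
  refine ⟨hv, fun m' hm' a => D.eq_zero fun j => ?_⟩
  obtain ⟨l, ⟨φ⟩⟩ := D.prop j
  let φ' : D.F j ≃ₗ[A] Δ h l := toLinearEquiv (Y := (Δ h l).shift (-i)) φ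
  have h1 : φ' (toLin (D.π j) v) ∈ (Δ h l).gr (-i + i) := toLin_mem φ.hom (toLin_mem (D.π j) hvi)
  rw [neg_add_cancel] at h1
  obtain ⟨c, hc⟩ := Δ.exists_of_mem_gr_zero h1
  have h2 : e m • φ' (toLin (D.π j) v) = φ' (toLin (D.π j) v) := by
    rw [← map_smul, ← map_smul, hv]
  suffices hz : e m' • a • φ' (toLin (D.π j) v) = 0 by
    apply φ'.injective
    rw [map_zero, map_smul, map_smul, map_smul, map_smul, hz]
  by_cases hml : m = l
  · subst hml
    exact Δ.smul_eq_zero h hm' _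
  · rw [← h2, hc, smul_k_comm, ← (Δ.isHW_gen h l).1, h.smul_smul_ne hml, smul_zero, smul_zero,
      smul_zero]

theorem eq_zero_of_isDirectSumOf (hM : IsDirectSumOf (IsShiftedStandard h i) M) {v : M} {j : ℤ}
    (hj : j < i) (hv : v ∈ M.gr j) : v = 0 := by
  obtain ⟨D⟩ := hM.decomposition
  refine D.eq_zero fun s => ?_
  obtain ⟨l, ⟨φ⟩⟩ := D.prop s
  let φ' : D.F s ≃ₗ[A] Δ h l := toLinearEquiv (Y := (Δ h l).shift (-i)) φ
  have h1 : φ' (toLin (D.π s) v) ∈ (Δ h l).gr (-i + j) := toLin_mem φ.hom (toLin_mem (D.π s) hv)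
  exact φ'.injective ((Δ.eq_zero_of_neg (by omega) h1).trans (map_zero _).symm)

theorem exists_gt_of_isDirectSumOf (hq : IsQuasiHereditary h)
    (hM : IsDirectSumOf (IsShiftedStandard h i) M) {v : M} (hvi : v ∈ M.gr (i + 1)) {m : Λ}
    (hv : e m • v = v) (hv0 : v ≠ 0) : ∃ l, m < l ∧ ∃ x ∈ M.gr i, e l • x = x ∧ x ≠ 0 := by
  obtain ⟨D⟩ := hM.decomposition
  obtain ⟨s, hs⟩ := D.exists_ne_zero hv0
  obtain ⟨l, ⟨φ⟩⟩ := D.prop s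
  let φ' : D.F s ≃ₗ[A] Δ h l := toLinearEquiv (Y := (Δ h l).shift (-i)) φ
  have h1 : φ' (toLin (D.π s) v) ∈ (Δ h l).gr (-i + (i + 1)) :=
    toLin_mem φ.hom (toLin_mem (D.π s) hvi)
  have h2 : e m • φ' (toLin (D.π s) v) = φ' (toLin (D.π s) v) := by
    rw [← map_smul, ← map_smul, hv]
  have h3 : φ' (toLin (D.π s) v) ≠ 0 := fun h0 => hs (φ'.injective (h0.trans (map_zero _).symm))
  refine ⟨l, ?_, toLin (D.ι s) (φ'.symm (Δ.gen h l)), toLin_mem _ ?_, ?_, ?_⟩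
  · rcases lt_trichotomy m l with hml | rfl | hml
    · exact hml
    · exact absurd (h2.symm.trans (Δ.e_smul_eq_zero hq (by omega) h1)) h3
    · exact absurd (h2.symm.trans (Δ.smul_eq_zero h hml _)) h3
  · refine toLin_mem (X := (Δ h l).shift (-i)) φ.inv ?_
    change Δ.gen h l ∈ (Δ h l).gr (-i + i)
    rw [neg_add_cancel]
    exact Δ.gen_mem h l
  · rw [← map_smul, ← map_smul, (Δ.isHW_gen h l).1]
  · intro h0
    have h4 := D.ι_injective s (h0.trans (map_zero _).symm)
    exact Δ.gen_ne_zero hq l (φ'.symm.injective (h4.trans (map_zero _).symm))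

/-- The image of the generator of `Δ(m)` in a direct summand isomorphic to `Δ(m)⟨-i⟩`. -/
theorem exists_generator {F : GrMod 𝒜} {m : Λ} (φ : F ≅ (Δ h m).shift (-i)) :
    ∃ x ∈ F.gr i, IsHW e m x ∧ toLin φ.hom x = Δ.gen h m := by
  let ψ : F ≃ₗ[A] Δ h m := toLinearEquiv (Y := (Δ h m).shift (-i)) φ
  refine ⟨toLin φ.inv (Δ.gen h m), toLin_mem (X := (Δ h m).shift (-i)) φ.inv ?_,
    (Δ.isHW_gen h m).map ψ.symm.toLinearMap, ?_⟩
  · change Δ.gen h m ∈ (Δ h m).gr (-i + i)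
    rw [neg_add_cancel]
    exact Δ.gen_mem h m
  · exact (toLinearEquiv φ).apply_symm_apply _

theorem hom_ext_generator {F N : GrMod 𝒜} {m : Λ} (φ : F ≅ (Δ h m).shift (-i)) {x : F}
    (hx : toLin φ.hom x = Δ.gen h m) {f g : F ⟶ N} (hfg : toLin f x = toLin g x) : f = g := by
  let ψ : F ≃ₗ[A] Δ h m := toLinearEquiv (Y := (Δ h m).shift (-i)) φ
  have hx' : ψ.symm (Δ.gen h m) = x := (LinearEquiv.symm_apply_eq ψ).mpr hx.symm
  have h1 : toLin f ∘ₗ ψ.symm.toLinearMap = toLin g ∘ₗ ψ.symm.toLinearMap :=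
    Δ.hom_ext_linear h (by
      rw [LinearMap.comp_apply, LinearMap.comp_apply, LinearEquiv.coe_coe, hx', hfg])
  refine GrMod.hom_ext fun y => ?_
  rw [← ψ.symm_apply_apply y]
  exact LinearMap.congr_fun h1 (ψ y)

theorem hom_ext_of_isDirectSumOf (hM : IsDirectSumOf (IsShiftedStandard h i) M) {N : GrMod 𝒜}
    {f g : M ⟶ N} (hfg : ∀ m, ∀ v ∈ M.gr i, IsHW e m v → toLin f v = toLin g v) : f = g := by
  obtain ⟨D⟩ := hM.decomposition
  refine D.hom_ext fun j => ?_
  obtain ⟨m, ⟨φ⟩⟩ := D.prop j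
  obtain ⟨x, hx, hxHW, hφ⟩ := exists_generator φ
  exact hom_ext_generator φ hφ (hfg m _ (toLin_mem _ hx) (hxHW.map _))

theorem exists_lift_of_isDirectSumOf (hM : IsDirectSumOf (IsShiftedStandard h i) M)
    {E F : GrMod 𝒜} (g : E ⟶ F) (u : M ⟶ F)
    (hu : ∀ m, ∀ v ∈ M.gr i, IsHW e m v → ∃ w ∈ E.gr i, IsHW e m w ∧ toLin g w = toLin u v) :
    ∃ v : M ⟶ E, v ≫ g = u := by
  obtain ⟨D⟩ := hM.decomposition
  refine D.exists_lift g u fun j => ?_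
  obtain ⟨m, ⟨φ⟩⟩ := D.prop j
  obtain ⟨x, hx, hxHW, hφ⟩ := exists_generator φ
  obtain ⟨w, hw, hwHW, hgw⟩ := hu m _ (toLin_mem (D.ι j) hx) (hxHW.map _)
  obtain ⟨t, ht⟩ := Δ.exists_shift_hom h hwHW hw (neg_add_cancel i)
  refine ⟨φ.hom ≫ t, hom_ext_generator φ hφ ?_⟩
  rw [toLin_comp, toLin_comp, toLin_comp, hφ, ← hgw]
  exact congrArg _ ht

end DirectSumsOfStandards

/-- Complexes of which the highest weight vectors behave as in linear resolutions. -/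
structure HWLifting {l : Λ} (Y : Cplx 𝒜) (r : GrMod.kernel (Y.d 0 (-1)) ⟶ L h l) : Prop where
  lift_zero : ∀ m, ∀ x ∈ (L h l).gr 0, IsHW e m x →
    ∃ z ∈ (GrMod.kernel (Y.d 0 (-1))).gr 0, IsHW e m z ∧ toLin r z = x
  lift : ∀ i j, 0 ≤ i → i + 1 = j → ∀ m, ∀ v ∈ (Y.X i).gr j, IsHW e m v →
    (∃ y, toLin (Y.d j i) y = v) → ∃ w ∈ (Y.X j).gr j, IsHW e m w ∧ toLin (Y.d j i) w = v
  unique : ∀ i j, 0 ≤ i → i + 1 = j → ∀ m, ∀ v ∈ (Y.X i).gr i, IsHW e m v →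
    (∃ y, toLin (Y.d j i) y = v) → v = 0
  exact : ∀ i, 0 < i → ExactAt Y i
  ker : ∀ z : GrMod.kernel (Y.d 0 (-1)), toLin r z = 0 ↔ ∃ y, toLin (Y.d 1 0) y = z.1

section Lifting

variable {l : Λ} {X Y : Cplx 𝒜} {p : X.X 0 ⟶ L h l} {r : GrMod.kernel (Y.d 0 (-1)) ⟶ L h l}

/-- The comparison theorem for resolutions, with projectivity replaced by lifting of highest weight
vectors: it suffices to lift the images of the generators of the summands. -/
theorem HWLifting.exists_compatible (hX : IsBGGComplex h l X p) (hY : HWLifting Y r) :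
    ∃ f : X ⟶ Y, Compatible h p r f := by
  obtain ⟨v, hv⟩ := exists_lift_of_isDirectSumOf (hX.linear 0) r p fun m x hx hxHW => by
    obtain ⟨z, hz, hzHW, hzx⟩ := hY.lift_zero m _ (toLin_mem p hx) (hxHW.map _)
    exact ⟨z, hz, hzHW, hzx⟩
  obtain ⟨ψ, hψ, -, hcomm⟩ := exists_int_family (H := fun i => X.X i ⟶ Y.X i) (a := 0)
    -- From position `0` upwards, the invariant says that boundaries go to boundaries, which permits
    -- the next lift. At or below `0` it says that `g` lands in cycles, so the map can be continued
    -- by zero.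
    (fun i g => (0 ≤ i → ∀ j, i + 1 = j → ∀ x, ∃ y, toLin (Y.d j i) y = toLin g (toLin (X.d j i) x))
      ∧ (i ≤ 0 → ∀ m, g ≫ Y.d i m = 0))
    (fun i j g g' => g' ≫ Y.d j i = X.d j i ≫ g) (v ≫ kernelι _) ⟨by
      rintro - j rfl x
      refine (hY.ker (toLin v (toLin (X.d 1 0) x))).mp ?_
      rw [← toLin_comp v r, hv, ← toLin_comp, hX.d_comp]
      rfl, by
      rintro - m
      by_cases hm : m = -1
      · subst hm
        exact GrMod.hom_ext fun x => (toLin v x).2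
      · rw [Y.shape 0 m (by simp; omega), Limits.comp_zero]⟩ (by
      rintro i j hij hi g ⟨hg, -⟩
      obtain ⟨g', hg'⟩ := exists_lift_of_isDirectSumOf (hX.linear j) (Y.d j i) (X.d j i ≫ g)
        fun m x hx hxHW => hY.lift i j hi hij m _ (toLin_mem _ hx) (hxHW.map _) (hg hi j hij x)
      refine ⟨g', ⟨?_, fun hj => by omega⟩, hg'⟩
      intro hj j' hj' x
      refine (exactAt_iff Y hj' hij).mp (hY.exact j (by omega)) _ ?_
      rw [← toLin_comp, hg', toLin_comp, toLin_d_d, map_zero]) (by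
      rintro i j hij hi g ⟨-, hg⟩
      refine ⟨0, ⟨fun h0 => by omega, fun _ _ => Limits.zero_comp⟩, ?_⟩
      rw [hg (by omega), Limits.comp_zero])
  refine ⟨mkChainMap ψ hcomm, fun x => ⟨?_, ?_⟩⟩
  · change toLin (ψ 0) x ∈ _
    rw [hψ]
    exact (toLin v x).2
  · have h1 : toLin (ψ 0) x = (toLin v x).1 := by
      rw [hψ]
      rfl
    refine (congrArg (toLin r) (Subtype.ext h1 : _ = toLin v x)).trans ?_
    rw [← toLin_comp, hv]

/-- On a generator in position `i`, the difference of two such maps is a boundary and a highest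
weight vector of degree `i`. The field `unique` forces it to vanish, so the maps agree, not only up
to homotopy. -/
theorem HWLifting.compatible_unique (hX : IsBGGComplex h l X p) (hY : HWLifting Y r)
    {f g : X ⟶ Y} (hf : Compatible h p r f) (hg : Compatible h p r g) : f = g := by
  have key : ∀ n : ℕ, f.f n = g.f n := by
    intro n
    induction n with
    | zero =>
      refine hom_ext_of_isDirectSumOf (hX.linear 0) fun m v hv hvHW => ?_
      obtain ⟨h1, h2⟩ := hf v
      obtain ⟨h3, h4⟩ := hg v
      rw [← sub_eq_zero]
      refine hY.unique 0 1 le_rfl rfl m _ (Submodule.sub_mem _ (toLin_mem _ hv) (toLin_mem _ hv)) ?_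
        ?_
      · rw [← toLin_sub]
        exact hvHW.map _
      · exact (hY.ker _).mp ((map_sub (toLin r) (⟨toLin (f.f 0) v, h1⟩ : GrMod.kernel (Y.d 0 (-1)))
          (⟨toLin (g.f 0) v, h3⟩ : GrMod.kernel (Y.d 0 (-1)))).trans
          (sub_eq_zero.mpr (h2.trans h4.symm)))
    | succ n ih =>
      push_cast
      refine hom_ext_of_isDirectSumOf (hX.linear _) fun m v hv hvHW => ?_
      rw [← sub_eq_zero]
      refine hY.unique _ (n + 1 + 1 : ℤ) (by omega) rfl m _
        (Submodule.sub_mem _ (toLin_mem _ hv) (toLin_mem _ hv)) ?_ ?_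
      · rw [← toLin_sub]
        exact hvHW.map _
      · refine (exactAt_iff Y rfl (m := (n : ℤ)) rfl).mp (hY.exact _ (by omega)) _ ?_
        rw [map_sub, toLin_comm, toLin_comm, ih, sub_self]
  ext i : 1
  rcases lt_or_ge i 0 with hi | hi
  · have := hX.zero i hi
    refine GrMod.hom_ext fun x => ?_
    rw [Subsingleton.elim x 0, map_zero, map_zero]
  · obtain ⟨n, rfl⟩ := Int.eq_ofNat_of_zero_le hi
    exact key n

/-- Weight vectors of degree `i` in position `i` are automatically highest weight vectors, so
applying `e m` to any homogeneous preimage gives a lift. Uniqueness holds because the term in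
position `i + 1` is zero in degree `i`. -/
theorem IsBGGResolution.hwLifting (hX : IsBGGResolution h l X p) :
    HWLifting X (kernelι (X.d 0 (-1)) ≫ p) where
  lift_zero m x hx hxHW := by
    obtain ⟨y, hy, rfl⟩ := exists_mem_gr_of_mem_range hx (hX.surjective x)
    have hsub := hX.zero (-1) (by norm_num)
    refine ⟨⟨e m • y, Subsingleton.elim _ _⟩, h.smul_mem_gr m hy, ?_, ?_⟩
    · exact (isHW_of_isDirectSumOf (hX.linear 0) (h.smul_mem_gr m hy)
        (h.smul_smul_self m y)).of_map (kernelι_injective (X.d 0 (-1)))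
    · refine Eq.trans ?_ hxHW.1
      rw [← map_smul]
      rfl
  lift i j hi hij m v hv hvHW hy := by
    obtain ⟨y, hyj, rfl⟩ := exists_mem_gr_of_mem_range hv hy
    refine ⟨e m • y, h.smul_mem_gr m hyj, isHW_of_isDirectSumOf (hX.linear j)
      (h.smul_mem_gr m hyj) (h.smul_smul_self m y), ?_⟩
    rw [map_smul, hvHW.1]
  unique i j hi hij m v hv hvHW hy := by
    obtain ⟨y, hyj, rfl⟩ := exists_mem_gr_of_mem_range hv hy
    rw [eq_zero_of_isDirectSumOf (hX.linear j) (by omega) hyj, map_zero]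
  exact := hX.exact.exact
  ker z := (hX.exact.exact_zero z.1)

/-- The kernel of `r` consists of the boundaries in position `0`, that is, `Y_1` modulo its cycles.
-/
theorem IsTiltingModel.coGood_ker (hq : IsQuasiHereditary h) (hY : IsTiltingModel h l Y r) :
    CoGood h (LinearMap.ker (toLin r)) := by
  obtain ⟨n, hn, -⟩ := hY.linear.exists_bound
  have h1 : CoGood h (LinearMap.ker (toLin (Y.d 1 0))) :=
    coGood_cycles hq Y hY.linear.coGood hn (fun i (hi : 1 ≤ i) => hY.exact i (by omega)) le_rfl rfl
  let g : Y.X 1 →ₗ[A] LinearMap.ker (toLin r) :=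
    LinearMap.codRestrict _ (LinearMap.codRestrict (LinearMap.ker (toLin (Y.d 0 (-1))))
      (toLin (Y.d 1 0)) fun x => toLin_d_d Y x) fun x => (hY.ker _).mpr ⟨x, rfl⟩
  refine CoGood.cokernel hq (g := g) (Submodule.injective_subtype _) ?_ ?_ h1 (hY.linear.coGood 1)
  · intro x
    refine ⟨fun h0 => ⟨⟨x, congrArg (fun t : LinearMap.ker (toLin r) =>
      toLin (kernelι (Y.d 0 (-1))) t.1) h0⟩, rfl⟩, ?_⟩
    rintro ⟨⟨x, hx⟩, rfl⟩
    exact Subtype.ext (Subtype.ext hx)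
  · rintro ⟨z, hz⟩
    obtain ⟨y, hy⟩ := (hY.ker z).mp hz
    exact ⟨y, Subtype.ext (Subtype.ext hy)⟩

/-- Lifts exist because the kernels involved are `CoGood`. A lift to position `i + 1` of a vector of
degree `i` has too small a degree, hence is zero. -/
theorem IsTiltingModel.hwLifting (hq : IsQuasiHereditary h) (hb : IsBalanced h)
    (hY : IsTiltingModel h l Y r) : HWLifting Y r := by
  obtain ⟨n, hn, -⟩ := hY.linear.exists_bound
  have h1 : ∀ i j, 0 ≤ i → i + 1 = j → CoGood h (LinearMap.ker (toLin (Y.d j i))) :=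
    fun i j hi hij => coGood_cycles hq Y hY.linear.coGood hn
      (fun i (hi : 1 ≤ i) => hY.exact i (by omega)) (by omega) hij
  refine ⟨?_, ?_, ?_, fun i hi => hY.exact i hi.ne', hY.ker⟩
  · intro m x hx hxHW
    exact hxHW.exists_lift r (hY.coGood_ker hq) hx (hY.surjective x)
  · intro i j hi hij m v hv hvHW hy
    exact hvHW.exists_lift _ (h1 i j hi hij) hv hy
  · intro i j hi hij m v hv hvHW hy
    obtain ⟨w, hw, hwHW, rfl⟩ := hvHW.exists_lift _ (h1 i j hi hij) hv hy
    rw [hY.linear.eq_zero_of_isHW hq hb (by omega) hw hwHW, map_zero]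

theorem compatible_kernelι_iff {p' : Y.X 0 ⟶ L h l} (hY : Subsingleton (Y.X (-1))) {f : X ⟶ Y} :
    Compatible h p (kernelι (Y.d 0 (-1)) ≫ p') f ↔ f.f 0 ≫ p' = p := by
  constructor
  · intro hf
    exact GrMod.hom_ext fun x => (hf x).2
  · rintro hf x
    exact ⟨Subsingleton.elim _ _, congrArg (fun t => toLin t x) hf⟩

/-- Uniqueness of BGG resolutions. -/
theorem IsBGGResolution.exists_iso {p' : Y.X 0 ⟶ L h l} (hX : IsBGGResolution h l X p)
    (hY : IsBGGResolution h l Y p') : ∃ f : X ≅ Y, f.hom.f 0 ≫ p' = p := by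
  have hX1 := hX.zero (-1) (by norm_num)
  have hY1 := hY.zero (-1) (by norm_num)
  obtain ⟨f, hf⟩ := hY.hwLifting.exists_compatible hX.toIsBGGComplex
  obtain ⟨g, hg⟩ := hX.hwLifting.exists_compatible hY.toIsBGGComplex
  rw [compatible_kernelι_iff hY1] at hf
  rw [compatible_kernelι_iff hX1] at hg
  refine ⟨⟨f, g, hX.hwLifting.compatible_unique hX.toIsBGGComplex
    ((compatible_kernelι_iff hX1).mpr ?_) ((compatible_kernelι_iff hX1).mpr ?_),
    hY.hwLifting.compatible_unique hY.toIsBGGComplex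
    ((compatible_kernelι_iff hY1).mpr ?_) ((compatible_kernelι_iff hY1).mpr ?_)⟩, hf⟩
  · rw [HomologicalComplex.comp_f, Category.assoc, hg, hf]
  · simp
  · rw [HomologicalComplex.comp_f, Category.assoc, hf, hg]
  · simp

/-- BGG resolutions are bounded. -/
theorem IsBGGResolution.bounded (hq : IsQuasiHereditary h) (hX : IsBGGResolution h l X p) {i : ℤ}
    (hi : (Fintype.card Λ : ℤ) < i) : Subsingleton (X.X i) := by
  classical
  -- A nonzero weight `m` vector of degree `i` in position `i > 0` has nonzero image in position `i
  -- - 1`, one degree above the bottom. It thus lies over generators of strictly larger weight, so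
  -- position `n` requires `n` weights above `m`.
  have key : ∀ n : ℕ, ∀ i : ℤ, i = n → ∀ m, ∀ x ∈ (X.X i).gr i, e m • x = x → x ≠ 0 →
      n ≤ (Finset.univ.filter (m < ·)).card := by
    intro n
    induction n with
    | zero => exact fun _ _ _ _ _ _ _ => Nat.zero_le _
    | succ n ih =>
      intro i hi m x hx hmx hx0
      obtain ⟨j, rfl⟩ : ∃ j, i = j + 1 := ⟨i - 1, by omega⟩
      push_cast at hi
      have h1 : toLin (X.d (j + 1) j) x ≠ 0 := by
        intro h0
        obtain ⟨y, hy⟩ := (exactAt_iff X rfl rfl).mp (hX.exact.exact _ (by omega)) x h0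
        obtain ⟨y, hy', hyx⟩ := exists_mem_gr_of_mem_range hx ⟨y, hy⟩
        rw [eq_zero_of_isDirectSumOf (hX.linear _) (by omega) hy', map_zero] at hyx
        exact hx0 hyx.symm
      obtain ⟨l, hml, y, hy, hly, hy0⟩ := exists_gt_of_isDirectSumOf hq (hX.linear j)
        (toLin_mem (X.d (j + 1) j) hx) (by rw [← map_smul, hmx]) h1
      refine Nat.succ_le_of_lt ((ih j (by omega) l y hy hly hy0).trans_lt (Finset.card_lt_card ?_))
      refine Finset.ssubset_iff_of_subset ?_ |>.mpr ⟨l, by simpa using hml, by simp⟩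
      intro t ht
      simp only [Finset.mem_filter, Finset.mem_univ, true_and] at ht ⊢
      exact hml.trans ht
  obtain ⟨n, rfl⟩ := Int.eq_ofNat_of_zero_le (show 0 ≤ i by omega)
  have h1 : 𝟙 (X.X n) = 0 := hom_ext_of_isDirectSumOf (hX.linear n) fun m v hv hvHW => by
    by_contra hv0
    have := (key n n rfl m v hv hvHW.1 hv0).trans (Finset.card_le_univ _)
    omega
  exact ⟨fun x y => by
    rw [← toLin_id x, ← toLin_id y, h1]
    rfl⟩

end Lifting

end StandardComplexes

end BGG
namespace BGG

/-! ### Comparison maps between tilting models -/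

section TiltingModels

open GrMod

variable {k A : Type u} [Field k] [Ring A] [Algebra k A] [Module.Finite k A]
variable {Λ : Type w} [Fintype Λ] [LinearOrder Λ]
variable {𝒜 : ℤ → Submodule k A} [GradedAlgebra 𝒜] {e : Λ → A} {h : IsPositivelyGraded 𝒜 e}

theorem range_eq_ker (X : Cplx 𝒜) {i j m : ℤ} (hj : i + 1 = j) (hm : m + 1 = i)
    (hX : ExactAt X i) : LinearMap.range (toLin (X.d j i)) = LinearMap.ker (toLin (X.d i m)) := by
  ext x
  refine ⟨?_, fun hx => (exactAt_iff X hj hm).mp hX x hx⟩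
  rintro ⟨y, rfl⟩
  exact toLin_d_d X y

/-- Extension of morphisms along the cycles of a right bounded complex of modules in `Good`. -/
theorem exists_extend_cycles {X : Cplx 𝒜} (hX : ∀ i, Good h (X.X i)) {n : ℤ}
    (hn : ∀ i, i < n → Subsingleton (X.X i)) {a : ℤ} (ha : ∀ i, i < a → ExactAt X i) {i m : ℤ}
    (hi : i ≤ a) (hm : m + 1 = i) {Y N : GrMod 𝒜} (f : Y ⟶ X.X i)
    (hf : LinearMap.range (toLin f) = LinearMap.ker (toLin (X.d i m))) (u : Y ⟶ N)
    (hu : ∀ y, toLin f y = 0 → toLin u y = 0) (hN : CoGood h N) : ∃ v : X.X i ⟶ N, f ≫ v = u := by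
  -- The cokernel of `f` is `X_i` modulo cycles, which is isomorphic to the boundaries, hence to the
  -- cycles, in position `i - 1`.
  have h1 : Good h (LinearMap.range (toLin (X.d i m))) := by
    rw [range_eq_ker X hm (sub_add_cancel m 1) (ha m (by omega))]
    exact good_cycles X hX hn ha (by omega) (sub_add_cancel m 1)
  have h2 : Good h (X.X i ⧸ LinearMap.range (toLin f)) := by
    rw [hf]
    exact h1.of_equiv (toLin (X.d i m)).quotKerEquivRange.symm
  exact exists_extend f u hu (h2 N hN 0)

/-- Any two linear tilting complexes that represent `L(l)` are related by a chain map that is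
compatible with the identifications of the homology. -/
theorem IsTiltingModel.exists_map (hq : IsQuasiHereditary h) {l : Λ} {T T' : Cplx 𝒜}
    {r : GrMod.kernel (T.d 0 (-1)) ⟶ L h l} {r' : GrMod.kernel (T'.d 0 (-1)) ⟶ L h l}
    (hT : IsTiltingModel h l T r) (hT' : IsTiltingModel h l T' r') :
    ∃ f : T ⟶ T', ∀ z : GrMod.kernel (T.d 0 (-1)),
      ∃ z' : GrMod.kernel (T'.d 0 (-1)), z'.1 = toLin (f.f 0) z.1 ∧ toLin r' z' = toLin r z := by
  obtain ⟨n, -, hn⟩ := hT.linear.exists_bound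
  obtain ⟨n', hn', -⟩ := hT'.linear.exists_bound
  have hgood := hT.linear.good hq
  have hco := hT'.linear.coGood
  have hex : ∀ i, i < 0 → ExactAt T i := fun i hi => hT.exact i hi.ne
  have hZ : Good h (GrMod.kernel (T.d 0 (-1))) := good_cycles T hgood hn hex le_rfl (by norm_num)
  -- The identification of homology is first lifted to a map of cycles and then extended to `T_0`.
  -- From there the chain map is built by lifting in positive positions and by extending in negative
  -- ones.
  obtain ⟨v, hv⟩ := exists_lift r' r (fun x => hT'.surjective _) (hZ _ (hT'.coGood_ker hq) 0)
  obtain ⟨g₀, hg₀⟩ := exists_extend_cycles hgood hn hex le_rfl (neg_add_cancel 1)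
    (kernelι (T.d 0 (-1))) (Submodule.range_subtype _) (v ≫ kernelι _) (fun y hy => by
      rw [kernelι_injective _ (hy.trans (map_zero _).symm), map_zero]) (hco 0)
  have hg₀' : ∀ z : GrMod.kernel (T.d 0 (-1)), (toLin v z).1 = toLin g₀ z.1 := fun z =>
    (congrArg (fun t => toLin t z) hg₀).symm
  obtain ⟨ψ, hψ, -, hcomm⟩ := exists_int_family (H := fun i => T.X i ⟶ T'.X i) (a := 0)
    (fun i g => (∀ m, m + 1 = i → ∀ x, toLin (T.d i m) x = 0 → toLin (T'.d i m) (toLin g x) = 0) ∧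
      ∀ j, i + 1 = j → ∀ x, ∃ y, toLin (T'.d j i) y = toLin g (toLin (T.d j i) x))
    (fun i j g g' => g' ≫ T'.d j i = T.d j i ≫ g) g₀ ⟨by
      intro m hm x hx
      obtain rfl : m = -1 := by omega
      rw [← hg₀' ⟨x, hx⟩]
      exact (toLin v ⟨x, hx⟩).2, by
      intro j hj x
      obtain rfl : j = 1 := by omega
      obtain ⟨z, hz⟩ : ∃ z : GrMod.kernel (T.d 0 (-1)), z.1 = toLin (T.d 1 0) x :=
        ⟨⟨_, toLin_d_d T x⟩, rfl⟩
      have h1 : toLin r z = 0 := (hT.ker z).mpr ⟨x, hz.symm⟩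
      have h2 : toLin r' (toLin v z) = 0 := (congrArg (fun t => toLin t z) hv).trans h1
      obtain ⟨y, hy⟩ := (hT'.ker _).mp h2
      exact ⟨y, hy.trans ((hg₀' z).trans (congrArg (toLin g₀) hz))⟩⟩ (by
      rintro i j hij hi g ⟨hgZ, hgB⟩
      obtain ⟨g', hg'⟩ := exists_lift (T'.d j i) (T.d j i ≫ g) (hgB j hij)
        (hgood j _ (coGood_cycles hq T' hco hn' (fun i (hi : 1 ≤ i) => hT'.exact i (by omega))
          (by omega) hij) 0)
      have hg'' : ∀ x, toLin (T'.d j i) (toLin g' x) = toLin g (toLin (T.d j i) x) := fun x =>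
        congrArg (fun t => toLin t x) hg'
      refine ⟨g', ⟨?_, ?_⟩, hg'⟩
      · intro m hm x hx
        obtain rfl : m = i := by omega
        rw [hg'', hx, map_zero]
      · intro j' hj' x
        refine (exactAt_iff T' hj' hij).mp (hT'.exact j (by omega)) _ ?_
        rw [hg'', toLin_d_d, map_zero]) (by
      rintro i j hij hi g ⟨hgZ, hgB⟩
      obtain ⟨g', hg'⟩ := exists_extend_cycles hgood hn hex hi.le (sub_add_cancel i 1) (T.d j i)
        (range_eq_ker T hij (sub_add_cancel i 1) (hex i hi)) (g ≫ T'.d j i) (hgZ i hij) (hco i)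
      have hg'' : ∀ x, toLin g' (toLin (T.d j i) x) = toLin (T'.d j i) (toLin g x) := fun x =>
        congrArg (fun t => toLin t x) hg'
      refine ⟨g', ⟨?_, ?_⟩, hg'.symm⟩
      · intro m hm x hx
        obtain ⟨y, rfl⟩ := (exactAt_iff T hij hm).mp (hex i hi) x hx
        rw [hg'', toLin_d_d]
      · intro j' hj' x
        obtain rfl : j = j' := by omega
        exact ⟨_, (hg'' x).symm⟩)
  refine ⟨mkChainMap ψ hcomm, fun z => ⟨toLin v z, ?_, ?_⟩⟩
  · rw [hg₀' z, ← hψ]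
    rfl
  · rw [← toLin_comp, hv]

end TiltingModels

end BGG
namespace BGG

/-! ### Gluing tilting coresolutions into a tilting model -/

section TwistedSums

open GrMod

variable {k A : Type u} [Field k] [Ring A] [Algebra k A] [Module.Finite k A]
variable {Λ : Type w} [Fintype Λ] [LinearOrder Λ]
variable {𝒜 : ℤ → Submodule k A} [GradedAlgebra 𝒜] {e : Λ → A} {h : IsPositivelyGraded 𝒜 e}

/-- The direct sum of two complexes with the differential `(t, s) ↦ (d t + f s, -d s)`. -/
def twistedSum (T S : Cplx 𝒜) (f : ∀ i j, S.X i ⟶ T.X j) (hf₀ : ∀ i j, j + 1 ≠ i → f i j = 0)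
    (hf : ∀ i j m, j + 1 = i → m + 1 = j → f i j ≫ T.d j m = S.d i j ≫ f j m) : Cplx 𝒜 where
  X i := (T.X i).prod (S.X i)
  d i j := prodLift (prodFst _ _ ≫ T.d i j + prodSnd _ _ ≫ f i j) (-(prodSnd _ _ ≫ S.d i j))
  shape i j hij := by
    rw [T.shape i j hij, S.shape i j hij, hf₀ i j hij]
    simp only [Limits.comp_zero, add_zero, neg_zero]
    rfl
  d_comp_d' i j m hij hjm := by
    refine GrMod.hom_ext fun x => Prod.ext ?_ ?_
    · change toLin (T.d j m) (toLin (T.d i j) x.1 + toLin (f i j) x.2) +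
        toLin (f j m) (-toLin (S.d i j) x.2) = 0
      have h1 := congrArg (fun t => toLin t x.2) (hf i j m hij hjm)
      simp only [toLin_comp] at h1
      rw [map_add, toLin_d_d, h1, map_neg, zero_add, add_neg_cancel]
    · change -toLin (S.d j m) (-toLin (S.d i j) x.2) = 0
      rw [map_neg, neg_neg, toLin_d_d]

theorem IsLinearTilting.of_bound {X : Cplx 𝒜}
    (hX : ∀ i, (X.X i).IsDirectSumOf fun M => ∃ m, IsTilting h m (M.shift i)) {a b : ℤ}
    (ha : ∀ i, a < i → Subsingleton (X.X i)) (hb : ∀ i, i < b → Subsingleton (X.X i)) :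
    IsLinearTilting h X := by
  refine ⟨hX, (max |a| |b|).toNat, fun i hi => ?_⟩
  rw [Int.toNat_of_nonneg (le_max_of_le_left (abs_nonneg a)), max_lt_iff] at hi
  rcases le_or_gt 0 i with h0 | h0
  · rw [abs_of_nonneg h0] at hi
    exact ha i ((le_abs_self a).trans_lt hi.1)
  · rw [abs_of_neg h0] at hi
    exact hb i (by linarith [neg_abs_le b])

theorem twistedSum_isLinearTilting {T S : Cplx 𝒜} {f : ∀ i j, S.X i ⟶ T.X j} {hf₀ hf}
    (hT : IsLinearTilting h T) (hS : IsLinearTilting h S) :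
    IsLinearTilting h (twistedSum T S f hf₀ hf) := by
  obtain ⟨a, ha, ha'⟩ := hT.exists_bound
  obtain ⟨b, hb, hb'⟩ := hS.exists_bound
  refine IsLinearTilting.of_bound (a := max a b) (b := min (-a) (-b)) (fun i => ?_)
    (fun i hi => ?_) (fun i hi => ?_)
  · obtain ⟨D⟩ := (hT.linear i).decomposition
    obtain ⟨D'⟩ := (hS.linear i).decomposition
    exact (D.prod D').isDirectSumOf
  · rw [max_lt_iff] at hi
    have := ha i hi.1
    have := hb i hi.2
    exact inferInstanceAs (Subsingleton (T.X i × S.X i))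
  · rw [lt_min_iff] at hi
    have := ha' i hi.1
    have := hb' i hi.2
    exact inferInstanceAs (Subsingleton (T.X i × S.X i))

/-- The zero complex. -/
def zeroCplx : Cplx 𝒜 where
  X _ := GrMod.zero
  d _ _ := 0

instance subsingleton_zeroCplx (i : ℤ) : Subsingleton ((zeroCplx : Cplx 𝒜).X i) :=
  inferInstanceAs (Subsingleton PUnit)

theorem zeroCplx_isLinearTilting : IsLinearTilting h (zeroCplx : Cplx 𝒜) :=
  .of_bound (a := 0) (b := 0) (fun _ => (Decomposition.ofSubsingleton _ _).isDirectSumOf)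
    (fun _ _ => inferInstance) fun _ _ => inferInstance

/-- Coresolutions `0 → M → S_a → S_{a-1} → ⋯` by linear tilting complexes. -/
structure IsTiltingCoresolution (h : IsPositivelyGraded 𝒜 e) (a : ℤ) (M : GrMod 𝒜) (S : Cplx 𝒜)
    (ι : M ⟶ S.X a) : Prop where
  linear : IsLinearTilting h S
  zero : ∀ i, a < i → Subsingleton (S.X i)
  injective : Function.Injective (toLin ι)
  range : ∀ m, m + 1 = a → LinearMap.range (toLin ι) = LinearMap.ker (toLin (S.d a m))
  exact : ∀ i, i < a → ExactAt S i

/-- The shift of a complex in the homological and the internal grading. -/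
def shiftCplx (X : Cplx 𝒜) (a : ℤ) : Cplx 𝒜 where
  X i := (X.X (i - a)).shift (-a)
  d i j := shiftHom (X.d (i - a) (j - a)) (-a)
  shape i j hij := by
    rw [X.shape (i - a) (j - a) fun h0 => hij (by simp at h0 ⊢; omega)]
    rfl
  d_comp_d' i j m _ _ := GrMod.hom_ext fun x => toLin_d_d X (i := i - a) x

theorem exists_coresolution_standard (hb : IsBalanced h) (a : ℤ) {M : GrMod 𝒜}
    (hM : IsShiftedStandard h a M) : ∃ S ι, IsTiltingCoresolution h a M S ι := by
  obtain ⟨l, ⟨φ⟩⟩ := hM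
  obtain ⟨X, f, hX, hf⟩ := hb.standard l
  -- The shifted complex has `X (a - a)` in position `a`; a variable index equal to zero avoids
  -- transport along `a - a = 0`.
  have key : ∀ b : ℤ, b = 0 → ∃ f : Δ h l ⟶ X.X b, Function.Injective (toLin f) ∧
      ∀ m, m + 1 = b → LinearMap.range (toLin f) = LinearMap.ker (toLin (X.d b m)) := by
    rintro _ rfl
    refine ⟨f, hf.injective, fun m hm => ?_⟩
    obtain rfl : m = -1 := by omega
    ext x
    exact (hf.exact_zero x).symm
  obtain ⟨g, hg, hgr⟩ := key (a - a) (sub_self a)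
  obtain ⟨n, hn, hn'⟩ := hX.exists_bound
  refine ⟨shiftCplx X a, φ.hom ≫ shiftHom g (-a), .of_bound (a := n + a) (b := -n + a) (fun i => ?_)
    (fun i hi => hn (i - a) (by omega)) (fun i hi => hn' (i - a) (by omega)),
    fun i hi => hf.zero (i - a) (by omega), ?_, ?_, ?_⟩
  · obtain ⟨D⟩ := (hX.linear (i - a)).decomposition
    refine (D.shift (-a) (S' := fun M => ∃ m, IsTilting h m (M.shift i)) ?_).isDirectSumOf
    rintro N ⟨m, hm⟩
    refine ⟨m, ?_⟩
    rwa [shift_shift, show -a + i = i - a by ring]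
  · exact hg.comp (toLinearEquiv φ).injective
  · intro m hm
    refine Eq.trans ?_ (hgr (m - a) (by omega))
    ext x
    constructor
    · rintro ⟨y, rfl⟩
      exact ⟨toLin φ.hom y, rfl⟩
    · rintro ⟨y, rfl⟩
      obtain ⟨z, rfl⟩ := (toLinearEquiv φ).surjective y
      exact ⟨z, rfl⟩
  · intro i hi
    refine (exactAt_iff _ rfl (sub_add_cancel i 1)).mpr fun x hx => ?_
    exact (exactAt_iff X (i := i - a) (by ring) (by ring)).mp (hf.exact (i - a) (by omega)) x hx

theorem exists_coresolution (hb : IsBalanced h) (a : ℤ) {M : GrMod 𝒜}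
    (hM : IsDirectSumOf (IsShiftedStandard h a) M) : ∃ S ι, IsTiltingCoresolution h a M S ι := by
  refine IsDirectSumOf.induction (p := fun M => ∃ S ι, IsTiltingCoresolution h a M S ι)
    ?_ ?_ ?_ hM
  · intro M hM
    refine ⟨zeroCplx, 0, zeroCplx_isLinearTilting, fun _ _ => inferInstance,
      fun x y _ => Subsingleton.elim _ _, fun m _ => Subsingleton.elim _ _, fun i hi => ?_⟩
    exact (exactAt_iff _ rfl (sub_add_cancel i 1)).mpr fun x _ => ⟨0, Subsingleton.elim _ _⟩
  · rintro M N hM ⟨S, ι, hS⟩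
    obtain ⟨S', ι', hS'⟩ := exists_coresolution_standard hb a hM
    refine ⟨twistedSum S' S (fun _ _ => 0) (fun _ _ _ => rfl) fun _ _ _ _ _ => by simp,
      prodLift (prodFst _ _ ≫ ι') (prodSnd _ _ ≫ ι), twistedSum_isLinearTilting hS'.linear hS.linear,
      ?_, ?_, ?_, ?_⟩
    · intro i hi
      have := hS.zero i hi
      have := hS'.zero i hi
      exact inferInstanceAs (Subsingleton (S'.X i × S.X i))
    · intro x y hxy
      exact Prod.ext (hS'.injective (congrArg Prod.fst hxy)) (hS.injective (congrArg Prod.snd hxy))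
    · intro m hm
      ext x
      have h1 := fun y => SetLike.ext_iff.mp (hS.range m hm) y
      have h1' := fun y => SetLike.ext_iff.mp (hS'.range m hm) y
      constructor
      · rintro ⟨y, rfl⟩
        refine Prod.ext ?_ ?_
        · exact (add_zero _).trans ((h1' _).mp ⟨y.1, rfl⟩)
        · exact neg_eq_zero.mpr ((h1 _).mp ⟨y.2, rfl⟩)
      · intro hx
        obtain ⟨y, hy⟩ := (h1' x.1).mpr ((add_zero _).symm.trans (congrArg Prod.fst hx))
        obtain ⟨z, hz⟩ := (h1 x.2).mpr (neg_eq_zero.mp (congrArg Prod.snd hx))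
        exact ⟨(y, z), Prod.ext hy hz⟩
    · intro i hi
      refine (exactAt_iff _ rfl (sub_add_cancel i 1)).mpr fun x hx => ?_
      obtain ⟨y, hy⟩ := (exactAt_iff S' rfl (sub_add_cancel i 1)).mp (hS'.exact i hi) x.1
        ((add_zero _).symm.trans (congrArg Prod.fst hx))
      obtain ⟨z, hz⟩ := (exactAt_iff S rfl (sub_add_cancel i 1)).mp (hS.exact i hi) x.2
        (neg_eq_zero.mp (congrArg Prod.snd hx))
      refine ⟨(y, -z), Prod.ext ((add_zero _).trans hy) ?_⟩
      refine (congrArg Neg.neg (map_neg (toLin (S.d (i + 1) i)) z)).trans ?_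
      rw [neg_neg, hz]
  · rintro M N φ ⟨S, ι, hS⟩
    refine ⟨S, φ.inv ≫ ι, hS.linear, hS.zero, hS.injective.comp (toLinearEquiv φ).symm.injective,
      fun m hm => ?_, hS.exact⟩
    rw [← hS.range m hm]
    ext x
    constructor
    · rintro ⟨y, rfl⟩
      exact ⟨toLin φ.inv y, rfl⟩
    · rintro ⟨y, rfl⟩
      obtain ⟨z, rfl⟩ := (toLinearEquiv φ).symm.surjective y
      exact ⟨z, rfl⟩

/-- A linear tilting complex that contains the part of `D` in positions up to `n`, with exact
quotient. -/
structure IsTiltingEnvelope (h : IsPositivelyGraded 𝒜 e) (D : Cplx 𝒜) (n : ℤ) (T : Cplx 𝒜)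
    (φ : ∀ i, D.X i ⟶ T.X i) : Prop where
  linear : IsLinearTilting h T
  zero : ∀ i, n < i → Subsingleton (T.X i)
  injective : ∀ i, i ≤ n → Function.Injective (toLin (φ i))
  comm : ∀ i j, i + 1 = j → j ≤ n → ∀ x,
    toLin (T.d j i) (toLin (φ j) x) = toLin (φ i) (toLin (D.d j i) x)
  exact : ∀ i j m, i + 1 = j → m + 1 = i → ∀ (t : T.X i) (x : D.X m),
    toLin (T.d i m) t = toLin (φ m) x → ∃ y t', t = toLin (φ i) y + toLin (T.d j i) t'

/-- The map from `D_{n+1}` to `T_n` extends along the coresolution step by step to the right: the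
successive cokernels are `Good` and the terms of `T` are `CoGood`. The result is the connecting map
of a twisted sum. -/
theorem IsTiltingEnvelope.exists_connecting (hq : IsQuasiHereditary h) {D : Cplx 𝒜} {n : ℤ}
    {T : Cplx 𝒜} {φ : ∀ i, D.X i ⟶ T.X i} (hT : IsTiltingEnvelope h D n T φ) {S : Cplx 𝒜}
    {ι : D.X (n + 1) ⟶ S.X (n + 1)} (hS : IsTiltingCoresolution h (n + 1) (D.X (n + 1)) S ι) :
    ∃ f : ∀ i j, S.X i ⟶ T.X j, (∀ i j, j + 1 ≠ i → f i j = 0) ∧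
      (∀ i j m, j + 1 = i → m + 1 = j → f i j ≫ T.d j m = S.d i j ≫ f j m) ∧
      ι ≫ f (n + 1) n = D.d (n + 1) n ≫ φ n := by
  obtain ⟨b, -, hb⟩ := hS.linear.exists_bound
  have hgood := hS.linear.good hq
  have hco := hT.linear.coGood
  obtain ⟨g₀, hg₀⟩ := exists_extend_cycles hgood hb hS.exact le_rfl rfl ι (hS.range n rfl)
    (D.d (n + 1) n ≫ φ n)
    (fun y hy => by rw [hS.injective (hy.trans (map_zero _).symm), map_zero]) (hco n)
  have hg₀' : ∀ x, toLin g₀ (toLin ι x) = toLin (φ n) (toLin (D.d (n + 1) n) x) := fun x =>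
    congrArg (fun t => toLin t x) hg₀
  -- The family is indexed by the position `j` of the target; the source position enters through an
  -- equation `j + 1 = i`, which keeps both indices free in the final statement.
  obtain ⟨ψ, hψ, -, hcomm⟩ := exists_int_family (H := fun j => ∀ i, j + 1 = i → (S.X i ⟶ T.X j))
    (a := n)
    (fun j g => ∀ i hij m, m + 1 = j → ∀ x, toLin (S.d i j) x = 0 →
      toLin (T.d j m) (toLin (g i hij) x) = 0)
    (fun m j g g' => ∀ hmj i hij, g' i hij ≫ T.d j m = S.d i j ≫ g j hmj)
    (fun i hi => eqToHom (by rw [hi]) ≫ g₀) (by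
      rintro _ rfl m hm x hx
      have h1 : x ∈ LinearMap.range (toLin ι) := by
        rw [hS.range n rfl]
        exact hx
      obtain ⟨y, rfl⟩ := h1
      beta_reduce
      rw [eqToHom_refl, Category.id_comp, hg₀', hT.comm m n hm le_rfl, toLin_d_d, map_zero]) (by
      intro m j hmj hm g _
      refine ⟨fun _ _ => 0, fun i hij m _ x _ => by rw [toLin_zero, map_zero], ?_⟩
      intro _ i hij
      have := hS.zero i (by omega)
      exact GrMod.hom_ext fun x => by rw [Subsingleton.elim x 0, map_zero, map_zero]) (by
      rintro i j hij hi g hg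
      obtain ⟨g', hg'⟩ := exists_extend_cycles hgood hb hS.exact (i := j) (by omega) hij
        (S.d (j + 1) j) (range_eq_ker S rfl hij (hS.exact j (by omega)))
        (g (j + 1) rfl ≫ T.d j i) (hg (j + 1) rfl i hij) (hco i)
      subst hij
      refine ⟨fun j' hj' => eqToHom (by rw [hj']) ≫ g', ?_, ?_⟩
      · rintro _ rfl m hm x hx
        obtain ⟨y, rfl⟩ := (exactAt_iff S rfl rfl).mp (hS.exact (i + 1) (by omega)) x hx
        have h1 := congrArg (fun t => toLin t y) hg'
        simp only [toLin_comp] at h1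
        beta_reduce
        rw [eqToHom_refl, Category.id_comp, h1, toLin_d_d]
      · rintro _ _ rfl
        beta_reduce
        rw [eqToHom_refl, Category.id_comp, hg'])
  refine ⟨fun i j => if hij : j + 1 = i then ψ j i hij else 0, fun i j hij => dif_neg hij, ?_, ?_⟩
  · intro i j m hij hjm
    beta_reduce
    rw [dif_pos hij, dif_pos hjm]
    exact hcomm m j hjm hjm i hij
  · beta_reduce
    rw [dif_pos rfl, hψ]
    beta_reduce
    rw [eqToHom_refl, Category.id_comp, hg₀]

/-- The term `D_{n+1}` is replaced by its coresolution and attached to `T` by the connecting map.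
Since both the old quotient and the coresolution are exact, so is the new quotient. -/
theorem IsTiltingEnvelope.succ (hq : IsQuasiHereditary h) (hb : IsBalanced h) {D : Cplx 𝒜}
    (hD : IsLinearStandard h D) {n : ℤ} {T : Cplx 𝒜} {φ : ∀ i, D.X i ⟶ T.X i}
    (hT : IsTiltingEnvelope h D n T φ) : ∃ T' φ', IsTiltingEnvelope h D (n + 1) T' φ' := by
  obtain ⟨S, ι, hS⟩ := exists_coresolution hb (n + 1) (hD (n + 1))
  obtain ⟨f, hf₀, hf, hfι⟩ := hT.exists_connecting hq hS
  obtain ⟨ι', hι', hι₀⟩ : ∃ ι' : ∀ i, D.X i ⟶ S.X i, ι' (n + 1) = ι ∧ ∀ i, i ≠ n + 1 → ι' i = 0 :=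
    ⟨Function.update (fun _ => 0) (n + 1) ι, Function.update_self .., fun i hi =>
      Function.update_of_ne hi ..⟩
  have hι₀' : ∀ i, i ≠ n + 1 → ∀ x, toLin (ι' i) x = 0 := fun i hi x => by
    rw [hι₀ i hi, toLin_zero]
  subst hι'
  refine ⟨twistedSum T S f hf₀ hf, fun i => prodLift (φ i) (ι' i),
    twistedSum_isLinearTilting hT.linear hS.linear, ?_, ?_, ?_, ?_⟩
  · intro i hi
    have := hT.zero i (by omega)
    have := hS.zero i hi
    exact inferInstanceAs (Subsingleton (T.X i × S.X i))
  · intro i hi x y hxy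
    by_cases hin : i = n + 1
    · subst hin
      exact hS.injective (congrArg Prod.snd hxy)
    · exact hT.injective i (by omega) (congrArg Prod.fst hxy)
  · intro i j hij hj x
    refine Prod.ext ?_ ?_
    · change toLin (T.d j i) (toLin (φ j) x) + toLin (f j i) (toLin (ι' j) x) =
        toLin (φ i) (toLin (D.d j i) x)
      by_cases hjn : j = n + 1
      · subst hjn
        obtain rfl : i = n := by omega
        have := hT.zero (i + 1) (by omega)
        have h1 := congrArg (fun t => toLin t x) hfι
        simp only [toLin_comp] at h1
        rw [h1, Subsingleton.elim (toLin (φ (i + 1)) x) 0, map_zero, zero_add]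
      · rw [hι₀' j hjn, map_zero, add_zero, hT.comm i j hij (by omega)]
    · change -toLin (S.d j i) (toLin (ι' j) x) = toLin (ι' i) (toLin (D.d j i) x)
      rw [hι₀' i (by omega), neg_eq_zero]
      by_cases hjn : j = n + 1
      · subst hjn
        have h1 : toLin (ι' (n + 1)) x ∈ LinearMap.range (toLin (ι' (n + 1))) := ⟨x, rfl⟩
        rw [hS.range i hij] at h1
        exact h1
      · rw [hι₀' j hjn, map_zero]
  · rintro i j m hij hmi ⟨t, s⟩ x hts
    have h1 : toLin (T.d i m) t + toLin (f i m) s = toLin (φ m) x := congrArg Prod.fst hts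
    have h2 : -toLin (S.d i m) s = toLin (ι' m) x := congrArg Prod.snd hts
    -- Below `n + 1`, `s` is a boundary; subtracting it leaves a problem in `T`. At `n + 1`, `T` is
    -- zero and `s` lies in the image of `D`. Above, everything is zero.
    rcases lt_trichotomy i (n + 1) with hi | rfl | hi
    · rw [hι₀' m (by omega), neg_eq_zero] at h2
      obtain ⟨s', rfl⟩ := (exactAt_iff S hij hmi).mp (hS.exact i hi) s h2
      have h3 := congrArg (fun t => toLin t s') (hf j i m hij hmi)
      simp only [toLin_comp] at h3
      obtain ⟨y, t', ht'⟩ := hT.exact i j m hij hmi (t + toLin (f j i) s') x (by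
        rw [map_add, h3, h1])
      refine ⟨y, (t', -s'), Prod.ext ?_ ?_⟩
      · change t = toLin (φ i) y + (toLin (T.d j i) t' + toLin (f j i) (-s'))
        rw [map_neg, ← add_assoc, ← ht', add_neg_cancel_right]
      · change toLin (S.d j i) s' = toLin (ι' i) y + -toLin (S.d j i) (-s')
        rw [hι₀' i hi.ne, map_neg, neg_neg, zero_add]
    · rw [hι₀' m (by omega), neg_eq_zero] at h2
      have h3 : s ∈ LinearMap.range (toLin (ι' (n + 1))) := by
        rw [hS.range m hmi]
        exact h2
      obtain ⟨y, rfl⟩ := h3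
      have := hT.zero (n + 1) (by omega)
      refine ⟨y, 0, ?_⟩
      rw [map_zero, add_zero]
      exact Prod.ext (Subsingleton.elim _ _) rfl
    · have := hT.zero i (by omega)
      have := hS.zero i hi
      exact ⟨0, 0, Prod.ext (Subsingleton.elim _ _) (Subsingleton.elim _ _)⟩

theorem exists_tiltingEnvelope (hq : IsQuasiHereditary h) (hb : IsBalanced h) {D : Cplx 𝒜}
    (hD : IsLinearStandard h D) (hD₀ : ∀ i < 0, Subsingleton (D.X i)) (n : ℕ) :
    ∃ T φ, IsTiltingEnvelope h D (-1 + n) T φ := by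
  induction n with
  | zero =>
    -- At position `-1` nothing has to be embedded, because `D` is zero in negative positions.
    refine ⟨zeroCplx, fun _ => 0, zeroCplx_isLinearTilting, fun _ _ => inferInstance, ?_,
      fun _ _ _ _ _ => Subsingleton.elim _ _,
      fun _ _ _ _ _ _ _ _ => ⟨0, 0, Subsingleton.elim _ _⟩⟩
    intro i hi x y _
    have := hD₀ i (by simp at hi; omega)
    exact Subsingleton.elim _ _
  | succ n ih =>
    obtain ⟨T, φ, hT⟩ := ih
    have := hT.succ hq hb hD
    rwa [show (-1 + (n : ℤ)) + 1 = -1 + ((n + 1 : ℕ) : ℤ) by push_cast; ring] at this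

/-- A simple module with a BGG resolution is represented by a linear tilting complex that contains
the resolution. -/
theorem IsBGGResolution.exists_tiltingModel (hq : IsQuasiHereditary h) (hb : IsBalanced h) {l : Λ}
    {D : Cplx 𝒜} {p : D.X 0 ⟶ L h l} (hD : IsBGGResolution h l D p) :
    ∃ (T : Cplx 𝒜) (r : GrMod.kernel (T.d 0 (-1)) ⟶ L h l) (f : D ⟶ T),
      IsTiltingModel h l T r ∧ Compatible h p r f ∧ ∀ i, Function.Injective (toLin (f.f i)) := by
  -- With `Fintype.card Λ + 1` steps from position `-1`, the envelope reaches position `Fintype.card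
  -- Λ`, beyond which `D` vanishes.
  obtain ⟨T, φ, hT⟩ := exists_tiltingEnvelope hq hb hD.linear hD.zero (Fintype.card Λ + 1)
  have hbd : ∀ i, -1 + ((Fintype.card Λ + 1 : ℕ) : ℤ) < i → Subsingleton (D.X i) := fun i hi =>
    hD.bounded hq (by push_cast at hi; omega)
  have hinj : ∀ i, Function.Injective (toLin (φ i)) := by
    intro i
    rcases le_or_gt i (-1 + ((Fintype.card Λ + 1 : ℕ) : ℤ)) with hi | hi
    · exact hT.injective i hi
    · have := hbd i hi
      exact fun x y _ => Subsingleton.elim _ _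
  have hcomm : ∀ i j, i + 1 = j → ∀ x,
      toLin (T.d j i) (toLin (φ j) x) = toLin (φ i) (toLin (D.d j i) x) := by
    intro i j hij x
    rcases le_or_gt j (-1 + ((Fintype.card Λ + 1 : ℕ) : ℤ)) with hj | hj
    · exact hT.comm i j hij hj x
    · have := hbd j hj
      rw [Subsingleton.elim x 0]
      simp only [map_zero]
  have hD1 := hD.zero (-1) (by norm_num)
  -- Exactness of the quotient means that every cycle in `T_0` has the form `φ x + d t`. The
  -- identification `r` sends it to `p x`, obtained by descending along the surjection `q` from `D_0
  -- ⊕ T_1` onto the cycles.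
  obtain ⟨q, hq'⟩ := exists_factor (kernelι_injective (T.d 0 (-1)))
    (prodFst (D.X 0) (T.X 1) ≫ φ 0 + prodSnd (D.X 0) (T.X 1) ≫ T.d 1 0) fun x => by
      refine ⟨⟨toLin (φ 0) x.1 + toLin (T.d 1 0) x.2, ?_⟩, rfl⟩
      rw [LinearMap.mem_ker, map_add, toLin_d_d, hcomm (-1) 0 (by norm_num),
        Subsingleton.elim (toLin (D.d 0 (-1)) x.1) 0, map_zero, add_zero]
  have hq'' : ∀ (x : D.X 0) (t : T.X 1),
      (toLin q (x, t)).1 = toLin (φ 0) x + toLin (T.d 1 0) t := fun x t => hq' (x, t)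
  have hqs : Function.Surjective (toLin q) := by
    intro z
    obtain ⟨y, t, hyt⟩ := hT.exact 0 1 (-1) (by norm_num) (by norm_num) z.1 0
      (z.2.trans (map_zero _).symm)
    exact ⟨(y, t), Subtype.ext ((hq'' y t).trans hyt.symm)⟩
  have hp : ∀ x, toLin p x = 0 ↔ ∃ y, toLin (D.d 1 0) y = x := hD.exact.exact_zero
  obtain ⟨r, hr⟩ := exists_desc hqs (prodFst (D.X 0) (T.X 1) ≫ p) fun x hx => by
    have h1 : toLin (φ 0) x.1 + toLin (T.d 1 0) x.2 = 0 :=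
      (hq'' x.1 x.2).symm.trans (congrArg Subtype.val hx)
    -- Well-definedness: if `φ x + d t = 0`, exactness in position `1` makes `t` an image from `D_1`
    -- up to boundaries, so `x` is a boundary in `D` and `p x = 0`.
    obtain ⟨y, t, hyt⟩ := hT.exact 1 2 0 (by norm_num) (by norm_num) x.2 (-x.1) (by
      rw [map_neg]
      exact (neg_eq_of_add_eq_zero_right h1).symm)
    rw [hyt, map_add, toLin_d_d, add_zero, hcomm 0 1 (by norm_num), ← map_add] at h1
    have h2 := hinj 0 (h1.trans (map_zero _).symm)
    refine (hp _).mpr ⟨-y, ?_⟩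
    rw [map_neg]
    exact (eq_neg_of_add_eq_zero_left h2).symm
  have hr' : ∀ x t, toLin r (toLin q (x, t)) = toLin p x := fun x t => hr (x, t)
  have hqφ : ∀ x, (toLin q (x, 0)).1 = toLin (φ 0) x := fun x => by
    rw [hq'', map_zero, add_zero]
  refine ⟨T, r, mkChainMap φ fun i j hij => GrMod.hom_ext (hcomm i j hij),
    ⟨hT.linear, ?_, ?_, ?_⟩, ?_, hinj⟩
  · intro i hi
    refine (exactAt_iff T rfl (sub_add_cancel i 1)).mpr fun z hz => ?_
    obtain ⟨y, t, rfl⟩ := hT.exact i (i + 1) (i - 1) rfl (sub_add_cancel i 1) z 0 (by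
      rw [hz, map_zero])
    rw [map_add, toLin_d_d, add_zero, hcomm _ _ (sub_add_cancel i 1)] at hz
    have h1 := hinj _ (hz.trans (map_zero _).symm)
    obtain ⟨y', rfl⟩ : ∃ y', toLin (D.d (i + 1) i) y' = y := by
      rcases lt_or_gt_of_ne hi with hi | hi
      · have := hD.zero i hi
        exact ⟨0, Subsingleton.elim _ _⟩
      · exact (exactAt_iff D rfl (sub_add_cancel i 1)).mp (hD.exact.exact i hi) y h1
    exact ⟨toLin (φ (i + 1)) y' + t, by rw [map_add, hcomm i (i + 1) rfl]⟩
  · intro x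
    obtain ⟨y, rfl⟩ := hD.surjective x
    exact ⟨toLin q (y, 0), hr' y 0⟩
  · intro z
    obtain ⟨⟨x, t⟩, rfl⟩ := hqs z
    rw [hr', hq'', hp]
    constructor
    · rintro ⟨y, rfl⟩
      exact ⟨toLin (φ 1) y + t, by rw [map_add, hcomm 0 1 (by norm_num)]⟩
    · rintro ⟨y, hy⟩
      obtain ⟨y', t', h1⟩ := hT.exact 1 2 0 (by norm_num) (by norm_num) (y - t) x (by
        rw [map_sub, hy, add_sub_cancel_right])
      refine ⟨y', hinj 0 ?_⟩
      rw [← hcomm 0 1 (by norm_num)]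
      have h2 := congrArg (toLin (T.d 1 0)) h1
      rw [map_add, toLin_d_d, add_zero, map_sub, hy, add_sub_cancel_right] at h2
      exact h2.symm
  · intro x
    have h1 : toLin (φ 0) x ∈ LinearMap.ker (toLin (T.d 0 (-1))) := by
      rw [← hqφ]
      exact (toLin q (x, 0)).2
    exact ⟨h1, (congrArg (toLin r) (Subtype.ext (hqφ x).symm)).trans (hr' x 0)⟩

end TwistedSums

end BGG

/-! ### The main theorem -/

theorem mainTheorem7 {k A : Type u} [Field k] [IsAlgClosed k] [Ring A] [Algebra k A]
    [Module.Finite k A] {Λ : Type w} [Fintype Λ] [LinearOrder Λ]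
    (𝒜 : ℤ → Submodule k A) [GradedAlgebra 𝒜] (e : Λ → A)
    (h : BGG.IsPositivelyGraded 𝒜 e) (hq : BGG.IsQuasiHereditary h) (hb : BGG.IsBalanced h)
    (l : Λ)
    (hres : ∃ (D : BGG.Cplx 𝒜) (p : D.X 0 ⟶ BGG.L h l), BGG.IsBGGResolution h l D p) :
    (∀ (D D' : BGG.Cplx 𝒜) (p : D.X 0 ⟶ BGG.L h l) (p' : D'.X 0 ⟶ BGG.L h l),
      BGG.IsBGGResolution h l D p → BGG.IsBGGResolution h l D' p' →
        ∃ f : D ≅ D', f.hom.f 0 ≫ p' = p) ∧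
    (∃ (T : BGG.Cplx 𝒜) (r : BGG.GrMod.kernel (T.d 0 (-1)) ⟶ BGG.L h l),
      BGG.IsTiltingModel h l T r) ∧
    (∀ (T : BGG.Cplx 𝒜) (r : BGG.GrMod.kernel (T.d 0 (-1)) ⟶ BGG.L h l),
      BGG.IsTiltingModel h l T r →
        ∃ K : BGG.Subcomplex T, ∀ (D : BGG.Cplx 𝒜) (p : D.X 0 ⟶ BGG.L h l),
          BGG.IsBGGResolution h l D p →
            ∃ f : D ⟶ T, BGG.Compatible h p r f ∧
              (∀ g : D ⟶ T, BGG.Compatible h p r g → g = f) ∧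
              ∀ i, Function.Injective (BGG.GrMod.toLin (f.f i)) ∧
                LinearMap.range (BGG.GrMod.toLin (f.f i)) = K.obj i) := by
  obtain ⟨D₀, p₀, hD₀⟩ := hres
  obtain ⟨T₀, r₀, f₀, hT₀, hf₀, hinj₀⟩ := hD₀.exists_tiltingModel hq hb
  refine ⟨fun D D' p p' hD hD' => hD.exists_iso hD', ⟨T₀, r₀, hT₀⟩, fun T r hT => ?_⟩
  have hlift := hT.hwLifting hq hb
  obtain ⟨φ, hφ⟩ := hlift.exists_compatible hD₀.toIsBGGComplex
  obtain ⟨ψ, hψ⟩ := hT.exists_map hq hT₀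
  -- Both sides are compatible maps into the model `T₀`, so they coincide; injectivity of `f₀` then
  -- passes to `φ`.
  have hφψ : φ ≫ ψ = f₀ := by
    refine (hT₀.hwLifting hq hb).compatible_unique hD₀.toIsBGGComplex (fun x => ?_) hf₀
    obtain ⟨hx, hrx⟩ := hφ x
    obtain ⟨⟨z, hz⟩, rfl, hz'⟩ := hψ ⟨_, hx⟩
    exact ⟨hz, hz'.trans hrx⟩
  have hinj : ∀ i, Function.Injective (BGG.GrMod.toLin (φ.f i)) := by
    intro i x y hxy
    apply hinj₀ i
    rw [← hφψ, HomologicalComplex.comp_f, BGG.GrMod.toLin_comp, BGG.GrMod.toLin_comp, hxy]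
  -- The subcomplex is the image of the fixed resolution `D₀`. Any other resolution maps to `T`
  -- through an isomorphism with `D₀`, so it has the same image.
  refine ⟨⟨fun i => LinearMap.range (BGG.GrMod.toLin (φ.f i)),
    fun i => BGG.GrMod.isHomogeneous_range _, ?_⟩, fun D p hD => ?_⟩
  · rintro i _ ⟨x, rfl⟩
    exact ⟨_, (BGG.toLin_comm φ i (i - 1) x).symm⟩
  · obtain ⟨f, hf⟩ := hD.exists_iso hD₀
    have hcomp : BGG.Compatible h p r (f.hom ≫ φ) := by
      intro x
      obtain ⟨hx, hrx⟩ := hφ (BGG.GrMod.toLin (f.hom.f 0) x)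
      exact ⟨hx, hrx.trans (congrArg (fun t => BGG.GrMod.toLin t x) hf)⟩
    have hbij : ∀ i, Function.Bijective (BGG.GrMod.toLin (f.hom.f i)) := fun i =>
      (BGG.GrMod.toLinearEquiv
        ((HomologicalComplex.eval _ _ i).mapIso f)).bijective
    refine ⟨f.hom ≫ φ, hcomp, fun g hg => hlift.compatible_unique hD.toIsBGGComplex hg hcomp,
      fun i => ⟨(hinj i).comp (hbij i).1, ?_⟩⟩
    ext x
    constructor
    · rintro ⟨y, rfl⟩
      exact ⟨_, rfl⟩
    · rintro ⟨y, rfl⟩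
      obtain ⟨z, rfl⟩ := (hbij i).2 y
      exact ⟨z, rfl⟩
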